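/- **Setting.** Let $\Bbbk$ be a commutative ring and $A$ an associative $\Bbbk$-superalgebra with a finite homogeneous $\Bbbk$-basis $B$; $\bar a\in\mathbb Z_2$ denotes the parity of a homogeneous $a$, and equations involving parities are stated for homogeneous elements and extended linearly. A *homogeneous trace map* of parity $\varepsilon$ is a $\Bbbk$-linear map $\operatorname{tr}\colon A\to\Bbbk$ vanishing on elements of parity $\ne\varepsilon$ and such that the pairing $(a,b)\mapsto\operatorname{tr}(ab)$ is perfect. It has a Nakayama automorphism $\psi$, determined by $\operatorname{tr}(ab)=(-1)^{\bar a\bar b}\operatorname{tr}(b\psi(a))$, and a left dual basis $\{b^\vee\}_{b\in B}$, determined by $\operatorname{tr}(b^\vee c)=\delta_{b,c}$ for $b,c\in B$. *Polynomial algebras.* $\operatorname{Pol}_n(A)$ is the superalgebra generated by $A^{\otimes n}$ and elements $x_1,\dots,x_n$ of parity $\varepsilon$, subject to $x_ix_j=(-1)^{\varepsilon}x_jx_i$ for $i\ne j$, $a_ix_i=(-1)^{\varepsilon\bar a}x_i\psi(a)_i$ and $a_jx_i=(-1)^{\varepsilon\bar a}x_ia_j$ for $i\neq j$, where $a_i\in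 A^{\otimes n}$ has $a$ in the $i$-th factor and $1$ elsewhere. Write $x=x_1\in\operatorname{Pol}_1(A)$. Let $s_1$ be the superalgebra automorphism of $\operatorname{Pol}_2(A)$ exchanging $a_1\leftrightarrow a_2$, $x_1\leftrightarrow x_2$, let $t_{i,j}=\sum_{b\in B}(-1)^{\varepsilon\bar b}b_i(b^\vee)_j$, and let $\partial_1$ be the $\Bbbk$-linear operator on $\operatorname{Pol}_2(A)$ with $\partial_1(A^{\otimes2})=0$, $\partial_1(x_1)=t_{1,2}$, $\partial_1(x_2)=-t_{2,1}$ and $\partial_1(fg)=\partial_1(f)g+s_1(f)\partial_1(g)$. Let $\mathcal E_A$ be the set of even central regular (i.e. neither left nor right zero-divisor) elements of $\operatorname{Pol}_1(A)$, and for $Q\in\mathcal E_A$ let $Q_1$ be its image in $\operatorname{Pol}_2(A)$ under $a\mapsto a_1$, $x\mapsto x_1$. *The category.* In a strict monoidal supercategory, $(f'\otimes g)\circ(f\otimes g')=(-1)^{\bar f\bar g}(f'\circ f)\otimes(g\circ g')$. The category $\mathcal{LAW}(A)$ is the strict $\Bbbk$-linear monoidal supercategory whose objects are the words in the set $\{\bullet\}\sqcup\mathcal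 E_A$ (the letter $\bullet$ is called black, the letters $Q\in\mathcal E_A$ red), with generating morphisms $$\sigma\colon\bullet\bullet\to\bullet\bullet,\quad \tau_a\colon\bullet\to\bullet\ (a\in A),\quad \xi\colon\bullet\to\bullet,\quad r_Q\colon Q\bullet\to\bullet Q,\quad \ell_Q\colon\bullet Q\to Q\bullet\ (Q\in\mathcal E_A),$$ the crossings $\sigma,r_Q,\ell_Q$ being even, the dot $\xi$ of parity $\varepsilon$, and the token $\tau_a$ of parity $\bar a$. For $f=\sum_ra_{(r)}x^r\in\operatorname{Pol}_1(A)$ put $f(\xi)=\sum_r\tau_{a_{(r)}}\xi^r$. For $f=\sum\lambda_{b,c,r,s}\,b_1c_2x_1^rx_2^s\in\operatorname{Pol}_2(A)$, with $b,c\in B$ and $\lambda_{b,c,r,s}\in\Bbbk$, put $f(\xi)_Q=\sum\lambda_{b,c,r,s}(\tau_b\otimes1_Q\otimes\tau_c)\circ(\xi^r\otimes1_Q\otimes\xi^s)$. The relations are, with $1$ denoting the identity of $\bullet$: * $a\mapsto\tau_a$ is a homomorphism of unital $\Bbbk$-algebras; * $\sigma^2=1\otimes 1$, $(\sigma\otimes1)(1\otimes\sigma)(\sigma\otimes1)=(1\otimes\sigma)(\sigma\otimes1)(1\otimes\sigma)$,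 $\sigma(\tau_a\otimes1)=(1\otimes\tau_a)\sigma$; * $\sigma(\xi\otimes1)=(1\otimes\xi)\sigma-\sum_{b\in B}(-1)^{\varepsilon\bar b}(\tau_b\otimes1)(1\otimes\tau_{b^\vee})$ and $\tau_a\xi=(-1)^{\varepsilon\bar a}\xi\tau_{\psi(a)}$; * $\ell_Q(z\otimes1_Q)=(1_Q\otimes z)\ell_Q$ and $r_Q(1_Q\otimes z)=(z\otimes1_Q)r_Q$ for $z=\tau_a$ and $z=\xi$; * $r_Q\ell_Q=Q(\xi)\otimes1_Q$ and $\ell_Qr_Q=1_Q\otimes Q(\xi)$; * $(\sigma\otimes1_Q)(1\otimes r_Q)(r_Q\otimes1)=(1\otimes r_Q)(r_Q\otimes1)(1_Q\otimes\sigma)$; * $(\ell_Q\otimes1)(1\otimes\ell_Q)(\sigma\otimes1_Q)=(1_Q\otimes\sigma)(\ell_Q\otimes1)(1\otimes\ell_Q)$; * $(r_Q\otimes1)(1_Q\otimes\sigma)(\ell_Q\otimes1)=(1\otimes\ell_Q)(\sigma\otimes1_Q)(1\otimes r_Q)-\partial_1(Q_1)(\xi)_Q$. *The algebras.* For $d\ge1$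 and a word $\mathbf Q$ in $\mathcal E_A$, let $\Gamma_{d,\mathbf Q}$ be the (finite) set of all words of length $d+|\mathbf Q|$ containing both $\bullet^d$ and $\mathbf Q$ as (not necessarily contiguous) subwords. Then $W^{\mathrm{aff}}_{d,\mathbf Q}(A)$ is the endomorphism superalgebra of $\bigoplus_{\mathbf i\in\Gamma_{d,\mathbf Q}}\mathbf i$ in the additive envelope of $\mathcal{LAW}(A)$. **Theorem.** Let $\operatorname{tr},\operatorname{tr}'$ be two homogeneous trace maps on the superalgebra $A$, of parities $\varepsilon,\varepsilon'$, and write $A$ and $A'$ for the resulting Frobenius superalgebras. Then there is a homogeneous invertible $u\in A$ of parity $\bar u=\varepsilon+\varepsilon'$ with $\operatorname{tr}'(a)=\operatorname{tr}(au)$ for all $a\in A$. For every such $u$ the following hold. 1. There is an isomorphism of superalgebras $\Psi\colon\operatorname{Pol}_1(A)\to\operatorname{Pol}_1(A')$ with $\Psi(a)=a$ for $a\in A$ and $\Psi(x)=(-1)^{\bar u}xu$. Consequently $\Psi(\mathcal E_A)=\mathcal E_{A'}$. 2. There is an isomorphism of strict $\Bbbk$-linear monoidal supercategories $\mathcal F\colon\mathcal{LAW}(A)\to\mathcal{LAW}(A')$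 given on objects by $\bullet\mapsto\bullet$, $Q\mapsto\Psi(Q)$, and on generating morphisms by $$\tau_a\mapsto\tau_a,\quad \xi\mapsto(-1)^{\bar u}\,\xi\circ\tau_u,\quad \sigma\mapsto\sigma,\quad r_Q\mapsto r_{\Psi(Q)},\quad \ell_Q\mapsto\ell_{\Psi(Q)}.$$ Its inverse $\mathcal G$ is given by $\bullet\mapsto\bullet$, $Q\mapsto\Psi^{-1}(Q)$ and $$\tau_a\mapsto\tau_a,\quad \xi\mapsto(-1)^{\bar u}\,\xi\circ\tau_{u^{-1}},\quad \sigma\mapsto\sigma,\quad r_Q\mapsto r_{\Psi^{-1}(Q)},\quad \ell_Q\mapsto\ell_{\Psi^{-1}(Q)}.$$ 3. For every $d\ge1$ and every word $\mathbf Q=Q^{(1)}\cdots Q^{(l)}$ in $\mathcal E_A$ there is an isomorphism of superalgebras $W^{\mathrm{aff}}_{d,\mathbf Q}(A)\cong W^{\mathrm{aff}}_{d,\mathcal F(\mathbf Q)}(A')$, where $\mathcal F(\mathbf Q)=\Psi(Q^{(1)})\cdots\Psi(Q^{(l)})$. -/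

import Mathlib

open scoped DirectSum

/-- The sign `(-1)^p` for a parity `p`. The sign `(-1)^(p q)` is `ksgn k (p * q)`. -/
def ksgn (k : Type*) [CommRing k] (p : ZMod 2) : k := if p = 0 then 1 else -1

theorem zmod_two_cases (p : ZMod 2) : p = 0 ∨ p = 1 := by revert p; decide

theorem ksgn_add (k : Type*) [CommRing k] (p q : ZMod 2) : ksgn k (p + q) = ksgn k p * ksgn k q := by
  rcases zmod_two_cases p with rfl | rfl <;> rcases zmod_two_cases q with rfl | rfl <;>
    simp [ksgn, show (1 : ZMod 2) + 1 = 0 from rfl]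

theorem ksgn_mul_self (k : Type*) [CommRing k] (p : ZMod 2) : ksgn k p * ksgn k p = 1 := by
  rcases zmod_two_cases p with rfl | rfl <;> simp [ksgn]

/-! ### Frobenius superalgebras -/

section Frobenius

variable {k A ι : Type*} [CommRing k] [Ring A] [Algebra k A]

/-- The bilinear form `(a, b) ↦ tr (a b)`. -/
noncomputable def traceForm (tr : A →ₗ[k] k) : A →ₗ[k] A →ₗ[k] k :=
  (LinearMap.mul k A).compr₂ tr

theorem traceForm_apply (tr : A →ₗ[k] k) (a b : A) : traceForm tr a b = tr (a * b) := rfl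

/-- A homogeneous trace map `tr : A → k` of parity `par`, making the superalgebra `A` (graded by
`𝒜`) a Frobenius superalgebra. The ground ring is purely even. -/
structure FrobeniusTrace (𝒜 : ZMod 2 → Submodule k A) where
  par : ZMod 2
  tr : A →ₗ[k] k
  homogeneous : ∀ p, p ≠ par → ∀ a ∈ 𝒜 p, tr a = 0
  perfect : (traceForm tr).IsPerfPair

/-- A finite homogeneous `k`-basis of the superalgebra. -/
structure HomogBasis (𝒜 : ZMod 2 → Submodule k A) (ι : Type*) where
  basis : Module.Basis ι k A
  deg : ι → ZMod 2
  mem : ∀ i, basis i ∈ 𝒜 (deg i)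

variable {𝒜 : ZMod 2 → Submodule k A}

/-- The left dual basis: `b^∨` is the element with `tr (b^∨ c) = δ_{b,c}`. -/
noncomputable def leftDual (B : HomogBasis 𝒜 ι) (T : FrobeniusTrace 𝒜) (i : ι) : A :=
  haveI := T.perfect
  (traceForm T.tr).toPerfPair.symm (B.basis.coord i)

theorem tr_leftDual_mul (B : HomogBasis 𝒜 ι) (T : FrobeniusTrace 𝒜) (i : ι) (a : A) :
    T.tr (leftDual B T i * a) = B.basis.repr a i := by
  have := T.perfect
  have h := LinearMap.apply_symm_toPerfPair_self (traceForm T.tr) (B.basis.coord i)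
  exact congrArg (fun f : Module.Dual k A => f a) h

theorem tr_right_ext (T : FrobeniusTrace 𝒜) {a b : A} (h : ∀ c, T.tr (c * a) = T.tr (c * b)) :
    a = b := by
  have := T.perfect
  apply (LinearMap.IsPerfPair.bijective_right (traceForm T.tr)).1
  ext c
  exact h c

theorem tr_left_ext (T : FrobeniusTrace 𝒜) {a b : A} (h : ∀ c, T.tr (a * c) = T.tr (b * c)) :
    a = b := by
  have := T.perfect
  apply (LinearMap.IsPerfPair.bijective_left (traceForm T.tr)).1
  ext c
  exact h c

theorem expand_basis [Fintype ι] (B : HomogBasis 𝒜 ι) (T : FrobeniusTrace 𝒜) (a : A) : a = ∑ i, T.tr (leftDual B T i * a) • B.basis i := by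
  simp only [tr_leftDual_mul]
  exact (B.basis.sum_repr a).symm

theorem expand_leftDual [Fintype ι] (B : HomogBasis 𝒜 ι) (T : FrobeniusTrace 𝒜) (a : A) : a = ∑ i, T.tr (a * B.basis i) • leftDual B T i := by
  apply tr_left_ext T
  intro c
  simp only [Finset.sum_mul, smul_mul_assoc, map_sum, map_smul, tr_leftDual_mul]
  conv_lhs => rw [← B.basis.sum_repr c]
  simp only [Finset.mul_sum, mul_smul_comm, map_sum, map_smul, smul_eq_mul]
  exact Finset.sum_congr rfl fun i _ => mul_comm _ _

variable [GradedAlgebra 𝒜]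

/-- `(a, b) ↦ (-1)^(ā b̄) tr (a b)`, extended bilinearly from homogeneous elements. -/
noncomputable def superTraceForm (T : FrobeniusTrace 𝒜) : A →ₗ[k] A →ₗ[k] k :=
  ∑ p : ZMod 2, ∑ q : ZMod 2, ksgn k (p * q) •
    (traceForm T.tr).compl₁₂ (GradedAlgebra.proj 𝒜 p) (GradedAlgebra.proj 𝒜 q)

theorem proj_of_mem {p q : ZMod 2} {a : A} (ha : a ∈ 𝒜 p) :
    GradedAlgebra.proj 𝒜 q a = if p = q then a else 0 := by
  rw [GradedAlgebra.proj_apply]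
  split_ifs with h
  · subst h; exact DirectSum.decompose_of_mem_same 𝒜 ha
  · exact DirectSum.decompose_of_mem_ne 𝒜 ha h

theorem sum_proj (a : A) : ∑ p : ZMod 2, GradedAlgebra.proj 𝒜 p a = a := by
  simp only [GradedAlgebra.proj_apply]
  classical
  conv_rhs => rw [← DirectSum.sum_support_decompose 𝒜 a]
  refine (Finset.sum_subset (Finset.subset_univ _) fun p _ hp => ?_).symm
  simpa using hp

theorem superTraceForm_apply (T : FrobeniusTrace 𝒜) {p q : ZMod 2} {a b : A} (ha : a ∈ 𝒜 p)
    (hb : b ∈ 𝒜 q) : superTraceForm T a b = ksgn k (p * q) * T.tr (a * b) := by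
  simp [superTraceForm, LinearMap.sum_apply, proj_of_mem ha, proj_of_mem hb, traceForm_apply]
  rw [Finset.sum_eq_single p, Finset.sum_eq_single q] <;> simp +contextual [eq_comm]

/-- The Nakayama automorphism `ψ`, determined by `tr (a b) = (-1)^(ā b̄) tr (b ψ(a))`. -/
noncomputable def nakayama (T : FrobeniusTrace 𝒜) : A →ₗ[k] A :=
  haveI := T.perfect
  (traceForm T.tr).flip.toPerfPair.symm.toLinearMap ∘ₗ superTraceForm T

theorem tr_mul_nakayama (T : FrobeniusTrace 𝒜) (a b : A) :
    T.tr (b * nakayama T a) = superTraceForm T a b := by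
  have := T.perfect
  exact LinearMap.apply_toPerfPair_flip (traceForm T.tr) (superTraceForm T a) b

theorem tr_mul_comm (T : FrobeniusTrace 𝒜) {p q : ZMod 2} {a b : A} (ha : a ∈ 𝒜 p)
    (hb : b ∈ 𝒜 q) : T.tr (a * b) = ksgn k (p * q) * T.tr (b * nakayama T a) := by
  rw [tr_mul_nakayama, superTraceForm_apply T ha hb, ← mul_assoc]
  rcases zmod_two_cases (p * q) with h | h <;> simp [h, ksgn]

theorem add_proj (p : ZMod 2) (a : A) :
    a = GradedAlgebra.proj 𝒜 p a + GradedAlgebra.proj 𝒜 (p + 1) a := by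
  conv_lhs => rw [← sum_proj (𝒜 := 𝒜) a]
  rcases zmod_two_cases p with rfl | rfl
  · exact Fin.sum_univ_two _
  · exact (Fin.sum_univ_two _).trans (add_comm _ _)

theorem mem_of_tr_right (T : FrobeniusTrace 𝒜) {p : ZMod 2} {a : A}
    (h : ∀ q, q + p ≠ T.par → ∀ c ∈ 𝒜 q, T.tr (c * a) = 0) : a ∈ 𝒜 p := by
  have key : GradedAlgebra.proj 𝒜 (p + 1) a = 0 := by
    apply tr_right_ext T
    intro c
    rw [mul_zero, map_zero, ← sum_proj (𝒜 := 𝒜) c, Finset.sum_mul, map_sum]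
    refine Finset.sum_eq_zero fun q _ => ?_
    have hq : GradedAlgebra.proj 𝒜 q c ∈ 𝒜 q := SetLike.coe_mem _
    have hpa : ∀ r, GradedAlgebra.proj 𝒜 r a ∈ 𝒜 r := fun r => SetLike.coe_mem _
    by_cases hqp : q + p = T.par
    · refine T.homogeneous (q + (p + 1)) ?_ _ (SetLike.mul_mem_graded hq (hpa _))
      rw [← hqp, ← add_assoc]; simp
    · have h1 := h q hqp _ hq
      have h2 : T.tr (GradedAlgebra.proj 𝒜 q c * GradedAlgebra.proj 𝒜 p a) = 0 :=
        T.homogeneous (q + p) hqp _ (SetLike.mul_mem_graded hq (hpa _))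
      rw [add_proj (𝒜 := 𝒜) p a, mul_add, map_add, h2, zero_add] at h1
      exact h1
  rw [add_proj (𝒜 := 𝒜) p a, key, add_zero]
  exact SetLike.coe_mem _

theorem mem_of_tr_left (T : FrobeniusTrace 𝒜) {p : ZMod 2} {a : A}
    (h : ∀ q, q + p ≠ T.par → ∀ c ∈ 𝒜 q, T.tr (a * c) = 0) : a ∈ 𝒜 p := by
  have key : GradedAlgebra.proj 𝒜 (p + 1) a = 0 := by
    apply tr_left_ext T
    intro c
    rw [zero_mul, map_zero, ← sum_proj (𝒜 := 𝒜) c, Finset.mul_sum, map_sum]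
    refine Finset.sum_eq_zero fun q _ => ?_
    have hq : GradedAlgebra.proj 𝒜 q c ∈ 𝒜 q := SetLike.coe_mem _
    have hpa : ∀ r, GradedAlgebra.proj 𝒜 r a ∈ 𝒜 r := fun r => SetLike.coe_mem _
    by_cases hqp : q + p = T.par
    · refine T.homogeneous ((p + 1) + q) ?_ _ (SetLike.mul_mem_graded (hpa _) hq)
      rw [← hqp, add_comm, ← add_assoc]; simp
    · have h1 := h q hqp _ hq
      have h2 : T.tr (GradedAlgebra.proj 𝒜 p a * GradedAlgebra.proj 𝒜 q c) = 0 :=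
        T.homogeneous (p + q) (by rwa [add_comm]) _ (SetLike.mul_mem_graded (hpa _) hq)
      rw [add_proj (𝒜 := 𝒜) p a, add_mul, map_add, h2, zero_add] at h1
      exact h1
  rw [add_proj (𝒜 := 𝒜) p a, key, add_zero]
  exact SetLike.coe_mem _

theorem nakayama_mem (T : FrobeniusTrace 𝒜) {p : ZMod 2} {a : A} (ha : a ∈ 𝒜 p) :
    nakayama T a ∈ 𝒜 p := by
  refine mem_of_tr_right T fun q hq c hc => ?_
  rw [tr_mul_nakayama, superTraceForm_apply T ha hc,
    T.homogeneous (p + q) (by rwa [add_comm]) _ (SetLike.mul_mem_graded ha hc), mul_zero]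

variable [Fintype ι] (B : HomogBasis 𝒜 ι) (T : FrobeniusTrace 𝒜)

theorem repr_eq_zero {q : ZMod 2} {c : A} (hc : c ∈ 𝒜 q) {i : ι} (hi : B.deg i ≠ q) :
    B.basis.repr c i = 0 := by
  classical
  have h : GradedAlgebra.proj 𝒜 (B.deg i) c = 0 := by
    rw [proj_of_mem hc, if_neg (Ne.symm hi)]
  have h2 := congrArg (fun x => B.basis.repr x i) h
  simp only [map_zero, Finsupp.coe_zero, Pi.zero_apply] at h2
  rw [← h2]
  conv_rhs => rw [← B.basis.sum_repr c]
  simp only [map_sum, map_smul, proj_of_mem (B.mem _), Finsupp.coe_finsetSum, Finset.sum_apply,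
    Finsupp.smul_apply, smul_eq_mul]
  rw [Finset.sum_eq_single i]
  · simp
  · intro j _ hj
    split_ifs
    · simp [hj]
    · simp
  · simp

theorem leftDual_mem (i : ι) : leftDual B T i ∈ 𝒜 (T.par + B.deg i) := by
  refine mem_of_tr_left T fun q hq c hc => ?_
  rw [tr_leftDual_mul]
  refine repr_eq_zero B hc fun h => hq ?_
  subst h
  rw [add_left_comm, CharTwo.add_self_eq_zero, add_zero]

end Frobenius

/-! ### Frobenius polynomial algebras -/

section Polynomials

variable {k A : Type*} [CommRing k] [Ring A] [Algebra k A]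
variable {𝒜 : ZMod 2 → Submodule k A} [GradedAlgebra 𝒜]

/-- Generators of `Pol_n(A)`: `tok i a` is the token `a` on strand `i`, `dot i` is `x_i`. -/
inductive PolGen (n : ℕ) (A : Type*) where
  | tok (i : Fin n) (a : A)
  | dot (i : Fin n)

/-- The defining relations of `Pol_n(A)`. The first five say that the tokens generate a copy of
the super tensor power of `A`. -/
inductive PolRel (T : FrobeniusTrace 𝒜) (n : ℕ) :
    FreeAlgebra k (PolGen n A) → FreeAlgebra k (PolGen n A) → Prop
  | tok_one (i : Fin n) : PolRel T n (FreeAlgebra.ι k (.tok i 1)) 1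
  | tok_add (i : Fin n) (a b : A) : PolRel T n (FreeAlgebra.ι k (.tok i (a + b)))
      (FreeAlgebra.ι k (.tok i a) + FreeAlgebra.ι k (.tok i b))
  | tok_smul (i : Fin n) (c : k) (a : A) : PolRel T n (FreeAlgebra.ι k (.tok i (c • a)))
      (c • FreeAlgebra.ι k (.tok i a))
  | tok_mul (i : Fin n) (a b : A) : PolRel T n (FreeAlgebra.ι k (.tok i (a * b)))
      (FreeAlgebra.ι k (.tok i a) * FreeAlgebra.ι k (.tok i b))
  | tok_comm (i j : Fin n) (hij : i ≠ j) (p q : ZMod 2) (a b : A) (ha : a ∈ 𝒜 p) (hb : b ∈ 𝒜 q) :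
      PolRel T n (FreeAlgebra.ι k (.tok i a) * FreeAlgebra.ι k (.tok j b))
        (ksgn k (p * q) • (FreeAlgebra.ι k (.tok j b) * FreeAlgebra.ι k (.tok i a)))
  | dot_comm (i j : Fin n) (hij : i ≠ j) :
      PolRel T n (FreeAlgebra.ι k (.dot i) * FreeAlgebra.ι k (.dot j))
        (ksgn k T.par • (FreeAlgebra.ι k (.dot j) * FreeAlgebra.ι k (.dot i)))
  | tok_dot (i : Fin n) (p : ZMod 2) (a : A) (ha : a ∈ 𝒜 p) :
      PolRel T n (FreeAlgebra.ι k (.tok i a) * FreeAlgebra.ι k (.dot i))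
        (ksgn k (T.par * p) • (FreeAlgebra.ι k (.dot i) * FreeAlgebra.ι k (.tok i (nakayama T a))))
  | tok_dot_ne (i j : Fin n) (hij : i ≠ j) (p : ZMod 2) (a : A) (ha : a ∈ 𝒜 p) :
      PolRel T n (FreeAlgebra.ι k (.tok j a) * FreeAlgebra.ι k (.dot i))
        (ksgn k (T.par * p) • (FreeAlgebra.ι k (.dot i) * FreeAlgebra.ι k (.tok j a)))

/-- The Frobenius polynomial algebra `Pol_n(A)`. -/
def Pol (T : FrobeniusTrace 𝒜) (n : ℕ) : Type _ := RingQuot (PolRel T n)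

namespace Pol

noncomputable instance (T : FrobeniusTrace 𝒜) (n : ℕ) : Ring (Pol T n) :=
  inferInstanceAs (Ring (RingQuot (PolRel T n)))

noncomputable instance (T : FrobeniusTrace 𝒜) (n : ℕ) : Algebra k (Pol T n) :=
  inferInstanceAs (Algebra k (RingQuot (PolRel T n)))

variable (T : FrobeniusTrace 𝒜) {n : ℕ}

/-- The quotient map from the free algebra. -/
noncomputable def mk : FreeAlgebra k (PolGen n A) →ₐ[k] Pol T n :=
  RingQuot.mkAlgHom k (PolRel T n)

theorem mk_rel {x y : FreeAlgebra k (PolGen n A)} (h : PolRel T n x y) : mk T x = mk T y :=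
  RingQuot.mkAlgHom_rel k h

/-- The element `a_i` of `Pol_n(A)`. -/
noncomputable def tok (i : Fin n) (a : A) : Pol T n :=
  mk T (FreeAlgebra.ι k (.tok i a))

/-- The element `x_i` of `Pol_n(A)`. -/
noncomputable def dot (i : Fin n) : Pol T n :=
  mk T (FreeAlgebra.ι k (.dot i))

theorem tok_one (i : Fin n) : tok T i 1 = 1 :=
  (mk_rel T (PolRel.tok_one (T := T) i)).trans (map_one _)

theorem tok_add (i : Fin n) (a b : A) : tok T i (a + b) = tok T i a + tok T i b :=
  (mk_rel T (PolRel.tok_add (T := T) i a b)).trans (map_add _ _ _)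

theorem tok_smul (i : Fin n) (c : k) (a : A) : tok T i (c • a) = c • tok T i a :=
  (mk_rel T (PolRel.tok_smul (T := T) i c a)).trans (map_smul _ _ _)

theorem tok_mul (i : Fin n) (a b : A) : tok T i (a * b) = tok T i a * tok T i b :=
  (mk_rel T (PolRel.tok_mul (T := T) i a b)).trans (map_mul _ _ _)

theorem tok_comm {i j : Fin n} (hij : i ≠ j) {p q : ZMod 2} {a b : A} (ha : a ∈ 𝒜 p)
    (hb : b ∈ 𝒜 q) : tok T i a * tok T j b = ksgn k (p * q) • (tok T j b * tok T i a) := by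
  simpa [tok] using mk_rel T (PolRel.tok_comm (T := T) i j hij p q a b ha hb)

theorem dot_comm {i j : Fin n} (hij : i ≠ j) :
    dot T i * dot T j = ksgn k T.par • (dot T j * dot T i) := by
  simpa [dot] using mk_rel T (PolRel.dot_comm (T := T) i j hij)

theorem tok_dot (i : Fin n) {p : ZMod 2} {a : A} (ha : a ∈ 𝒜 p) :
    tok T i a * dot T i = ksgn k (T.par * p) • (dot T i * tok T i (nakayama T a)) := by
  simpa [tok, dot] using mk_rel T (PolRel.tok_dot (T := T) i p a ha)

theorem tok_dot_ne {i j : Fin n} (hij : i ≠ j) {p : ZMod 2} {a : A} (ha : a ∈ 𝒜 p) :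
    tok T j a * dot T i = ksgn k (T.par * p) • (dot T i * tok T j a) := by
  simpa [tok, dot] using mk_rel T (PolRel.tok_dot_ne (T := T) i j hij p a ha)

/-- `a ↦ a_i` as a linear map. -/
noncomputable def tokLin (i : Fin n) : A →ₗ[k] Pol T n where
  toFun := tok T i
  map_add' := tok_add T i
  map_smul' := tok_smul T i

theorem tok_sum {J : Type*} (i : Fin n) (s : Finset J) (f : J → A) :
    tok T i (∑ j ∈ s, f j) = ∑ j ∈ s, tok T i (f j) := map_sum (tokLin T i) f s

/-- Homomorphisms out of `Pol_n(A)` are given on generators. -/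
noncomputable def lift {R : Type*} [Ring R] [Algebra k R] (f : PolGen n A → R)
    (h : ∀ ⦃x y⦄, PolRel T n x y → FreeAlgebra.lift k f x = FreeAlgebra.lift k f y) :
    Pol T n →ₐ[k] R :=
  (RingQuot.liftAlgHom k ⟨FreeAlgebra.lift k f, h⟩ : RingQuot (PolRel T n) →ₐ[k] R)

theorem lift_mk {R : Type*} [Ring R] [Algebra k R] (f : PolGen n A → R)
    (h : ∀ ⦃x y⦄, PolRel T n x y → FreeAlgebra.lift k f x = FreeAlgebra.lift k f y)
    (x : FreeAlgebra k (PolGen n A)) : lift T f h (mk T x) = FreeAlgebra.lift k f x :=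
  RingQuot.liftAlgHom_mkAlgHom_apply k _ h x

theorem lift_tok {R : Type*} [Ring R] [Algebra k R] (f : PolGen n A → R)
    (h : ∀ ⦃x y⦄, PolRel T n x y → FreeAlgebra.lift k f x = FreeAlgebra.lift k f y)
    (i : Fin n) (a : A) : lift T f h (tok T i a) = f (.tok i a) := by
  simp [lift_mk, tok]

theorem lift_dot {R : Type*} [Ring R] [Algebra k R] (f : PolGen n A → R)
    (h : ∀ ⦃x y⦄, PolRel T n x y → FreeAlgebra.lift k f x = FreeAlgebra.lift k f y)
    (i : Fin n) : lift T f h (dot T i) = f (.dot i) := by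
  simp [lift_mk, dot]

/-- Words in the homogeneous generators of `Pol_n(A)`, with their parities. -/
inductive IsWord : ZMod 2 → Pol T n → Prop
  | one : IsWord 0 1
  | tok_mul (i : Fin n) (p q : ZMod 2) (a : A) (w : Pol T n) : a ∈ 𝒜 p → IsWord q w →
      IsWord (p + q) (tok T i a * w)
  | dot_mul (i : Fin n) (q : ZMod 2) (w : Pol T n) : IsWord q w →
      IsWord (T.par + q) (dot T i * w)

/-- The parity `p` part of the superalgebra `Pol_n(A)`: a token has the parity of its label and
the `x_i` have the parity of the trace. -/
noncomputable def parity (p : ZMod 2) : Submodule k (Pol T n) := Submodule.span k {w | IsWord T p w}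

/-- The homomorphism `f ↦ f_i` from `Pol_1(A)` to `Pol_n(A)`. -/
noncomputable def incl (i : Fin n) : Pol T 1 →ₐ[k] Pol T n :=
  lift T (fun g => match g with
    | .tok _ a => tok T i a
    | .dot _ => dot T i) (by
    rintro x y (j | ⟨j, a, b⟩ | ⟨j, c, a⟩ | ⟨j, a, b⟩ | ⟨j, l, h, _, _, _, _, _, _⟩ | ⟨j, l, h⟩ |
      ⟨j, p, a, ha⟩ | ⟨j, l, h, _, _, _⟩)
    · simpa using tok_one T i
    · simpa using tok_add T i a b
    · simpa using tok_smul T i c a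
    · simpa using tok_mul T i a b
    · exact absurd (Subsingleton.elim j l) h
    · exact absurd (Subsingleton.elim j l) h
    · simpa using tok_dot T i ha
    · exact absurd (Subsingleton.elim j l) h)

/-- The set of even, central, regular elements of `Pol_1(A)`. (An even element is central in the
super sense if and only if it commutes with all elements.) -/
def evenCentralRegular : Set (Pol T 1) :=
  {f | f ∈ parity T 0 ∧ (∀ g, f * g = g * f) ∧ IsRegular f}

/-- Two algebra homomorphisms out of `Pol_n(A)` agreeing on generators are equal. -/
theorem hom_ext {R : Type*} [Ring R] [Algebra k R] {f g : Pol T n →ₐ[k] R}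
    (h1 : ∀ i a, f (tok T i a) = g (tok T i a)) (h2 : ∀ i, f (dot T i) = g (dot T i)) : f = g := by
  have h : f.comp (mk T) = g.comp (mk T) := by
    ext x
    rcases x with ⟨i, a⟩ | i
    · exact h1 i a
    · exact h2 i
  ext x
  obtain ⟨y, rfl⟩ := RingQuot.mkAlgHom_surjective k (PolRel T n) x
  exact DFunLike.congr_fun h y

section Demazure

variable {ι : Type*} [Fintype ι] (B : HomogBasis 𝒜 ι)

/-- The element `t_{i,j} = ∑_b (-1)^(ε b̄) b_i b^∨_j`. -/
noncomputable def tele (i j : Fin n) : Pol T n :=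
  ∑ b, ksgn k (T.par * B.deg b) • (tok T i (B.basis b) * tok T j (leftDual B T b))

theorem tok_mul_tele {i j : Fin n} {p : ZMod 2} {a : A} (ha : a ∈ 𝒜 p) :
    tok T i a * tele T B i j = ksgn k (T.par * p) • (tele T B i j * tok T j a) := by
  have h1 : ∀ b, tok T i a * tok T i (B.basis b) =
      ∑ c, T.tr (leftDual B T c * (a * B.basis b)) • tok T i (B.basis c) := fun b => by
    rw [← tok_mul, expand_basis B T (a * B.basis b), tok_sum]
    simp only [tok_smul, ← expand_basis B T (a * B.basis b)]
  have h2 : ∀ c, tok T j (leftDual B T c) * tok T j a =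
      ∑ b, T.tr (leftDual B T c * a * B.basis b) • tok T j (leftDual B T b) := fun c => by
    rw [← tok_mul, expand_leftDual B T (leftDual B T c * a), tok_sum]
    simp only [tok_smul, ← expand_leftDual B T (leftDual B T c * a)]
  simp only [tele, Finset.mul_sum, Finset.sum_mul, mul_smul_comm, smul_mul_assoc, mul_assoc (tok T i _), h2,
    Finset.smul_sum]
  simp only [← mul_assoc (tok T i _), h1, Finset.sum_mul, smul_mul_assoc, Finset.smul_sum]
  rw [Finset.sum_comm]
  refine Finset.sum_congr rfl fun c _ => Finset.sum_congr rfl fun b _ => ?_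
  rw [mul_assoc (leftDual B T c)]
  by_cases h : (T.par + B.deg c) + (p + B.deg b) = T.par
  · simp only [smul_smul, ← mul_assoc, ← ksgn_add]
    congr 3
    generalize T.par = e at *; generalize B.deg c = x at *; generalize B.deg b = y at *
    clear * - h
    revert e p x y; decide
  · rw [T.homogeneous _ h _ (SetLike.mul_mem_graded (leftDual_mem B T c)
      (SetLike.mul_mem_graded ha (B.mem b)))]
    simp

theorem tok_mul_tele' {i j : Fin n} (hij : i ≠ j) {p : ZMod 2} {a : A} (ha : a ∈ 𝒜 p) :
    tok T j a * tele T B i j = ksgn k (T.par * p) • (tele T B i j * tok T i (nakayama T a)) := by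
  have h1 : ∀ c, tok T j a * tok T j (leftDual B T c) =
      ∑ b, T.tr (a * leftDual B T c * B.basis b) • tok T j (leftDual B T b) := fun c => by
    rw [← tok_mul, expand_leftDual B T (a * leftDual B T c), tok_sum]
    simp only [tok_smul, ← expand_leftDual B T (a * leftDual B T c)]
  have h2 : ∀ b, tok T i (B.basis b) * tok T i (nakayama T a) =
      ∑ c, T.tr (leftDual B T c * (B.basis b * nakayama T a)) • tok T i (B.basis c) := fun b => by
    rw [← tok_mul, expand_basis B T (B.basis b * nakayama T a), tok_sum]
    simp only [tok_smul, ← expand_basis B T (B.basis b * nakayama T a)]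
  have hl : ∀ c, tok T j a * (tok T i (B.basis c) * tok T j (leftDual B T c)) =
      ∑ b, (ksgn k (p * B.deg c) * T.tr (a * leftDual B T c * B.basis b)) •
        (tok T i (B.basis c) * tok T j (leftDual B T b)) := fun c => by
    rw [← mul_assoc, tok_comm T hij.symm ha (B.mem c), smul_mul_assoc, mul_assoc, h1]
    simp only [Finset.mul_sum, mul_smul_comm, Finset.smul_sum, smul_smul]
  have hr : ∀ b, tok T i (B.basis b) * tok T j (leftDual B T b) * tok T i (nakayama T a) =
      ∑ c, (ksgn k ((T.par + B.deg b) * p) *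
        T.tr (leftDual B T c * (B.basis b * nakayama T a))) •
        (tok T i (B.basis c) * tok T j (leftDual B T b)) := fun b => by
    rw [mul_assoc, tok_comm T hij.symm (leftDual_mem B T b) (nakayama_mem T ha), mul_smul_comm,
      ← mul_assoc, h2]
    simp only [Finset.sum_mul, smul_mul_assoc, Finset.smul_sum, smul_smul]
  simp only [tele, Finset.mul_sum, Finset.sum_mul, mul_smul_comm, smul_mul_assoc, hl, hr,
    Finset.smul_sum, smul_smul]
  rw [Finset.sum_comm]
  refine Finset.sum_congr rfl fun b _ => Finset.sum_congr rfl fun c _ => ?_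
  congr 1
  have hm : leftDual B T c * B.basis b ∈ 𝒜 ((T.par + B.deg c) + B.deg b) :=
    SetLike.mul_mem_graded (leftDual_mem B T c) (B.mem b)
  rw [← mul_assoc (leftDual B T c), mul_assoc a, tr_mul_comm T ha hm]
  by_cases h : ((T.par + B.deg c) + B.deg b) + p = T.par
  · simp only [← mul_assoc, ← ksgn_add]
    congr 2
    generalize T.par = e at *; generalize B.deg c = x at *; generalize B.deg b = y at *
    clear * - h
    revert e p x y; decide
  · rw [T.homogeneous _ h _ (SetLike.mul_mem_graded hm (nakayama_mem T ha))]
    simp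

theorem tele_mul_dot {i j : Fin n} (hij : i ≠ j) :
    tele T B i j * dot T j = dot T j * tele T B j i := by
  have hψ : ∀ b, tok T j (nakayama T (leftDual B T b)) =
      ∑ c, T.tr (leftDual B T c * nakayama T (leftDual B T b)) • tok T j (B.basis c) := fun b => by
    rw [expand_basis B T (nakayama T (leftDual B T b)), tok_sum]
    simp only [tok_smul, ← expand_basis B T (nakayama T (leftDual B T b))]
  have hd : ∀ c, tok T i (leftDual B T c) =
      ∑ b, T.tr (leftDual B T b * leftDual B T c) • tok T i (B.basis b) := fun c => by
    rw [expand_basis B T (leftDual B T c), tok_sum]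
    simp only [tok_smul, ← expand_basis B T (leftDual B T c)]
  have hl : ∀ b, tok T i (B.basis b) * tok T j (leftDual B T b) * dot T j =
      ∑ c, (ksgn k (T.par * (T.par + B.deg b)) * ksgn k (T.par * B.deg b) *
        T.tr (leftDual B T c * nakayama T (leftDual B T b))) •
        (dot T j * (tok T i (B.basis b) * tok T j (B.basis c))) := fun b => by
    rw [mul_assoc, tok_dot T j (leftDual_mem B T b), mul_smul_comm, ← mul_assoc,
      tok_dot_ne T hij.symm (B.mem b), smul_mul_assoc, hψ]
    simp only [Finset.mul_sum, mul_smul_comm, Finset.smul_sum, smul_smul, mul_assoc]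
  have hr : ∀ c, dot T j * (tok T j (B.basis c) * tok T i (leftDual B T c)) =
      ∑ b, (ksgn k (B.deg c * (T.par + B.deg c)) * T.tr (leftDual B T b * leftDual B T c)) •
        (dot T j * (tok T i (B.basis b) * tok T j (B.basis c))) := fun c => by
    rw [tok_comm T hij.symm (B.mem c) (leftDual_mem B T c), hd]
    simp only [Finset.sum_mul, Finset.mul_sum, smul_mul_assoc, mul_smul_comm, Finset.smul_sum,
      smul_smul]
  simp only [tele, Finset.mul_sum, Finset.sum_mul, mul_smul_comm, smul_mul_assoc, hl, hr,
    Finset.smul_sum, smul_smul]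
  rw [Finset.sum_comm]
  refine Finset.sum_congr rfl fun c _ => Finset.sum_congr rfl fun b _ => ?_
  congr 1
  rw [tr_mul_comm T (leftDual_mem B T b) (leftDual_mem B T c)]
  by_cases h : (T.par + B.deg c) + (T.par + B.deg b) = T.par
  · simp only [← mul_assoc, ← ksgn_add]
    congr 2
    generalize T.par = e at *; generalize B.deg c = x at *; generalize B.deg b = y at *
    clear * - h
    revert e x y; decide
  · rw [T.homogeneous _ h _ (SetLike.mul_mem_graded (leftDual_mem B T c)
      (nakayama_mem T (leftDual_mem B T b)))]
    simp

/-- The nontrivial permutation of the two strands. -/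
def flip2 (i : Fin 2) : Fin 2 := Equiv.swap 0 1 i

/-- The simple transposition `s_1` acting on `Pol_2(A)` by superpermutation of the strands. -/
noncomputable def swap : Pol T 2 →ₐ[k] Pol T 2 :=
  lift T (fun g => match g with
    | .tok i a => tok T (flip2 i) a
    | .dot i => dot T (flip2 i)) (by
    have hf : ∀ i j : Fin 2, i ≠ j → flip2 i ≠ flip2 j := by decide
    rintro x y (i | ⟨i, a, b⟩ | ⟨i, c, a⟩ | ⟨i, a, b⟩ | ⟨i, j, h, p, q, a, b, ha, hb⟩ | ⟨i, j, h⟩ |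
      ⟨i, p, a, ha⟩ | ⟨i, j, h, p, a, ha⟩)
    · simpa using tok_one T _
    · simpa using tok_add T _ a b
    · simpa using tok_smul T _ c a
    · simpa using tok_mul T _ a b
    · simpa using tok_comm T (hf i j h) ha hb
    · simpa using dot_comm T (hf i j h)
    · simpa using tok_dot T _ ha
    · simpa using tok_dot_ne T (hf i j h) ha)

/-- The values of the Demazure operator on the `x_i`: `∂(x_1) = t_{1,2}`, `∂(x_2) = -t_{2,1}`
(strands are numbered from `0` here). -/
noncomputable def demazureDot (i : Fin 2) : Pol T 2 :=
  if i = 0 then tele T B 0 1 else -tele T B 1 0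

/-- The homomorphism `f ↦ (s(f), ∂(f); 0, f)` to upper triangular matrices. That it is
multiplicative is the twisted Leibniz rule `∂(f g) = ∂(f) g + s(f) ∂(g)`. -/
noncomputable def demazureHom : Pol T 2 →ₐ[k] Matrix (Fin 2) (Fin 2) (Pol T 2) :=
  lift T (fun g => match g with
    | .tok i a => !![tok T (flip2 i) a, 0; 0, tok T i a]
    | .dot i => !![dot T (flip2 i), demazureDot T B i; 0, dot T i]) (by
    have hf : ∀ i j : Fin 2, i ≠ j → j = flip2 i ∧ i = flip2 j ∧ flip2 i ≠ flip2 j := by decide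
    have hff : ∀ i : Fin 2, flip2 i ≠ i ∧ flip2 (flip2 i) = i := by decide
    have hd1 : ∀ (i : Fin 2) {p : ZMod 2} {a : A}, a ∈ 𝒜 p → tok T (flip2 i) a * demazureDot T B i =
        ksgn k (T.par * p) • (demazureDot T B i * tok T i (nakayama T a)) := by
      intro i p a ha
      fin_cases i
      · exact tok_mul_tele' T B (by decide) ha
      · simpa [demazureDot, flip2] using tok_mul_tele' T B (i := (1 : Fin 2)) (j := 0) (by decide) ha
    have hd2 : ∀ (i : Fin 2) {p : ZMod 2} {a : A}, a ∈ 𝒜 p → tok T i a * demazureDot T B i =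
        ksgn k (T.par * p) • (demazureDot T B i * tok T (flip2 i) a) := by
      intro i p a ha
      fin_cases i
      · exact tok_mul_tele T B ha
      · simpa [demazureDot, flip2] using tok_mul_tele T B (i := (1 : Fin 2)) (j := 0) ha
    have hd3 : ∀ i : Fin 2, demazureDot T B i * dot T (flip2 i) +
        dot T (flip2 i) * demazureDot T B (flip2 i) = 0 := by
      intro i
      fin_cases i
      · simp [demazureDot, flip2, tele_mul_dot T B (show (0 : Fin 2) ≠ 1 by decide)]
      · simp [demazureDot, flip2, tele_mul_dot T B (show (1 : Fin 2) ≠ 0 by decide)]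
    rintro x y (i | ⟨i, a, b⟩ | ⟨i, c, a⟩ | ⟨i, a, b⟩ | ⟨i, j, h, p, q, a, b, ha, hb⟩ | ⟨i, j, h⟩ |
      ⟨i, p, a, ha⟩ | ⟨i, j, h, p, a, ha⟩)
    · simp [tok_one, Matrix.one_fin_two]
    · simp [tok_add]
    · simp [tok_smul]
    · simp [tok_mul]
    · simp [tok_comm T h ha hb, tok_comm T (hf i j h).2.2 ha hb]
    · have h3 := hd3 i
      have h4 := hd3 (flip2 i)
      obtain ⟨rfl, -, h5⟩ := hf i j h
      simp only [(hff i).2] at h4 h5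
      rw [add_comm] at h3
      simp only [map_mul, map_smul, FreeAlgebra.lift_ι_apply, Matrix.mul_fin_two,
        Matrix.smul_of, Matrix.smul_cons, Matrix.smul_empty, (hff i).2]
      rw [dot_comm T h5, h3, (add_comm _ _).trans h4]
      simp [smul_smul, ksgn_mul_self]
    · simp [tok_dot T _ ha, hd1 i ha]
    · obtain ⟨rfl, -, h5⟩ := hf i j h
      simp only [(hff i).2] at h5
      simp [tok_dot_ne T h ha, tok_dot_ne T h5 ha, hd2 _ ha, (hff i).2])

/-- The Frobenius Demazure operator `∂_1` on `Pol_2(A)`. -/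
noncomputable def demazure : Pol T 2 →ₗ[k] Pol T 2 :=
  Matrix.entryLinearMap k (Pol T 2) 0 1 ∘ₗ (demazureHom T B).toLinearMap

theorem demazureHom_apply (f : Pol T 2) :
    demazureHom T B f = !![swap T f, demazure T B f; 0, f] := by
  obtain ⟨y, rfl⟩ := RingQuot.mkAlgHom_surjective k (PolRel T 2) f
  change demazureHom T B (mk T y) = !![swap T (mk T y), demazure T B (mk T y); 0, mk T y]
  suffices h : demazureHom T B (mk T y) 0 0 = swap T (mk T y) ∧ demazureHom T B (mk T y) 1 0 = 0 ∧
      demazureHom T B (mk T y) 1 1 = mk T y by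
    ext i j
    fin_cases i <;> fin_cases j
    · exact h.1
    · rfl
    · exact h.2.1
    · exact h.2.2
  induction y using FreeAlgebra.induction with
  | grade0 r => simp [Algebra.algebraMap_eq_smul_one]
  | grade1 x =>
    rcases x with ⟨i, a⟩ | i
    · change demazureHom T B (tok T i a) 0 0 = swap T (tok T i a) ∧
        demazureHom T B (tok T i a) 1 0 = 0 ∧ demazureHom T B (tok T i a) 1 1 = tok T i a
      simp [demazureHom, swap, lift_tok]
    · change demazureHom T B (dot T i) 0 0 = swap T (dot T i) ∧
        demazureHom T B (dot T i) 1 0 = 0 ∧ demazureHom T B (dot T i) 1 1 = dot T i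
      simp [demazureHom, swap, lift_dot]
  | mul a b ha hb => simp [Matrix.mul_apply, Fin.sum_univ_two, ha.1, ha.2.1, ha.2.2, hb.1, hb.2.1, hb.2.2]
  | add a b ha hb => simp [ha.1, ha.2.1, ha.2.2, hb.1, hb.2.1, hb.2.2]

theorem demazure_tok (i : Fin 2) (a : A) : demazure T B (tok T i a) = 0 := by
  simp [demazure, demazureHom, lift_tok]

theorem demazure_dot (i : Fin 2) :
    demazure T B (dot T i) = if i = 0 then tele T B 0 1 else -tele T B 1 0 := by
  simp [demazure, demazureHom, lift_dot, demazureDot]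

theorem demazure_mul (f g : Pol T 2) :
    demazure T B (f * g) = demazure T B f * g + swap T f * demazure T B g := by
  have h : demazure T B (f * g) = (demazureHom T B f * demazureHom T B g) 0 1 := by
    rw [← map_mul]; rfl
  rw [h, demazureHom_apply, demazureHom_apply]
  simp [Matrix.mul_apply, Fin.sum_univ_two, add_comm]

end Demazure

end Pol

end Polynomials


/-! ### Strict monoidal supercategories -/

universe u v w

/-- A strict `k`-linear monoidal supercategory. Morphism spaces are `k`-supermodules, composition
and tensor product are bilinear and even, and they satisfy the super interchange law. The objects
form a monoid under the tensor product. Equations between morphisms whose source and target agree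
only up to the monoid laws on objects are heterogeneous equalities. -/
structure MonoidalSupercat (k : Type u) [CommRing k] where
  Obj : Type v
  [monoid : Monoid Obj]
  Hom : Obj → Obj → Type w
  [addCommGroup : ∀ X Y, AddCommGroup (Hom X Y)]
  [module : ∀ X Y, Module k (Hom X Y)]
  parity : ∀ X Y, ZMod 2 → Submodule k (Hom X Y)
  isCompl_parity : ∀ X Y, IsCompl (parity X Y 0) (parity X Y 1)
  id : ∀ X, Hom X X
  comp : ∀ {X Y Z : Obj}, Hom Y Z →ₗ[k] Hom X Y →ₗ[k] Hom X Z
  tensor : ∀ {X Y X' Y' : Obj}, Hom X Y →ₗ[k] Hom X' Y' →ₗ[k] Hom (X * X') (Y * Y')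
  id_mem : ∀ X, id X ∈ parity X X 0
  comp_mem : ∀ {X Y Z p q} {f : Hom Y Z} {g : Hom X Y}, f ∈ parity Y Z p → g ∈ parity X Y q →
    comp f g ∈ parity X Z (p + q)
  tensor_mem : ∀ {X Y X' Y' p q} {f : Hom X Y} {g : Hom X' Y'}, f ∈ parity X Y p →
    g ∈ parity X' Y' q → tensor f g ∈ parity (X * X') (Y * Y') (p + q)
  id_comp : ∀ {X Y} (f : Hom X Y), comp (id Y) f = f
  comp_id : ∀ {X Y} (f : Hom X Y), comp f (id X) = f
  assoc : ∀ {X Y Z W} (f : Hom Z W) (g : Hom Y Z) (h : Hom X Y),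
    comp (comp f g) h = comp f (comp g h)
  tensor_id : ∀ X Y, tensor (id X) (id Y) = id (X * Y)
  interchange : ∀ {X Y Z X' Y' Z' p q} {f : Hom X Y} {g : Hom Y' Z'} (f' : Hom Y Z)
    (g' : Hom X' Y'), f ∈ parity X Y p → g ∈ parity Y' Z' q →
    comp (tensor f' g) (tensor f g') = ksgn k (p * q) • tensor (comp f' f) (comp g g')
  tensor_assoc : ∀ {X Y X' Y' X'' Y''} (f : Hom X Y) (g : Hom X' Y') (h : Hom X'' Y''),
    HEq (tensor (tensor f g) h) (tensor f (tensor g h))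
  one_tensor : ∀ {X Y} (f : Hom X Y), HEq (tensor (id 1) f) f
  tensor_one : ∀ {X Y} (f : Hom X Y), HEq (tensor f (id 1)) f

attribute [instance] MonoidalSupercat.monoid MonoidalSupercat.addCommGroup MonoidalSupercat.module

/-- A strict `k`-linear monoidal superfunctor acting on objects by the monoid homomorphism `φ`. -/
structure MonoidalSuperfunctor {k : Type*} [CommRing k] (C D : MonoidalSupercat k)
    (φ : C.Obj →* D.Obj) where
  map : ∀ {X Y : C.Obj}, C.Hom X Y →ₗ[k] D.Hom (φ X) (φ Y)
  map_mem : ∀ {X Y p} {f : C.Hom X Y}, f ∈ C.parity X Y p → map f ∈ D.parity (φ X) (φ Y) p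
  map_id : ∀ X, map (C.id X) = D.id (φ X)
  map_comp : ∀ {X Y Z} (f : C.Hom Y Z) (g : C.Hom X Y),
    map (C.comp f g) = D.comp (map f) (map g)
  map_tensor : ∀ {X Y X' Y'} (f : C.Hom X Y) (g : C.Hom X' Y'),
    HEq (map (C.tensor f g)) (D.tensor (map f) (map g))

/-- The superfunctors `F` and `G` are mutually inverse, on objects and on morphisms. -/
def MutuallyInverse {k : Type*} [CommRing k] {C D : MonoidalSupercat k} {φ : C.Obj →* D.Obj}
    {γ : D.Obj →* C.Obj} (F : MonoidalSuperfunctor C D φ) (G : MonoidalSuperfunctor D C γ) : Prop :=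
  ((∀ X, γ (φ X) = X) ∧ ∀ {X Y : C.Obj} (f : C.Hom X Y), HEq (G.map (F.map f)) f) ∧
  ((∀ X, φ (γ X) = X) ∧ ∀ {X Y : D.Obj} (f : D.Hom X Y), HEq (F.map (G.map f)) f)

/-! ### Endomorphism algebras in the additive envelope -/

/-- Matrices of morphisms, the morphisms `⨁ X_i → ⨁ X_i` of the additive envelope. The entry
`M j i` is the component from `X i` to `X j`. -/
def MonoidalSupercat.AddEnd {k : Type*} [CommRing k] (C : MonoidalSupercat k) {I : Type*}
    (X : I → C.Obj) : Type _ := ∀ j i : I, C.Hom (X i) (X j)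

namespace MonoidalSupercat.AddEnd

variable {k : Type*} [CommRing k] {C : MonoidalSupercat k} {I : Type*} {X : I → C.Obj}

instance : AddCommGroup (C.AddEnd X) :=
  inferInstanceAs (AddCommGroup (∀ j i : I, C.Hom (X i) (X j)))

instance : Module k (C.AddEnd X) :=
  inferInstanceAs (Module k (∀ j i : I, C.Hom (X i) (X j)))

theorem add_apply (M N : C.AddEnd X) (j i : I) : (M + N) j i = M j i + N j i := rfl

theorem smul_apply (c : k) (M : C.AddEnd X) (j i : I) : (c • M) j i = c • M j i := rfl

theorem zero_apply (j i : I) : (0 : C.AddEnd X) j i = 0 := rfl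

instance [Fintype I] : Mul (C.AddEnd X) := ⟨fun M N j i => ∑ l, C.comp (M j l) (N l i)⟩

theorem mul_apply [Fintype I] (M N : C.AddEnd X) (j i : I) : (M * N) j i = ∑ l, C.comp (M j l) (N l i) := rfl

open Classical in
noncomputable instance : One (C.AddEnd X) :=
  ⟨fun j i => if h : i = j then h ▸ C.id (X i) else 0⟩

theorem one_apply_self (i : I) : (1 : C.AddEnd X) i i = C.id (X i) := by
  simp [One.one, OfNat.ofNat]

theorem one_apply_ne {i j : I} (h : i ≠ j) : (1 : C.AddEnd X) j i = 0 := by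
  simp [One.one, OfNat.ofNat, h]

variable [Fintype I]

noncomputable instance : Ring (C.AddEnd X) :=
  { (inferInstance : AddCommGroup (C.AddEnd X)) with
    left_distrib := fun M N P => by
      funext j i
      simp [add_apply, mul_apply, Finset.sum_add_distrib]
    right_distrib := fun M N P => by
      funext j i
      simp [add_apply, mul_apply, Finset.sum_add_distrib]
    zero_mul := fun M => by
      funext j i
      simp [zero_apply, mul_apply]
    mul_zero := fun M => by
      funext j i
      simp [zero_apply, mul_apply]
    mul_assoc := fun M N P => by
      funext j i
      simp only [mul_apply, map_sum, LinearMap.sum_apply, C.assoc]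
      exact Finset.sum_comm
    one_mul := fun M => by
      funext j i
      rw [mul_apply, Finset.sum_eq_single j]
      · rw [one_apply_self, C.id_comp]
      · intro l _ hl
        rw [one_apply_ne hl, map_zero, LinearMap.zero_apply]
      · simp
    mul_one := fun M => by
      funext j i
      rw [mul_apply, Finset.sum_eq_single i]
      · rw [one_apply_self, C.comp_id]
      · intro l _ hl
        rw [one_apply_ne hl.symm, map_zero]
      · simp }

noncomputable instance : Algebra k (C.AddEnd X) :=
  Algebra.ofModule
    (fun c M N => by
      funext j i
      simp [mul_apply, smul_apply, Finset.smul_sum])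
    (fun c M N => by
      funext j i
      simp [mul_apply, smul_apply, Finset.smul_sum])

/-- The parity `p` part of the endomorphism superalgebra. -/
def parity (p : ZMod 2) : Submodule k (C.AddEnd X) where
  carrier := {M | ∀ j i, M j i ∈ C.parity (X i) (X j) p}
  add_mem' h h' j i := add_mem (h j i) (h' j i)
  zero_mem' _ _ := zero_mem _
  smul_mem' c _ h j i := Submodule.smul_mem _ c (h j i)

end MonoidalSupercat.AddEnd

/-! ### Presentations by generators and relations -/

/-- Generating objects and generating morphisms, with parities. -/
structure Signature where
  Letter : Type v
  Gen : FreeMonoid Letter → FreeMonoid Letter → Type w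
  parity : ∀ {X Y}, Gen X Y → ZMod 2

/-- Formal vertical and horizontal composites of the generating morphisms. In `tensor` the source
and target are allowed to be only propositionally equal to the concatenations. -/
inductive Diag (S : Signature.{v, w}) :
    FreeMonoid S.Letter → FreeMonoid S.Letter → Type (max v w)
  | id (X) : Diag S X X
  | gen {X Y} (g : S.Gen X Y) : Diag S X Y
  | comp {X Y Z} (f : Diag S Y Z) (g : Diag S X Y) : Diag S X Z
  | tensor {X Y X' Y' V W} (f : Diag S X Y) (g : Diag S X' Y') (hV : V = X * X')
      (hW : W = Y * Y') : Diag S V W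

namespace Diag

variable {S : Signature.{v, w}}

/-- The parity of a diagram is the sum of the parities of its generators. -/
def parity : ∀ {X Y}, Diag S X Y → ZMod 2
  | _, _, id _ => 0
  | _, _, gen g => S.parity g
  | _, _, comp f g => f.parity + g.parity
  | _, _, tensor f g _ _ => f.parity + g.parity

end Diag

section Presentation

variable (k : Type u) [CommRing k] (S : Signature.{v, w})

/-- Formal linear combinations of diagrams. -/
abbrev LDiag (X Y : FreeMonoid S.Letter) : Type _ := Diag S X Y →₀ k

variable {S}

/-- A diagram as a formal linear combination. -/
noncomputable def mono {X Y : FreeMonoid S.Letter} (D : Diag S X Y) : LDiag k S X Y :=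
  Finsupp.single D 1

/-- Bilinear extension of vertical composition. -/
noncomputable def compL {X Y Z : FreeMonoid S.Letter} :
    LDiag k S Y Z →ₗ[k] LDiag k S X Y →ₗ[k] LDiag k S X Z :=
  Finsupp.linearCombination k fun f => Finsupp.lmapDomain k k fun g => Diag.comp f g

/-- Bilinear extension of horizontal composition. -/
noncomputable def tensorL {X Y X' Y' V W : FreeMonoid S.Letter} (hV : V = X * X')
    (hW : W = Y * Y') : LDiag k S X Y →ₗ[k] LDiag k S X' Y' →ₗ[k] LDiag k S V W :=
  Finsupp.linearCombination k fun f => Finsupp.lmapDomain k k fun g => Diag.tensor f g hV hW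

theorem compL_mono {X Y Z : FreeMonoid S.Letter} (f : Diag S Y Z) (g : Diag S X Y) :
    compL k (mono k f) (mono k g) = mono k (f.comp g) := by
  simp [compL, mono]

theorem tensorL_mono {X Y X' Y' V W : FreeMonoid S.Letter} (hV : V = X * X') (hW : W = Y * Y')
    (f : Diag S X Y) (g : Diag S X' Y') :
    tensorL k hV hW (mono k f) (mono k g) = mono k (f.tensor g hV hW) := by
  simp [tensorL, mono]

/-- The span of the diagrams of parity `p`. -/
noncomputable def parityL (X Y : FreeMonoid S.Letter) (p : ZMod 2) : Submodule k (LDiag k S X Y) :=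
  Submodule.span k {x | ∃ D : Diag S X Y, D.parity = p ∧ x = mono k D}

variable {k}

/-- The elements that have to vanish: the given relations `R`, the axioms of a strict monoidal
supercategory, and everything obtained from these by composing and tensoring with diagrams. -/
inductive Relator (R : ∀ X Y, Set (LDiag k S X Y)) :
    ∀ {X Y : FreeMonoid S.Letter}, LDiag k S X Y → Prop
  | rel {X Y} (r : LDiag k S X Y) : r ∈ R X Y → Relator R r
  | id_comp {X Y} (f : Diag S X Y) : Relator R (mono k (.comp (.id Y) f) - mono k f)
  | comp_id {X Y} (f : Diag S X Y) : Relator R (mono k (.comp f (.id X)) - mono k f)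
  | assoc {X Y Z W} (f : Diag S Z W) (g : Diag S Y Z) (h : Diag S X Y) :
      Relator R (mono k (.comp (.comp f g) h) - mono k (.comp f (.comp g h)))
  | tensor_id {X Y V} (h h' : V = X * Y) :
      Relator R (mono k (.tensor (.id X) (.id Y) h h') - mono k (.id V))
  | interchange {X Y Z X' Y' Z' U V W} (f' : Diag S Y Z) (f : Diag S X Y) (g : Diag S Y' Z')
      (g' : Diag S X' Y') (hU : U = X * X') (hV hV' : V = Y * Y') (hW : W = Z * Z') :
      Relator R (mono k (.comp (.tensor f' g hV hW) (.tensor f g' hU hV')) -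
        ksgn k (f.parity * g.parity) • mono k (.tensor (.comp f' f) (.comp g g') hU hW))
  | tensor_assoc {X Y X' Y' X'' Y'' V W V' W' V'' W''} (f : Diag S X Y) (g : Diag S X' Y')
      (h : Diag S X'' Y'') (h1 : V' = X * X') (h2 : W' = Y * Y') (h3 : V = V' * X'')
      (h4 : W = W' * Y'') (h5 : V'' = X' * X'') (h6 : W'' = Y' * Y'') (h7 : V = X * V'')
      (h8 : W = Y * W'') :
      Relator R (mono k (.tensor (.tensor f g h1 h2) h h3 h4) -
        mono k (.tensor f (.tensor g h h5 h6) h7 h8))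
  | one_tensor {X Y} (f : Diag S X Y) (h : X = 1 * X) (h' : Y = 1 * Y) :
      Relator R (mono k (.tensor (.id 1) f h h') - mono k f)
  | tensor_one {X Y} (f : Diag S X Y) (h : X = X * 1) (h' : Y = Y * 1) :
      Relator R (mono k (.tensor f (.id 1) h h') - mono k f)
  | comp_left {X Y Z} (D : Diag S Y Z) (r : LDiag k S X Y) :
      Relator R r → Relator R (compL k (mono k D) r)
  | comp_right {X Y Z} (r : LDiag k S Y Z) (D : Diag S X Y) :
      Relator R r → Relator R (compL k r (mono k D))
  | tensor_left {X Y X' Y' V W} (D : Diag S X Y) (r : LDiag k S X' Y') (hV : V = X * X')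
      (hW : W = Y * Y') : Relator R r → Relator R (tensorL k hV hW (mono k D) r)
  | tensor_right {X Y X' Y' V W} (r : LDiag k S X Y) (D : Diag S X' Y') (hV : V = X * X')
      (hW : W = Y * Y') : Relator R r → Relator R (tensorL k hV hW r (mono k D))

/-- The tensor ideal generated by the relations `R`. -/
noncomputable def idealOf (R : ∀ X Y, Set (LDiag k S X Y)) (X Y : FreeMonoid S.Letter) :
    Submodule k (LDiag k S X Y) :=
  Submodule.span k {r | Relator R r}

theorem mono_induction {X Y : FreeMonoid S.Letter} {P : LDiag k S X Y → Prop}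
    (f : LDiag k S X Y) (zero : P 0) (add : ∀ f g, P f → P g → P (f + g))
    (smul : ∀ (c : k) D, P (c • mono k D)) : P f := by
  induction f using Finsupp.induction_linear with
  | zero => exact zero
  | add f g hf hg => exact add f g hf hg
  | single D c => simpa [mono] using smul c D

theorem mono_mem_parityL {X Y : FreeMonoid S.Letter} {D : Diag S X Y} {p : ZMod 2}
    (h : D.parity = p) : mono k D ∈ parityL k X Y p := Submodule.subset_span ⟨D, h, rfl⟩

theorem bilin_mem {M N P : Type*} [AddCommGroup M] [AddCommGroup N] [AddCommGroup P] [Module k M]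
    [Module k N] [Module k P] (b : M →ₗ[k] N →ₗ[k] P) {s : Set M} {t : Set N} {U : Submodule k P}
    (h : ∀ x ∈ s, ∀ y ∈ t, b x y ∈ U) {x : M} {y : N} (hx : x ∈ Submodule.span k s)
    (hy : y ∈ Submodule.span k t) : b x y ∈ U := by
  have h2 := Submodule.apply_mem_map₂ b hx hy
  rw [Submodule.map₂_span_span] at h2
  refine Submodule.span_le.2 ?_ h2
  rintro _ ⟨x, hx, y, hy, rfl⟩
  exact h x hx y hy

theorem compL_mem {X Y Z : FreeMonoid S.Letter} {p q : ZMod 2} {f : LDiag k S Y Z}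
    {g : LDiag k S X Y} (hf : f ∈ parityL k Y Z p) (hg : g ∈ parityL k X Y q) :
    compL k f g ∈ parityL k X Z (p + q) := by
  refine bilin_mem (compL k) ?_ hf hg
  rintro _ ⟨D, rfl, rfl⟩ _ ⟨E, rfl, rfl⟩
  rw [compL_mono]
  exact mono_mem_parityL rfl

theorem tensorL_mem {X Y X' Y' V W : FreeMonoid S.Letter} (hV : V = X * X') (hW : W = Y * Y')
    {p q : ZMod 2} {f : LDiag k S X Y} {g : LDiag k S X' Y'} (hf : f ∈ parityL k X Y p)
    (hg : g ∈ parityL k X' Y' q) : tensorL k hV hW f g ∈ parityL k V W (p + q) := by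
  refine bilin_mem (tensorL k hV hW) ?_ hf hg
  rintro _ ⟨D, rfl, rfl⟩ _ ⟨E, rfl, rfl⟩
  rw [tensorL_mono]
  exact mono_mem_parityL rfl

theorem isCompl_parityL (X Y : FreeMonoid S.Letter) :
    IsCompl (parityL k X Y 0) (parityL k X Y 1) := by
  have h : ∀ p, parityL k X Y p = Finsupp.supported k k {D : Diag S X Y | D.parity = p} := by
    intro p
    rw [Finsupp.supported_eq_span_single, parityL]
    congr 1
    ext x
    simp [mono, eq_comm]
  rw [h, h]
  constructor
  · apply Finsupp.disjoint_supported_supported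
    rw [Set.disjoint_left]
    intro D h0 h1
    exact absurd (h0.symm.trans h1) (by decide)
  · apply Finsupp.codisjoint_supported_supported
    refine codisjoint_iff.2 (Set.eq_univ_iff_forall.2 fun D => ?_)
    exact zmod_two_cases D.parity

/-- The relations are homogeneous. -/
def IsHomogRel (R : ∀ X Y : FreeMonoid S.Letter, Set (LDiag k S X Y)) : Prop :=
  ∀ X Y, ∀ r ∈ R X Y, ∃ p, r ∈ parityL k X Y p

theorem Relator.homog {R : ∀ X Y : FreeMonoid S.Letter, Set (LDiag k S X Y)} (hR : IsHomogRel R)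
    {X Y : FreeMonoid S.Letter} {r : LDiag k S X Y} (h : Relator R r) :
    ∃ p, r ∈ parityL k X Y p := by
  induction h with
  | rel r h => exact hR _ _ r h
  | id_comp f =>
    exact ⟨f.parity, sub_mem (mono_mem_parityL (by simp [Diag.parity])) (mono_mem_parityL rfl)⟩
  | comp_id f =>
    exact ⟨f.parity, sub_mem (mono_mem_parityL (by simp [Diag.parity])) (mono_mem_parityL rfl)⟩
  | assoc f g h =>
    exact ⟨_, sub_mem (mono_mem_parityL rfl) (mono_mem_parityL (by simp [Diag.parity, add_assoc]))⟩
  | tensor_id h h' =>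
    exact ⟨_, sub_mem (mono_mem_parityL rfl) (mono_mem_parityL (by simp [Diag.parity]))⟩
  | interchange f' f g g' _ _ _ _ =>
    exact ⟨_, sub_mem (mono_mem_parityL rfl) (Submodule.smul_mem _ _ (mono_mem_parityL (by
      simp only [Diag.parity]; abel)))⟩
  | tensor_assoc f g h _ _ _ _ _ _ _ _ =>
    exact ⟨_, sub_mem (mono_mem_parityL rfl) (mono_mem_parityL (by simp [Diag.parity, add_assoc]))⟩
  | one_tensor f _ _ =>
    exact ⟨f.parity, sub_mem (mono_mem_parityL (by simp [Diag.parity])) (mono_mem_parityL rfl)⟩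
  | tensor_one f _ _ =>
    exact ⟨f.parity, sub_mem (mono_mem_parityL (by simp [Diag.parity])) (mono_mem_parityL rfl)⟩
  | comp_left D r _ ih =>
    obtain ⟨p, hp⟩ := ih
    exact ⟨_, compL_mem (mono_mem_parityL rfl) hp⟩
  | comp_right r D _ ih =>
    obtain ⟨p, hp⟩ := ih
    exact ⟨_, compL_mem hp (mono_mem_parityL rfl)⟩
  | tensor_left D r hV hW _ ih =>
    obtain ⟨p, hp⟩ := ih
    exact ⟨_, tensorL_mem hV hW (mono_mem_parityL rfl) hp⟩
  | tensor_right r D hV hW _ ih =>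
    obtain ⟨p, hp⟩ := ih
    exact ⟨_, tensorL_mem hV hW hp (mono_mem_parityL rfl)⟩

/-- Morphisms of the presented category. -/
abbrev PHom (R : ∀ X Y, Set (LDiag k S X Y)) (X Y : FreeMonoid S.Letter) : Type _ :=
  LDiag k S X Y ⧸ idealOf R X Y

/-- The class of a formal linear combination of diagrams. -/
noncomputable def cls (R : ∀ X Y, Set (LDiag k S X Y)) {X Y : FreeMonoid S.Letter} :
    LDiag k S X Y →ₗ[k] PHom R X Y := (idealOf R X Y).mkQ

theorem cls_eq_zero {R : ∀ X Y, Set (LDiag k S X Y)} {X Y : FreeMonoid S.Letter}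
    {r : LDiag k S X Y} (h : Relator R r) : cls R r = 0 :=
  (Submodule.Quotient.mk_eq_zero _).2 (Submodule.subset_span h)

theorem cls_eq {R : ∀ X Y, Set (LDiag k S X Y)} {X Y : FreeMonoid S.Letter}
    {r s : LDiag k S X Y} (h : Relator R (r - s)) : cls R r = cls R s := by
  rw [← sub_eq_zero, ← map_sub]
  exact cls_eq_zero h

/-- A bilinear map on linear combinations of diagrams passes to the quotients as soon as it maps
pairs consisting of a relator and a diagram to relators. -/
noncomputable def quotBilin (R : ∀ X Y, Set (LDiag k S X Y)) {X Y X' Y' V W : FreeMonoid S.Letter}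
    (b : LDiag k S X Y →ₗ[k] LDiag k S X' Y' →ₗ[k] LDiag k S V W)
    (h1 : ∀ r D, Relator R r → Relator R (b r (mono k D)))
    (h2 : ∀ D r, Relator R r → Relator R (b (mono k D) r)) :
    PHom R X Y →ₗ[k] PHom R X' Y' →ₗ[k] PHom R V W :=
  LinearMap.liftQ₂ _ _ (b.compr₂ (cls R))
    (Submodule.span_le.2 fun r hr => LinearMap.mem_ker.2 <| LinearMap.ext fun g => by
      induction g using mono_induction with
      | zero => simp
      | add f g hf hg => rw [map_add, hf, hg]; simp
      | smul c D =>
        rw [map_smul, LinearMap.compr₂_apply, cls_eq_zero (h1 r D hr)]; simp)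
    (Submodule.span_le.2 fun r hr => LinearMap.mem_ker.2 <| LinearMap.ext fun g => by
      induction g using mono_induction with
      | zero => simp
      | add f g hf hg => rw [map_add, hf, hg]; simp
      | smul c D =>
        rw [map_smul, LinearMap.flip_apply, LinearMap.compr₂_apply, cls_eq_zero (h2 D r hr)]; simp)

/-- Composition in the presented category. -/
noncomputable def compQ (R : ∀ X Y, Set (LDiag k S X Y)) {X Y Z : FreeMonoid S.Letter} :
    PHom R Y Z →ₗ[k] PHom R X Y →ₗ[k] PHom R X Z :=
  quotBilin R (compL k) (fun r D h => .comp_right r D h) (fun D r h => .comp_left D r h)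

/-- Tensor product in the presented category. -/
noncomputable def tensorQ (R : ∀ X Y, Set (LDiag k S X Y)) {X Y X' Y' V W : FreeMonoid S.Letter}
    (hV : V = X * X') (hW : W = Y * Y') : PHom R X Y →ₗ[k] PHom R X' Y' →ₗ[k] PHom R V W :=
  quotBilin R (tensorL k hV hW) (fun r D h => .tensor_right r D hV hW h)
    (fun D r h => .tensor_left D r hV hW h)

/-- The parity `p` part of a morphism space of the presented category. -/
noncomputable def parityQ (R : ∀ X Y, Set (LDiag k S X Y)) (X Y : FreeMonoid S.Letter)
    (p : ZMod 2) : Submodule k (PHom R X Y) := (parityL k X Y p).map (cls R)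

section

variable {R : ∀ X Y : FreeMonoid S.Letter, Set (LDiag k S X Y)}

theorem compQ_cls {X Y Z : FreeMonoid S.Letter} (f : LDiag k S Y Z) (g : LDiag k S X Y) :
    compQ R (cls R f) (cls R g) = cls R (compL k f g) := rfl

theorem tensorQ_cls {X Y X' Y' V W : FreeMonoid S.Letter} (hV : V = X * X') (hW : W = Y * Y')
    (f : LDiag k S X Y) (g : LDiag k S X' Y') :
    tensorQ R hV hW (cls R f) (cls R g) = cls R (tensorL k hV hW f g) := rfl

theorem cls_induction {X Y : FreeMonoid S.Letter} {P : PHom R X Y → Prop} (f : PHom R X Y)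
    (zero : P 0) (add : ∀ f g, P f → P g → P (f + g)) (smul : ∀ (c : k) D, P (c • cls R (mono k D))) :
    P f := by
  obtain ⟨f, rfl⟩ := Submodule.mkQ_surjective _ f
  change P (cls R f)
  induction f using mono_induction with
  | zero => simpa using zero
  | add f g hf hg => rw [map_add]; exact add _ _ hf hg
  | smul c D => rw [map_smul]; exact smul c D

theorem id_memQ (X : FreeMonoid S.Letter) :
    cls R (mono k (Diag.id X)) ∈ parityQ R X X 0 :=
  ⟨mono k (Diag.id X), mono_mem_parityL rfl, rfl⟩

theorem compQ_mem {X Y Z : FreeMonoid S.Letter} {p q : ZMod 2} {f : PHom R Y Z}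
    {g : PHom R X Y} (hf : f ∈ parityQ R Y Z p) (hg : g ∈ parityQ R X Y q) :
    compQ R f g ∈ parityQ R X Z (p + q) := by
  obtain ⟨f, hf, rfl⟩ := hf
  obtain ⟨g, hg, rfl⟩ := hg
  exact ⟨_, compL_mem hf hg, rfl⟩

theorem tensorQ_mem {X Y X' Y' V W : FreeMonoid S.Letter} (hV : V = X * X') (hW : W = Y * Y')
    {p q : ZMod 2} {f : PHom R X Y} {g : PHom R X' Y'} (hf : f ∈ parityQ R X Y p)
    (hg : g ∈ parityQ R X' Y' q) : tensorQ R hV hW f g ∈ parityQ R V W (p + q) := by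
  obtain ⟨f, hf, rfl⟩ := hf
  obtain ⟨g, hg, rfl⟩ := hg
  exact ⟨_, tensorL_mem hV hW hf hg, rfl⟩

theorem isCompl_parityQ (hR : IsHomogRel R) (X Y : FreeMonoid S.Letter) :
    IsCompl (parityQ R X Y 0) (parityQ R X Y 1) := by
  have hc := isCompl_parityL (k := k) X Y
  have hI : idealOf R X Y ≤ (idealOf R X Y ⊓ parityL k X Y 0) ⊔ (idealOf R X Y ⊓ parityL k X Y 1) := by
    refine Submodule.span_le.2 fun r hr => ?_
    obtain ⟨p, hp⟩ := Relator.homog hR hr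
    have hr' : r ∈ idealOf R X Y := Submodule.subset_span hr
    rcases zmod_two_cases p with rfl | rfl
    · exact Submodule.mem_sup_left ⟨hr', hp⟩
    · exact Submodule.mem_sup_right ⟨hr', hp⟩
  constructor
  · rw [Submodule.disjoint_def]
    rintro x ⟨f, hf, rfl⟩ ⟨g, hg, hgf⟩
    have h1 : f - g ∈ idealOf R X Y := by
      rw [← Submodule.Quotient.mk_eq_zero, Submodule.Quotient.mk_sub, sub_eq_zero]
      exact hgf.symm
    obtain ⟨a, ha, b, hb, hab⟩ := Submodule.mem_sup.1 (hI h1)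
    have h2 : f - a = g + b := by
      rw [sub_eq_iff_eq_add, add_assoc, add_comm b a, hab]; abel
    have h3 : f - a = 0 := (Submodule.disjoint_def.1 hc.disjoint) _ (sub_mem hf ha.2)
      (h2 ▸ add_mem hg hb.2)
    rw [sub_eq_zero.1 h3]
    exact (Submodule.Quotient.mk_eq_zero _).2 ha.1
  · rw [codisjoint_iff, parityQ, parityQ, ← Submodule.map_sup, codisjoint_iff.1 hc.codisjoint,
      Submodule.map_top, cls, Submodule.range_mkQ]

theorem tensorQ_heq {X Y X' Y' V W : FreeMonoid S.Letter} (hV : V = X * X') (hW : W = Y * Y')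
    (f : PHom R X Y) (g : PHom R X' Y') :
    HEq (tensorQ R rfl rfl f g) (tensorQ R hV hW f g) := by
  subst hV hW; rfl

end

/-- The strict monoidal supercategory presented by the signature `S` and the relations `R`. -/
noncomputable def presented (R : ∀ X Y : FreeMonoid S.Letter, Set (LDiag k S X Y))
    (hR : IsHomogRel R) : MonoidalSupercat k where
  Obj := FreeMonoid S.Letter
  Hom := PHom R
  parity := parityQ R
  isCompl_parity := isCompl_parityQ hR
  id X := cls R (mono k (.id X))
  comp := compQ R
  tensor := tensorQ R rfl rfl
  id_mem := id_memQ
  comp_mem := compQ_mem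
  tensor_mem := tensorQ_mem rfl rfl
  id_comp f := by
    induction f using cls_induction with
    | zero => simp
    | add f g hf hg => rw [map_add, hf, hg]
    | smul c D => rw [map_smul, compQ_cls, compL_mono, cls_eq (.id_comp D)]
  comp_id f := by
    induction f using cls_induction with
    | zero => simp
    | add f g hf hg => rw [map_add, LinearMap.add_apply, hf, hg]
    | smul c D => rw [map_smul, LinearMap.smul_apply, compQ_cls, compL_mono, cls_eq (.comp_id D)]
  assoc f g h := by
    induction f using cls_induction with
    | zero => simp
    | add f f' hf hf' => simp only [map_add, LinearMap.add_apply, hf, hf']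
    | smul a D =>
    induction g using cls_induction with
    | zero => simp
    | add f f' hf hf' => simp only [map_add, LinearMap.add_apply, hf, hf']
    | smul b E =>
    induction h using cls_induction with
    | zero => simp
    | add f f' hf hf' => simp only [map_add, hf, hf']
    | smul c F =>
    simp only [map_smul, LinearMap.smul_apply, compQ_cls, compL_mono, cls_eq (.assoc D E F)]
  tensor_id X Y := by
    rw [tensorQ_cls, tensorL_mono, cls_eq (.tensor_id rfl rfl)]
  interchange f' g' hf hg := by
    obtain ⟨f, hf, rfl⟩ := hf
    obtain ⟨g, hg, rfl⟩ := hg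
    change f ∈ Submodule.span _ _ at hf
    change g ∈ Submodule.span _ _ at hg
    induction hf using Submodule.span_induction with
    | zero => simp
    | add f f' _ _ hf hf' => simp only [map_add, LinearMap.add_apply, hf, hf', smul_add]
    | smul c f _ h => simp only [map_smul, LinearMap.smul_apply, h]; rw [smul_comm]
    | mem f hf =>
    obtain ⟨F, hF, rfl⟩ := hf
    induction hg using Submodule.span_induction with
    | zero => simp
    | add f f' _ _ hf hf' => simp only [map_add, LinearMap.add_apply, hf, hf', smul_add]
    | smul c f _ h => simp only [map_smul, LinearMap.smul_apply, h]; rw [smul_comm]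
    | mem g hg =>
    obtain ⟨G, hG, rfl⟩ := hg
    subst hF hG
    induction f' using cls_induction with
    | zero => simp
    | add f f' hf hf' => simp only [map_add, LinearMap.add_apply, hf, hf', smul_add]
    | smul a D =>
    induction g' using cls_induction with
    | zero => simp
    | add f f' hf hf' => simp only [map_add, hf, hf', smul_add]
    | smul b E =>
    simp only [map_smul, LinearMap.smul_apply]
    change b • a • compQ R (tensorQ R rfl rfl (cls R (mono k D)) (cls R (mono k G)))
      (tensorQ R rfl rfl (cls R (mono k F)) (cls R (mono k E))) = _ • b • a •
      tensorQ R rfl rfl (compQ R (cls R (mono k D)) (cls R (mono k F)))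
        (compQ R (cls R (mono k G)) (cls R (mono k E)))
    simp only [tensorQ_cls, tensorL_mono, compQ_cls, compL_mono]
    rw [cls_eq (.interchange D F G E rfl rfl rfl rfl), map_smul]
    simp only [smul_smul]
    congr 1
    ring
  tensor_assoc {X Y X' Y' X'' Y''} f g h := by
    refine HEq.trans ?_ (tensorQ_heq (mul_assoc X X' X'') (mul_assoc Y Y' Y'') _ _).symm
    apply heq_of_eq
    induction f using cls_induction with
    | zero => simp
    | add f f' hf hf' => simp only [map_add, LinearMap.add_apply, hf, hf']
    | smul a D =>
    induction g using cls_induction with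
    | zero => simp
    | add f f' hf hf' => simp only [map_add, LinearMap.add_apply, hf, hf']
    | smul b E =>
    induction h using cls_induction with
    | zero => simp
    | add f f' hf hf' => simp only [map_add, hf, hf']
    | smul c F =>
    simp only [map_smul, LinearMap.smul_apply, tensorQ_cls, tensorL_mono]
    rw [cls_eq (.tensor_assoc D E F rfl rfl rfl rfl rfl rfl (mul_assoc _ _ _) (mul_assoc _ _ _))]
  one_tensor {X Y} f := by
    refine (tensorQ_heq (one_mul X).symm (one_mul Y).symm _ _).trans (heq_of_eq ?_)
    induction f using cls_induction with
    | zero => simp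
    | add f f' hf hf' => simp only [map_add, hf, hf']
    | smul a D =>
    simp only [map_smul, tensorQ_cls, tensorL_mono]
    rw [cls_eq (.one_tensor D _ _)]
  tensor_one {X Y} f := by
    refine (tensorQ_heq (mul_one X).symm (mul_one Y).symm _ _).trans (heq_of_eq ?_)
    induction f using cls_induction with
    | zero => simp
    | add f f' hf hf' => simp only [map_add, LinearMap.add_apply, hf, hf']
    | smul a D =>
    simp only [map_smul, LinearMap.smul_apply, tensorQ_cls, tensorL_mono]
    rw [cls_eq (.tensor_one D _ _)]

end Presentation

/-! ### The higher-level affine wreath product category -/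

section LAW

variable {k : Type u} {A : Type v} {ι : Type w} [CommRing k] [Ring A] [Algebra k A]
variable {𝒜 : ZMod 2 → Submodule k A} [GradedAlgebra 𝒜]

/-- The generating objects: the black strand and the red strands, which are labelled by the even
central regular elements of `Pol_1(A)`. -/
inductive Strand (T : FrobeniusTrace 𝒜) where
  | black
  | red (Q : Pol.evenCentralRegular T)

/-- The object given by one black strand. -/
def bl (T : FrobeniusTrace 𝒜) : FreeMonoid (Strand T) := FreeMonoid.of .black

/-- The object given by one red strand. -/
def rd {T : FrobeniusTrace 𝒜} (Q : Pol.evenCentralRegular T) : FreeMonoid (Strand T) :=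
  FreeMonoid.of (.red Q)

/-- The generating morphisms: the black crossing, the tokens (labelled by homogeneous elements of
`A`; the token of an arbitrary element is defined by linearity), the dot, and the two crossings of
a red and a black strand. -/
inductive LGen (T : FrobeniusTrace 𝒜) : FreeMonoid (Strand T) → FreeMonoid (Strand T) → Type (max u v)
  | cross : LGen T (bl T * bl T) (bl T * bl T)
  | tok (p : ZMod 2) (a : 𝒜 p) : LGen T (bl T) (bl T)
  | dot : LGen T (bl T) (bl T)
  | redBlack (Q : Pol.evenCentralRegular T) : LGen T (rd Q * bl T) (bl T * rd Q)
  | blackRed (Q : Pol.evenCentralRegular T) : LGen T (bl T * rd Q) (rd Q * bl T)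

/-- Crossings are even, a token has the parity of its label, the dot has the parity of the trace. -/
def LGen.parity {T : FrobeniusTrace 𝒜} {X Y : FreeMonoid (Strand T)} : LGen T X Y → ZMod 2
  | cross => 0
  | tok p _ => p
  | dot => T.par
  | redBlack _ => 0
  | blackRed _ => 0

/-- The signature of the higher-level affine wreath product category. -/
abbrev lawSig (T : FrobeniusTrace 𝒜) : Signature.{max u v, max u v} where
  Letter := Strand T
  Gen := LGen T
  parity := LGen.parity

namespace LAW

variable (T : FrobeniusTrace 𝒜)

/-- Diagrams in the generators. -/
abbrev D (X Y : FreeMonoid (Strand T)) : Type _ := Diag (lawSig T) X Y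

/-- Identity diagrams. -/
def idd (X : FreeMonoid (Strand T)) : D T X X := Diag.id (S := lawSig T) X

/-- The black crossing. -/
def cross : D T (bl T * bl T) (bl T * bl T) := .gen (S := lawSig T) LGen.cross

/-- The token labelled by a homogeneous element. -/
def tok {p : ZMod 2} (a : 𝒜 p) : D T (bl T) (bl T) := .gen (S := lawSig T) (LGen.tok p a)

/-- The dot. -/
def dot : D T (bl T) (bl T) := .gen (S := lawSig T) LGen.dot

/-- The `r`-th vertical power of the dot. -/
def dotPow : ℕ → D T (bl T) (bl T)
  | 0 => idd T _
  | r + 1 => .comp (dot T) (dotPow r)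

variable {T}

/-- The crossing with the red strand going from bottom left to top right. -/
def redBlack (Q : Pol.evenCentralRegular T) : D T (rd Q * bl T) (bl T * rd Q) :=
  .gen (S := lawSig T) (LGen.redBlack Q)

/-- The crossing with the red strand going from bottom right to top left. -/
def blackRed (Q : Pol.evenCentralRegular T) : D T (bl T * rd Q) (rd Q * bl T) :=
  .gen (S := lawSig T) (LGen.blackRed Q)

variable {X Y Z X' Y' Z' : FreeMonoid (Strand T)}

/-- Horizontal composition. -/
def hor (f : D T X Y) (g : D T X' Y') : D T (X * X') (Y * Y') := .tensor f g rfl rfl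

/-- Add a strand on the right of a diagram on two strands. -/
def left3 (f : D T (X * Y) (X' * Y')) (Z : FreeMonoid (Strand T)) :
    D T (X * Y * Z) (X' * Y' * Z) := .tensor f (idd T Z) rfl rfl

/-- Add a strand on the left of a diagram on two strands. -/
def right3 (X : FreeMonoid (Strand T)) (f : D T (Y * Z) (Y' * Z')) :
    D T (X * Y * Z) (X * Y' * Z') := .tensor (idd T X) f (mul_assoc _ _ _) (mul_assoc _ _ _)

/-- Morphisms of black strands placed to the left and to the right of a red strand. -/
def around (Q : Pol.evenCentralRegular T) (f g : D T (bl T) (bl T)) :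
    D T (bl T * rd Q * bl T) (bl T * rd Q * bl T) := hor (hor f (idd T (rd Q))) g

/-- The element `∑_{r < N} a_r x^r` of `Pol_1(A)`, all of whose terms are even. -/
noncomputable def poly1 (T : FrobeniusTrace 𝒜) (N : ℕ) (a : ∀ r : ℕ, 𝒜 (r * T.par)) : Pol T 1 :=
  ∑ r ∈ Finset.range N, Pol.tok T 0 (a r : A) * Pol.dot T 0 ^ r

/-- The pin labelled `∑_{r < N} a_r x^r`. -/
noncomputable def pin1 (T : FrobeniusTrace 𝒜) (N : ℕ) (a : ∀ r : ℕ, 𝒜 (r * T.par)) :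
    LDiag k (lawSig T) (bl T) (bl T) :=
  ∑ r ∈ Finset.range N, mono k (Diag.comp (tok T (a r)) (dotPow T r))

variable [Fintype ι] (B : HomogBasis 𝒜 ι)

/-- The element `∑ l_{b,c,r,s} (b ⊗ c) x^r y^s` of `Pol_2(A)`, with `r, s < N`. -/
noncomputable def poly2 (T : FrobeniusTrace 𝒜) (N : ℕ) (l : ι → ι → ℕ → ℕ → k) : Pol T 2 :=
  ∑ b, ∑ c, ∑ r ∈ Finset.range N, ∑ s ∈ Finset.range N, l b c r s •
    (Pol.tok T 0 (B.basis b) * Pol.tok T 1 (B.basis c) * Pol.dot T 0 ^ r * Pol.dot T 1 ^ s)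

/-- The elements of `A` in the homogeneous basis. -/
noncomputable def basisElt (b : ι) : 𝒜 (B.deg b) := ⟨B.basis b, B.mem b⟩

/-- The elements of the left dual basis. -/
noncomputable def dualElt (T : FrobeniusTrace 𝒜) (b : ι) : 𝒜 (T.par + B.deg b) :=
  ⟨leftDual B T b, leftDual_mem B T b⟩

/-- The pin labelled `∑ l_{b,c,r,s} (b ⊗ c) x^r y^s` on the two black strands around a red one. -/
noncomputable def pin2 (Q : Pol.evenCentralRegular T) (N : ℕ) (l : ι → ι → ℕ → ℕ → k) :
    LDiag k (lawSig T) (bl T * rd Q * bl T) (bl T * rd Q * bl T) :=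
  ∑ b, ∑ c, ∑ r ∈ Finset.range N, ∑ s ∈ Finset.range N, l b c r s •
    mono k (Diag.comp (around Q (tok T (basisElt B b)) (tok T (basisElt B c)))
      (around Q (dotPow T r) (dotPow T s)))

/-- The defining relations; each constructor says that the displayed difference is zero. Since the
coefficients of an element of a Frobenius polynomial algebra with respect to the basis of normally
ordered monomials are unique, an even element only involves even monomials. -/
inductive Rel (T : FrobeniusTrace 𝒜) : ∀ X Y, LDiag k (lawSig T) X Y → Prop
  | tok_one : Rel T _ _ (mono k (tok T (⟨1, SetLike.one_mem_graded 𝒜⟩ : 𝒜 0)) - mono k (idd T (bl T)))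
  | tok_lin (p : ZMod 2) (c d : k) (a b : 𝒜 p) : Rel T _ _
      (c • mono k (tok T a) + d • mono k (tok T b) - mono k (tok T (c • a + d • b)))
  | tok_mul (p q : ZMod 2) (a : 𝒜 p) (b : 𝒜 q) : Rel T _ _
      (mono k (.comp (tok T a) (tok T b)) -
        mono k (tok T (⟨a * b, SetLike.mul_mem_graded a.2 b.2⟩ : 𝒜 (p + q))))
  | cross_cross : Rel T _ _ (mono k (.comp (cross T) (cross T)) - mono k (idd T (bl T * bl T)))
  | braid : Rel T _ _
      (mono k (.comp (left3 (cross T) (bl T)) (.comp (right3 (bl T) (cross T))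
          (left3 (cross T) (bl T)))) -
        mono k (.comp (right3 (bl T) (cross T)) (.comp (left3 (cross T) (bl T))
          (right3 (bl T) (cross T)))))
  | cross_tok (p : ZMod 2) (a : 𝒜 p) : Rel T _ _
      (mono k (.comp (cross T) (hor (tok T a) (idd T (bl T)))) -
        mono k (.comp (hor (idd T (bl T)) (tok T a)) (cross T)))
  | cross_dot : Rel T _ _
      (mono k (.comp (cross T) (hor (dot T) (idd T (bl T)))) -
        (mono k (.comp (hor (idd T (bl T)) (dot T)) (cross T)) -
          ∑ b, ksgn k (T.par * B.deg b) • mono k (.comp (hor (tok T (basisElt B b)) (idd T (bl T)))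
            (hor (idd T (bl T)) (tok T (dualElt B T b))))))
  | tok_dot (p : ZMod 2) (a : 𝒜 p) : Rel T _ _
      (mono k (.comp (tok T a) (dot T)) - ksgn k (T.par * p) •
        mono k (.comp (dot T) (tok T (⟨nakayama T a, nakayama_mem T a.2⟩ : 𝒜 p))))
  | blackRed_tok (Q : Pol.evenCentralRegular T) (p : ZMod 2) (a : 𝒜 p) : Rel T _ _
      (mono k (.comp (blackRed Q) (hor (tok T a) (idd T (rd Q)))) -
        mono k (.comp (hor (idd T (rd Q)) (tok T a)) (blackRed Q)))
  | redBlack_tok (Q : Pol.evenCentralRegular T) (p : ZMod 2) (a : 𝒜 p) : Rel T _ _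
      (mono k (.comp (redBlack Q) (hor (idd T (rd Q)) (tok T a))) -
        mono k (.comp (hor (tok T a) (idd T (rd Q))) (redBlack Q)))
  | blackRed_dot (Q : Pol.evenCentralRegular T) : Rel T _ _
      (mono k (.comp (blackRed Q) (hor (dot T) (idd T (rd Q)))) -
        mono k (.comp (hor (idd T (rd Q)) (dot T)) (blackRed Q)))
  | redBlack_dot (Q : Pol.evenCentralRegular T) : Rel T _ _
      (mono k (.comp (redBlack Q) (hor (idd T (rd Q)) (dot T))) -
        mono k (.comp (hor (dot T) (idd T (rd Q))) (redBlack Q)))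
  | redBlack_blackRed (Q : Pol.evenCentralRegular T) (N : ℕ) (a : ∀ r : ℕ, 𝒜 (r * T.par))
      (h : poly1 T N a = Q) : Rel T _ _
      (mono k (.comp (redBlack Q) (blackRed Q)) -
        tensorL k rfl rfl (pin1 T N a) (mono k (idd T (rd Q))))
  | blackRed_redBlack (Q : Pol.evenCentralRegular T) (N : ℕ) (a : ∀ r : ℕ, 𝒜 (r * T.par))
      (h : poly1 T N a = Q) : Rel T _ _
      (mono k (.comp (blackRed Q) (redBlack Q)) -
        tensorL k rfl rfl (mono k (idd T (rd Q))) (pin1 T N a))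
  | braid_red_left (Q : Pol.evenCentralRegular T) : Rel T _ _
      (mono k (.comp (left3 (cross T) (rd Q)) (.comp (right3 (bl T) (redBlack Q))
          (left3 (redBlack Q) (bl T)))) -
        mono k (.comp (right3 (bl T) (redBlack Q)) (.comp (left3 (redBlack Q) (bl T))
          (right3 (rd Q) (cross T)))))
  | braid_red_right (Q : Pol.evenCentralRegular T) : Rel T _ _
      (mono k (.comp (left3 (blackRed Q) (bl T)) (.comp (right3 (bl T) (blackRed Q))
          (left3 (cross T) (rd Q)))) -
        mono k (.comp (right3 (rd Q) (cross T)) (.comp (left3 (blackRed Q) (bl T))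
          (right3 (bl T) (blackRed Q)))))
  | braid_red_middle (Q : Pol.evenCentralRegular T) (N : ℕ) (l : ι → ι → ℕ → ℕ → k)
      (hl : ∀ b c r s, l b c r s ≠ 0 → B.deg b + B.deg c + (r + s) * T.par = 0)
      (h : poly2 B T N l = Pol.demazure T B (Pol.incl T 0 Q)) : Rel T _ _
      (mono k (.comp (left3 (redBlack Q) (bl T)) (.comp (right3 (rd Q) (cross T))
          (left3 (blackRed Q) (bl T)))) -
        (mono k (.comp (right3 (bl T) (blackRed Q)) (.comp (left3 (cross T) (rd Q))
          (right3 (bl T) (redBlack Q)))) - pin2 B Q N l))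

theorem parity_idd (X : FreeMonoid (Strand T)) : (idd T X).parity = 0 := rfl

theorem parity_dotPow (T : FrobeniusTrace 𝒜) (r : ℕ) : (dotPow T r).parity = r * T.par := by
  induction r with
  | zero => simp [dotPow, parity_idd]
  | succ r ih =>
    simp only [dotPow, Diag.parity, ih, Nat.cast_add, Nat.cast_one, add_mul, one_mul]
    rw [add_comm]; rfl

theorem pin1_mem (T : FrobeniusTrace 𝒜) (N : ℕ) (a : ∀ r : ℕ, 𝒜 (r * T.par)) :
    pin1 T N a ∈ parityL k (bl T) (bl T) 0 := by
  refine sum_mem fun r _ => mono_mem_parityL ?_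
  rw [Diag.parity, parity_dotPow]
  exact CharTwo.add_self_eq_zero _

theorem isHomogRel : IsHomogRel (S := lawSig T) fun X Y => {r | Rel B T X Y r} := by
  intro X Y r hr
  rcases hr with _ | ⟨p, c, d, a, b⟩ | ⟨p, q, a, b⟩ | _ | _ | ⟨p, a⟩ | _ | ⟨p, a⟩ | ⟨Q, p, a⟩ |
    ⟨Q, p, a⟩ | Q | Q | ⟨Q, N, a, h⟩ | ⟨Q, N, a, h⟩ | Q | Q | ⟨Q, N, l, hl, h⟩
  · exact ⟨0, sub_mem (mono_mem_parityL rfl) (mono_mem_parityL rfl)⟩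
  · exact ⟨p, sub_mem (add_mem (Submodule.smul_mem _ _ (mono_mem_parityL rfl))
      (Submodule.smul_mem _ _ (mono_mem_parityL rfl))) (mono_mem_parityL rfl)⟩
  · exact ⟨p + q, sub_mem (mono_mem_parityL rfl) (mono_mem_parityL rfl)⟩
  · exact ⟨0, sub_mem (mono_mem_parityL rfl) (mono_mem_parityL rfl)⟩
  · exact ⟨0, sub_mem (mono_mem_parityL rfl) (mono_mem_parityL rfl)⟩
  · exact ⟨p, sub_mem (mono_mem_parityL (by simp [Diag.parity, parity_idd, hor, cross, tok, lawSig, LGen.parity]))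
      (mono_mem_parityL (by simp [Diag.parity, parity_idd, hor, cross, tok, lawSig, LGen.parity]))⟩
  · refine ⟨T.par, sub_mem (mono_mem_parityL ?_) (sub_mem (mono_mem_parityL ?_)
      (sum_mem fun b _ => Submodule.smul_mem _ _ (mono_mem_parityL ?_)))⟩
    · simp [Diag.parity, parity_idd, hor, cross, dot, lawSig, LGen.parity]
    · simp [Diag.parity, parity_idd, hor, cross, dot, lawSig, LGen.parity]
    · simp only [Diag.parity, parity_idd, hor, tok, lawSig, LGen.parity, zero_add, add_zero]
      rw [add_left_comm, CharTwo.add_self_eq_zero, add_zero]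
  · exact ⟨_, sub_mem (mono_mem_parityL rfl) (Submodule.smul_mem _ _ (mono_mem_parityL
      (add_comm _ _)))⟩
  · exact ⟨p, sub_mem (mono_mem_parityL (by simp [Diag.parity, parity_idd, hor, blackRed, tok, lawSig, LGen.parity]))
      (mono_mem_parityL (by simp [Diag.parity, parity_idd, hor, blackRed, tok, lawSig, LGen.parity]))⟩
  · exact ⟨p, sub_mem (mono_mem_parityL (by simp [Diag.parity, parity_idd, hor, redBlack, tok, lawSig, LGen.parity]))
      (mono_mem_parityL (by simp [Diag.parity, parity_idd, hor, redBlack, tok, lawSig, LGen.parity]))⟩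
  · exact ⟨T.par, sub_mem
      (mono_mem_parityL (by simp [Diag.parity, parity_idd, hor, blackRed, dot, lawSig, LGen.parity]))
      (mono_mem_parityL (by simp [Diag.parity, parity_idd, hor, blackRed, dot, lawSig, LGen.parity]))⟩
  · exact ⟨T.par, sub_mem
      (mono_mem_parityL (by simp [Diag.parity, parity_idd, hor, redBlack, dot, lawSig, LGen.parity]))
      (mono_mem_parityL (by simp [Diag.parity, parity_idd, hor, redBlack, dot, lawSig, LGen.parity]))⟩
  · exact ⟨0, sub_mem (mono_mem_parityL rfl)
      (tensorL_mem (p := 0) (q := 0) rfl rfl (pin1_mem T N a) (mono_mem_parityL rfl))⟩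
  · exact ⟨0, sub_mem (mono_mem_parityL rfl)
      (tensorL_mem (p := 0) (q := 0) rfl rfl (mono_mem_parityL rfl) (pin1_mem T N a))⟩
  · exact ⟨0, sub_mem (mono_mem_parityL rfl) (mono_mem_parityL rfl)⟩
  · exact ⟨0, sub_mem (mono_mem_parityL rfl) (mono_mem_parityL rfl)⟩
  · refine ⟨0, sub_mem (mono_mem_parityL rfl) (sub_mem (mono_mem_parityL rfl)
      (sum_mem fun b _ => sum_mem fun c _ => sum_mem fun r _ => sum_mem fun s _ => ?_))⟩
    by_cases h0 : l b c r s = 0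
    · rw [h0, zero_smul]; exact zero_mem _
    · refine Submodule.smul_mem _ _ (mono_mem_parityL ?_)
      rw [← hl b c r s h0]
      simp only [Diag.parity, parity_idd, around, hor, parity_dotPow, add_zero, add_mul]
      rfl

end LAW

variable [Fintype ι]

/-- The higher-level affine wreath product category of the Frobenius superalgebra `(A, T)`. -/
noncomputable def LAWCat (B : HomogBasis 𝒜 ι) (T : FrobeniusTrace 𝒜) : MonoidalSupercat.{u, max u v, max u v} k :=
  presented (S := lawSig T) (fun X Y => {r | LAW.Rel B T X Y r}) (LAW.isHomogRel B)

namespace LAWCat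

variable (B : HomogBasis 𝒜 ι) (T : FrobeniusTrace 𝒜)

/-- A word in the generating objects, as an object. -/
def obj (B : HomogBasis 𝒜 ι) {T : FrobeniusTrace 𝒜} (X : FreeMonoid (Strand T)) :
    (LAWCat B T).Obj := X

/-- The morphism represented by a diagram. -/
noncomputable def ofDiag {X Y : FreeMonoid (Strand T)} (f : LAW.D T X Y) :
    (LAWCat B T).Hom (obj B X) (obj B Y) :=
  cls (S := lawSig T) (fun X Y => {r | LAW.Rel B T X Y r}) (mono k f)

/-- The black crossing. -/
noncomputable def cross : (LAWCat B T).Hom (obj B (bl T * bl T)) (obj B (bl T * bl T)) := ofDiag B T (LAW.cross T)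

/-- The token labelled by an arbitrary element of `A`, the sum of the tokens labelled by its
homogeneous components. -/
noncomputable def tok (a : A) : (LAWCat B T).Hom (obj B (bl T)) (obj B (bl T)) :=
  ∑ p : ZMod 2, ofDiag B T (LAW.tok T (DirectSum.decompose 𝒜 a p))

/-- The dot. -/
noncomputable def dot : (LAWCat B T).Hom (obj B (bl T)) (obj B (bl T)) := ofDiag B T (LAW.dot T)

variable {T}

/-- The crossing with the red strand going from bottom left to top right. -/
noncomputable def redBlack (Q : Pol.evenCentralRegular T) :
    (LAWCat B T).Hom (obj B (rd Q * bl T)) (obj B (bl T * rd Q)) := ofDiag B T (LAW.redBlack Q)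

/-- The crossing with the red strand going from bottom right to top left. -/
noncomputable def blackRed (Q : Pol.evenCentralRegular T) :
    (LAWCat B T).Hom (obj B (bl T * rd Q)) (obj B (rd Q * bl T)) := ofDiag B T (LAW.blackRed Q)

end LAWCat

/-! ### Higher-level affine wreath product algebras -/

/-- The `(u, v)`-shuffles: words of length `|u| + |v|` containing `u` and `v` as subwords. -/
def shuffles {L : Type*} (u v : FreeMonoid L) : Set (FreeMonoid L) :=
  {w | w.toList.length = u.toList.length + v.toList.length ∧ u.toList.Sublist w.toList ∧
    v.toList.Sublist w.toList}

/-- The word in the red generating objects given by a word in their labels. -/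
def redWord {T : FrobeniusTrace 𝒜} (Q : FreeMonoid (Pol.evenCentralRegular T)) :
    FreeMonoid (Strand T) := FreeMonoid.map Strand.red Q

/-- The set of shuffles of `d` black strands with the word `Q` of red strands. -/
def Gam (T : FrobeniusTrace 𝒜) (d : ℕ) (Q : FreeMonoid (Pol.evenCentralRegular T)) :
    Set (FreeMonoid (Strand T)) := shuffles (bl T ^ d) (redWord Q)

theorem toList_bl_pow (T : FrobeniusTrace 𝒜) (d : ℕ) :
    (bl T ^ d).toList = List.replicate d Strand.black := by
  induction d with
  | zero => rfl
  | succ d ih => rw [pow_succ', FreeMonoid.toList_mul, ih]; rfl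

theorem finite_Gam (T : FrobeniusTrace 𝒜) (d : ℕ) (Q : FreeMonoid (Pol.evenCentralRegular T)) :
    (Gam T d Q).Finite := by
  classical
  refine Set.Finite.subset
    (List.finite_toSet (((bl T ^ d).toList ++ (redWord Q).toList).permutations)) ?_
  rintro w ⟨hl, hu, hv⟩
  change FreeMonoid.toList w ∈ List.permutations _
  rw [List.mem_permutations]
  have hd : Disjoint ((bl T ^ d).toList : Multiset (Strand T)) ((redWord Q).toList) := by
    rw [Multiset.disjoint_left]
    intro x hx hy
    rw [Multiset.mem_coe, toList_bl_pow] at hx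
    rw [List.eq_of_mem_replicate hx, Multiset.mem_coe, redWord, FreeMonoid.toList_map,
      List.mem_map] at hy
    obtain ⟨q, -, hq⟩ := hy
    cases hq
  rw [← Multiset.coe_eq_coe, ← Multiset.coe_add]
  refine (Multiset.eq_of_le_of_card_le ?_ ?_).symm
  · rw [Multiset.add_eq_union_iff_disjoint.2 hd]
    exact Multiset.union_le (Multiset.coe_le.2 hu.subperm) (Multiset.coe_le.2 hv.subperm)
  · simp [hl]

noncomputable instance (T : FrobeniusTrace 𝒜) (d : ℕ)
    (Q : FreeMonoid (Pol.evenCentralRegular T)) : Fintype (Gam T d Q) :=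
  (finite_Gam T d Q).fintype

/-- The higher-level affine wreath product algebra: the endomorphism algebra of the direct sum of
all shuffles, in the additive envelope. -/
abbrev WAff (B : HomogBasis 𝒜 ι) (T : FrobeniusTrace 𝒜) (d : ℕ)
    (Q : FreeMonoid (Pol.evenCentralRegular T)) : Type _ :=
  (LAWCat B T).AddEnd fun i : Gam T d Q => LAWCat.obj B (i : FreeMonoid (Strand T))

/-! ### Changing the trace -/

/-- Isomorphisms of superalgebras from `Pol_1(A)` to `Pol_1(A')`, where `A'` is `A` with the
trace `T'`. -/
structure PolEquiv (T T' : FrobeniusTrace 𝒜) where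
  equiv : Pol T 1 ≃ₐ[k] Pol T' 1
  mem_parity_iff : ∀ p f, equiv f ∈ Pol.parity T' p ↔ f ∈ Pol.parity T p

namespace PolEquiv

variable {T T' : FrobeniusTrace 𝒜}

/-- The inverse isomorphism. -/
noncomputable def symm (e : PolEquiv T T') : PolEquiv T' T where
  equiv := e.equiv.symm
  mem_parity_iff p f := by rw [← e.mem_parity_iff, AlgEquiv.apply_symm_apply]

/-- An isomorphism of superalgebras preserves the even central regular elements. -/
noncomputable def onLabels (e : PolEquiv T T') (Q : Pol.evenCentralRegular T) : Pol.evenCentralRegular T' :=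
  ⟨e.equiv Q, (e.mem_parity_iff _ _).2 Q.2.1,
    fun g => by
      obtain ⟨f, rfl⟩ := e.equiv.surjective g
      rw [← map_mul, ← map_mul, Q.2.2.1],
    fun f g h => by
      apply e.equiv.symm.injective
      apply Q.2.2.2.left
      apply e.equiv.injective
      simpa using h,
    fun f g h => by
      apply e.equiv.symm.injective
      apply Q.2.2.2.right
      apply e.equiv.injective
      simpa using h⟩

/-- The induced map on generating objects. -/
noncomputable def onStrands (e : PolEquiv T T') : Strand T → Strand T'
  | .black => .black
  | .red Q => .red (e.onLabels Q)

/-- The induced homomorphism on objects: it fixes the black strand and relabels red strands. -/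
noncomputable def onObj (e : PolEquiv T T') (B : HomogBasis 𝒜 ι) : (LAWCat B T).Obj →* (LAWCat B T').Obj :=
  FreeMonoid.map e.onStrands

end PolEquiv

/-- `u` is homogeneous of parity `ε + ε'`, invertible, and `tr'(a) = tr(a u)` for all `a`. -/
def RelatesTraces (T T' : FrobeniusTrace 𝒜) (u : Aˣ) : Prop :=
  (u : A) ∈ 𝒜 (T.par + T'.par) ∧ ∀ a, T'.tr a = T.tr (a * u)

end LAW

/-! ### The unit relating two traces, and the two Nakayama automorphisms -/

section TraceChange

variable {k A ι : Type*} [CommRing k] [Ring A] [Algebra k A]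
variable {𝒜 : ZMod 2 → Submodule k A} [GradedAlgebra 𝒜]

/-! Perfectness of the pairing of `tr` represents the functional `tr'` as `tr(- u)`. Representing
`tr` in the same way through `tr'` produces a two-sided inverse of `u`, and the parity of `u` is
read off from the degrees in which the two traces vanish.

Everything else rests on the fact that `(-1)^ū x u`, formed in the algebra of the second trace,
satisfies the relations of the dot of the first. Two identities carry this.
`RelatesTraces.nakayama_mul` says that `ψ'(a) u = (-1)^(ā ū) u ψ(a)`; with the sign rules for
distinct strands it gives the homomorphism `Pol.traceMap` on `Pol_n`, whose inverse is the same
construction for `u⁻¹`. `Pol.traceMap_tele` says that `t_{i,j}` becomes `(-1)^ū t'_{i,j} u_i`. As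
`∂` kills tokens, this makes the change of trace intertwine the two Demazure operators
(`Pol.traceMap_demazure`).

To lift this to the categories, the black strand is regarded as a module over `Pol_1`, and two black
strands, adjacent or around a red one, as a module over `Pol_2`. Every pin is then the value of such
an action, so it depends only on the polynomial and not on the expansion naming it
(`LAWCat.cls_pin1`, `LAWCat.cls_pin2`). The relations involving dots or pins thus become identities
in polynomial algebras, while the others are carried to relations of the same shape;
`PolEquiv.evalL_rel` assembles them. Since the relations with pins are indexed by normally ordered
expansions, an expansion of every even element is needed in order to invoke them
(`Pol.exists_poly1`, `Pol.exists_poly2`). Only existence of expansions is required, not uniqueness.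

The functor for `u⁻¹` is inverse to the functor for `u`: a composite of monoidal functors that fixes
objects and generators is the identity (`map_map_heq_of_gen`), and on the dot the check is `x u⁻¹ u
= x`. The isomorphism of endomorphism algebras applies the functor to matrix entries and then
renames the indices along the induced bijection of shuffles. -/

theorem exists_tr_mul_right (T T' : FrobeniusTrace 𝒜) :
    ∃ u ∈ 𝒜 (T.par + T'.par), ∀ a, T'.tr a = T.tr (a * u) := by
  have := T.perfect
  obtain ⟨u, hu⟩ := (LinearMap.IsPerfPair.bijective_right (traceForm T.tr)).2 T'.tr
  have h : ∀ a, T'.tr a = T.tr (a * u) := fun a => (LinearMap.congr_fun hu a).symm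
  refine ⟨u, mem_of_tr_right T fun q hq c hc => ?_, h⟩
  -- The value `tr(c u) = tr'(c)` vanishes unless `c` has parity `ε'`, and `ε' + (ε + ε') = ε`.
  rw [← h]
  refine T'.homogeneous q (fun hqp => hq ?_) c hc
  rw [hqp, add_left_comm, CharTwo.add_self_eq_zero, add_zero]

/-- With `tr' = tr(- u)` and `tr = tr'(- v)` one gets `tr'(c u v) = tr(c u) = tr'(c)` and
symmetrically `tr(c v u) = tr(c)`, so nondegeneracy forces `u v = v u = 1`. -/
theorem exists_relatesTraces (T T' : FrobeniusTrace 𝒜) : ∃ u : Aˣ, RelatesTraces T T' u := by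
  obtain ⟨u, hu, h⟩ := exists_tr_mul_right T T'
  obtain ⟨v, -, h'⟩ := exists_tr_mul_right T' T
  refine ⟨⟨u, v, tr_right_ext T' fun c => ?_, tr_right_ext T fun c => ?_⟩, hu, h⟩
  · rw [← mul_assoc, ← h', ← h, mul_one]
  · rw [← mul_assoc, ← h, ← h', mul_one]

namespace RelatesTraces

variable {T T' : FrobeniusTrace 𝒜} {u : Aˣ}

theorem inv_mem (h : RelatesTraces T T' u) : ((u⁻¹ : Aˣ) : A) ∈ 𝒜 (T.par + T'.par) := by
  refine mem_of_tr_right T' fun q hq c hc => ?_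
  rw [h.2, mul_assoc, Units.inv_mul, mul_one]
  refine T.homogeneous q (fun hqp => hq ?_) c hc
  rw [hqp, ← add_assoc, CharTwo.add_self_eq_zero, zero_add]

theorem symm (h : RelatesTraces T T' u) : RelatesTraces T' T u⁻¹ :=
  ⟨add_comm T.par T'.par ▸ h.inv_mem, fun a => by rw [h.2, mul_assoc, Units.inv_mul, mul_one]⟩

/-- Comparison of the Nakayama automorphisms of two traces. -/
theorem nakayama_mul (h : RelatesTraces T T' u) {p : ZMod 2} {a : A} (ha : a ∈ 𝒜 p) :
    nakayama T' a * u = ksgn k (p * (T.par + T'.par)) • ((u : A) * nakayama T a) := by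
  apply tr_right_ext T
  intro c
  rw [← sum_proj (𝒜 := 𝒜) c]
  simp only [Finset.sum_mul, map_sum]
  refine Finset.sum_congr rfl fun q _ => ?_
  have hc : GradedAlgebra.proj 𝒜 q c ∈ 𝒜 q := SetLike.coe_mem _
  generalize GradedAlgebra.proj 𝒜 q c = c at *
  -- For homogeneous `c` of parity `q`, `tr(c ψ'(a) u) = tr'(c ψ'(a)) = (-1)^(p q) tr(a c u)`.
  -- Moving `a` around `c u` with the supersymmetry of `tr` costs `(-1)^(p (q + ū))`, and the
  -- `q`-dependence cancels.
  rw [← mul_assoc, ← h.2, tr_mul_nakayama, superTraceForm_apply T' ha hc, h.2, mul_smul_comm, map_smul,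
    mul_assoc, tr_mul_comm T ha (SetLike.mul_mem_graded hc h.1), smul_eq_mul, ← mul_assoc,
    ← ksgn_add, mul_assoc]
  congr 2
  generalize T.par = x, T'.par = y
  clear * -
  revert p q x y; decide

end RelatesTraces

/-- Surjectivity of `ψ` in each parity comes from perfectness in the other variable: the functional
`tr(- c)`, with a sign, is `tr(a -)` for some `a`. The sign `(-1)^(q r)` in the definition of `ψ`
may be taken constant, because `tr(b c)` only sees `b` of parity `r = ε + q`. -/
theorem exists_nakayama_eq (T : FrobeniusTrace 𝒜) {q : ZMod 2} {c : A} (hc : c ∈ 𝒜 q) :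
    ∃ a ∈ 𝒜 q, nakayama T a = c := by
  have := T.perfect
  obtain ⟨a, ha⟩ := (LinearMap.IsPerfPair.bijective_left (traceForm T.tr)).2
    (ksgn k (q * (T.par + q)) • (traceForm T.tr).flip c)
  have h : ∀ b, T.tr (a * b) = ksgn k (q * (T.par + q)) * T.tr (b * c) :=
    fun b => LinearMap.congr_fun ha b
  have hm : a ∈ 𝒜 q := mem_of_tr_left T fun r hr b hb => by
    rw [h, T.homogeneous _ hr _ (SetLike.mul_mem_graded hb hc), mul_zero]
  refine ⟨a, hm, tr_right_ext T fun b => ?_⟩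
  rw [← sum_proj (𝒜 := 𝒜) b]
  simp only [Finset.sum_mul, map_sum]
  refine Finset.sum_congr rfl fun r _ => ?_
  have hb : GradedAlgebra.proj 𝒜 r b ∈ 𝒜 r := SetLike.coe_mem _
  generalize GradedAlgebra.proj 𝒜 r b = b at *
  rw [tr_mul_nakayama, superTraceForm_apply T hm hb, h, ← mul_assoc, ← ksgn_add]
  by_cases hr : r + q = T.par
  · rw [← hr]
    convert one_mul _
    clear * -
    rw [show q * r + q * (r + q + q) = 0 by revert q r; decide]
    simp [ksgn]
  · rw [T.homogeneous _ hr _ (SetLike.mul_mem_graded hb hc), mul_zero]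

/-! ### Change of trace on the polynomial algebras -/

namespace Pol

variable {T T' : FrobeniusTrace 𝒜} {u : Aˣ} {n : ℕ}

/-- The homomorphism `Pol_n(A) → Pol_n(A')` fixing tokens and mapping `x_i` to `(-1)^ū x_i u_i`. -/
noncomputable def traceMap (h : RelatesTraces T T' u) (n : ℕ) : Pol T n →ₐ[k] Pol T' n :=
  lift T (fun g => match g with
    | .tok i a => tok T' i a
    | .dot i => ksgn k (T.par + T'.par) • (dot T' i * tok T' i (u : A))) (by
    rintro x y (i | ⟨i, a, b⟩ | ⟨i, c, a⟩ | ⟨i, a, b⟩ | ⟨i, j, hij, p, q, a, b, ha, hb⟩ | ⟨i, j, hij⟩ |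
      ⟨i, p, a, ha⟩ | ⟨i, j, hij, p, a, ha⟩)
    · simpa using tok_one T' i
    · simpa using tok_add T' i a b
    · simpa using tok_smul T' i c a
    · simpa using tok_mul T' i a b
    · simpa using tok_comm T' hij ha hb
    · have e : ∀ i j : Fin n, i ≠ j → dot T' i * tok T' i (u : A) * (dot T' j * tok T' j (u : A)) =
          ksgn k (T'.par * (T.par + T'.par)) •
            (dot T' i * dot T' j * (tok T' i (u : A) * tok T' j (u : A))) := fun i j hij => by
        rw [mul_assoc, ← mul_assoc (tok T' i _), tok_dot_ne T' hij.symm h.1]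
        simp only [smul_mul_assoc, mul_smul_comm, mul_assoc]
      simp only [map_mul, map_smul, FreeAlgebra.lift_ι_apply, smul_mul_smul_comm]
      -- Moving `u_i` past `x_j` gives the same sign on both sides. Exchanging the dots gives
      -- `(-1)^ε'` and exchanging the two copies of `u` gives `(-1)^ū`; together these are `(-1)^ε`.
      rw [e i j hij, e j i hij.symm, dot_comm T' hij, tok_comm T' hij h.1 h.1]
      simp only [smul_mul_assoc, mul_smul_comm, smul_smul, ← ksgn_add]
      congr 2
      generalize T.par = x, T'.par = y
      revert x y; decide
    · simp only [map_mul, map_smul, FreeAlgebra.lift_ι_apply, mul_smul_comm, smul_mul_assoc]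
      -- The sign `(-1)^(ε' p)` from passing the new dot and `(-1)^(p ū)` from replacing `ψ'(a) u`
      -- by `u ψ(a)` combine to `(-1)^(ε p)`.
      rw [← mul_assoc, tok_dot T' i ha, smul_mul_assoc, mul_assoc, ← tok_mul, h.nakayama_mul ha,
        tok_smul, tok_mul]
      simp only [mul_smul_comm, smul_smul, ← ksgn_add, mul_assoc]
      congr 2
      generalize T.par = x, T'.par = y
      clear * -
      revert p x y; decide
    · simp only [map_mul, map_smul, FreeAlgebra.lift_ι_apply, mul_smul_comm, smul_mul_assoc]
      rw [← mul_assoc, tok_dot_ne T' hij ha, smul_mul_assoc, mul_assoc, tok_comm T' hij.symm ha h.1]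
      simp only [mul_smul_comm, smul_smul, ← ksgn_add, mul_assoc]
      congr 2
      generalize T.par = x, T'.par = y
      clear * -
      revert p x y; decide)

theorem traceMap_tok (h : RelatesTraces T T' u) (i : Fin n) (a : A) :
    traceMap h n (tok T i a) = tok T' i a := lift_tok T _ _ i a

theorem traceMap_dot (h : RelatesTraces T T' u) (i : Fin n) :
    traceMap h n (dot T i) = ksgn k (T.par + T'.par) • (dot T' i * tok T' i (u : A)) :=
  lift_dot T _ _ i

theorem traceMap_traceMap_symm (h : RelatesTraces T T' u) :
    (traceMap h n).comp (traceMap h.symm n) = AlgHom.id k _ := by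
  apply hom_ext
  · intro i a
    simp [traceMap_tok]
  · intro i
    simp [traceMap_tok, traceMap_dot, smul_smul, mul_assoc, ← tok_mul, tok_one, add_comm T'.par,
      ksgn_mul_self]

theorem traceMap_symm_traceMap (h : RelatesTraces T T' u) :
    (traceMap h.symm n).comp (traceMap h n) = AlgHom.id k _ := by
  apply hom_ext
  · intro i a
    simp [traceMap_tok]
  · intro i
    simp [traceMap_tok, traceMap_dot, smul_smul, mul_assoc, ← tok_mul, tok_one, add_comm T'.par,
      ksgn_mul_self]

theorem traceMap_incl (h : RelatesTraces T T' u) (i : Fin n) (f : Pol T 1) :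
    traceMap h n (incl T i f) = incl T' i (traceMap h 1 f) := by
  suffices e : (traceMap h n).comp (incl T i) = (incl T' i).comp (traceMap h 1) from
    DFunLike.congr_fun e f
  apply hom_ext
  · intro j a
    simp [traceMap_tok, incl, lift_tok]
  · intro j
    simp [traceMap_dot, incl, lift_tok, lift_dot]

variable (T) in
theorem tok_mul_mem_parity (i : Fin n) {p q : ZMod 2} {a : A} {f : Pol T n} (ha : a ∈ 𝒜 p)
    (hf : f ∈ parity T q) : tok T i a * f ∈ parity T (p + q) := by
  induction hf using Submodule.span_induction with
  | zero => simp
  | add f g _ _ hf hg => rw [mul_add]; exact add_mem hf hg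
  | smul c f _ hf => rw [mul_smul_comm]; exact Submodule.smul_mem _ _ hf
  | mem w hw => exact Submodule.subset_span (.tok_mul i p q a w ha hw)

variable (T) in
theorem dot_mul_mem_parity (i : Fin n) {q : ZMod 2} {f : Pol T n}
    (hf : f ∈ parity T q) : dot T i * f ∈ parity T (T.par + q) := by
  induction hf using Submodule.span_induction with
  | zero => simp
  | add f g _ _ hf hg => rw [mul_add]; exact add_mem hf hg
  | smul c f _ hf => rw [mul_smul_comm]; exact Submodule.smul_mem _ _ hf
  | mem w hw => exact Submodule.subset_span (.dot_mul i q w hw)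

theorem one_mem_parity : (1 : Pol T n) ∈ parity T 0 := Submodule.subset_span .one

theorem traceMap_mem_parity (h : RelatesTraces T T' u) {p : ZMod 2} {f : Pol T n}
    (hf : f ∈ parity T p) : traceMap h n f ∈ parity T' p := by
  induction hf using Submodule.span_induction with
  | zero => simp
  | add f g _ _ hf hg => rw [map_add]; exact add_mem hf hg
  | smul c f _ hf => rw [map_smul]; exact Submodule.smul_mem _ _ hf
  | mem w hw =>
  induction hw with
  | one => rw [map_one]; exact one_mem_parity
  | tok_mul i p q a w ha _ ih =>
    rw [map_mul, traceMap_tok]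
    exact tok_mul_mem_parity T' i ha ih
  | dot_mul i q w _ ih =>
    rw [map_mul, traceMap_dot, smul_mul_assoc, mul_assoc]
    refine Submodule.smul_mem _ _ ?_
    have := dot_mul_mem_parity T' i (tok_mul_mem_parity T' i h.1 ih)
    -- The new dot and the token `u` together have parity `ε' + ū = ε`, the parity of the old dot.
    convert this using 2
    generalize T.par = x, T'.par = y
    clear * -
    revert q x y; decide

/-- The isomorphism of superalgebras `Pol_1(A) ≃ Pol_1(A')`. -/
noncomputable def traceEquiv (h : RelatesTraces T T' u) : PolEquiv T T' where
  equiv := AlgEquiv.ofAlgHom (traceMap h 1) (traceMap h.symm 1) (traceMap_traceMap_symm h)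
    (traceMap_symm_traceMap h)
  mem_parity_iff p f := by
    refine ⟨fun hf => ?_, traceMap_mem_parity h⟩
    have := traceMap_mem_parity h.symm hf
    rwa [AlgEquiv.ofAlgHom_apply, ← AlgHom.comp_apply, traceMap_symm_traceMap] at this

/-! ### Compatibility with the Demazure operators -/

section Demazure

variable [Fintype ι] (B : HomogBasis 𝒜 ι)

/-- One matrix plays two roles. Its entries `tr'(c^∨ b) = tr(c^∨ b u)` are the coefficients of `b u`
in the basis, and also those of the old dual vector `c^∨` in the new dual basis. Both sides
therefore expand into the same double sum. The condition `i ≠ j` lets `u_i` move across the dual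
factor on strand `j`. -/
theorem traceMap_tele (h : RelatesTraces T T' u) {i j : Fin n} (hij : i ≠ j) :
    traceMap h n (tele T B i j) =
      ksgn k (T.par + T'.par) • (tele T' B i j * tok T' i (u : A)) := by
  have h1 : ∀ b, tok T' i (B.basis b) * tok T' j (leftDual B T' b) * tok T' i (u : A) =
      ∑ c, (ksgn k ((T'.par + B.deg b) * (T.par + T'.par)) * T'.tr (leftDual B T c * B.basis b)) •
        (tok T' i (B.basis c) * tok T' j (leftDual B T' b)) := fun b => by
    rw [mul_assoc, tok_comm T' hij.symm (leftDual_mem B T' b) h.1, mul_smul_comm, ← mul_assoc,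
      ← tok_mul, expand_basis B T (B.basis b * u), tok_sum]
    simp only [tok_smul, Finset.sum_mul, smul_mul_assoc, Finset.smul_sum, smul_smul, ← mul_assoc, h.2]
  have h2 : ∀ c, tok T' j (leftDual B T c) =
      ∑ b, T'.tr (leftDual B T c * B.basis b) • tok T' j (leftDual B T' b) := fun c => by
    conv_lhs => rw [expand_leftDual B T' (leftDual B T c)]
    simp only [tok_sum, tok_smul]
  simp only [tele, map_sum, map_smul, map_mul, traceMap_tok, Finset.sum_mul, smul_mul_assoc, h1, h2,
    Finset.mul_sum, mul_smul_comm, Finset.smul_sum, smul_smul]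
  rw [Finset.sum_comm]
  refine Finset.sum_congr rfl fun b _ => Finset.sum_congr rfl fun c _ => ?_
  congr 1
  -- The signs agree only in the degrees where the matrix entry can be nonzero; elsewhere both
  -- coefficients vanish.
  by_cases hp : T.par + B.deg c + B.deg b = T'.par
  · simp only [← mul_assoc, ← ksgn_add]
    congr 2
    generalize T.par = e at *; generalize T'.par = p at *
    generalize B.deg c = x at *; generalize B.deg b = y at *
    clear * - hp
    revert e p x y; decide
  · rw [T'.homogeneous _ hp _ (SetLike.mul_mem_graded (leftDual_mem B T c) (B.mem b))]
    simp

/-- The Demazure operator is the corner entry of an algebra homomorphism to matrices, so generators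
suffice. Tokens are killed on both sides, and the Leibniz rule gives `∂(x_i u_i) = ∂(x_i) u_i`,
which is matched by `traceMap_tele`. -/
theorem traceMap_demazure (h : RelatesTraces T T' u) (f : Pol T 2) :
    traceMap h 2 (demazure T B f) = demazure T' B (traceMap h 2 f) := by
  suffices e : (demazureHom T' B).comp (traceMap h 2) =
      (traceMap h 2).mapMatrix.comp (demazureHom T B) from
    (congrFun (congrFun (DFunLike.congr_fun e f) 0) 1).symm
  apply hom_ext
  · intro i a
    simp only [AlgHom.comp_apply, traceMap_tok]
    ext x y
    fin_cases x <;> fin_cases y <;> simp [demazureHom, lift_tok, traceMap_tok]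
  · intro i
    simp only [AlgHom.comp_apply, traceMap_dot, map_smul, map_mul]
    have h3 : ksgn k (T.par + T'.par) • (demazureDot T' B i * tok T' i (u : A)) =
        traceMap h 2 (demazureDot T B i) := by
      fin_cases i
      · simp [demazureDot, traceMap_tele]
      · simp [demazureDot, traceMap_tele]
    ext x y
    fin_cases x <;> fin_cases y <;>
      simp [demazureHom, lift_tok, lift_dot, traceMap_dot, h3]

end Demazure
end Pol

end TraceChange

/-! ### Expansions of polynomials in normally ordered monomials -/

section NormalForm

variable {k A ι : Type*} [CommRing k] [Ring A] [Algebra k A]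
variable {𝒜 : ZMod 2 → Submodule k A} [GradedAlgebra 𝒜]

namespace Pol

variable (T : FrobeniusTrace 𝒜) {n : ℕ}

theorem tok_zero (i : Fin n) : tok T i 0 = 0 := map_zero (tokLin T i)

/-- The defining relation carries a token from the left of a dot to its right and applies `ψ`.
Normal ordering needs the opposite direction, which is available because `ψ` is surjective. -/
theorem exists_dot_mul_tok (i : Fin n) {p : ZMod 2} {a : A} (ha : a ∈ 𝒜 p) :
    ∃ b ∈ 𝒜 p, dot T i * tok T i a = tok T i b * dot T i := by
  obtain ⟨b, hb, rfl⟩ := exists_nakayama_eq T ha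
  refine ⟨ksgn k (T.par * p) • b, Submodule.smul_mem _ _ hb, ?_⟩
  rw [tok_smul, smul_mul_assoc, tok_dot T i hb, smul_smul, ksgn_mul_self, one_smul]

theorem dot_mul_tok_ne {i j : Fin n} (hij : i ≠ j) {p : ZMod 2} {a : A} (ha : a ∈ 𝒜 p) :
    dot T i * tok T j a = tok T j (ksgn k (T.par * p) • a) * dot T i := by
  rw [tok_smul, smul_mul_assoc, tok_dot_ne T hij ha, smul_smul, ksgn_mul_self, one_smul]

theorem dot_mul_dot_pow {i j : Fin n} (hij : i ≠ j) (r : ℕ) :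
    dot T i * dot T j ^ r = ksgn k (r * T.par) • (dot T j ^ r * dot T i) := by
  induction r with
  | zero => simp [ksgn]
  | succ r ih =>
    rw [pow_succ, ← mul_assoc, ih, smul_mul_assoc, mul_assoc, dot_comm T hij, mul_smul_comm,
      smul_smul, ← ksgn_add, mul_assoc]
    push_cast
    rw [add_mul, one_mul]

/-- The parity components are spanned by words built up by multiplying by generators on the left, so
stability under these multiplications is enough. It is applied to spans of normally ordered
monomials. -/
theorem parity_le_of_mul_mem (M : ZMod 2 → Submodule k (Pol T n)) (h1 : 1 ∈ M 0)
    (ht : ∀ i p q, ∀ a ∈ 𝒜 p, ∀ f ∈ M q, tok T i a * f ∈ M (p + q))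
    (hd : ∀ i q, ∀ f ∈ M q, dot T i * f ∈ M (T.par + q)) (p : ZMod 2) : parity T p ≤ M p := by
  refine Submodule.span_le.2 fun w hw => ?_
  induction hw with
  | one => exact h1
  | tok_mul i p q a w ha _ ih => exact ht i p q a ha w ih
  | dot_mul i q w _ ih => exact hd i q w ih

/-- The span of the monomials `a x^r` of parity `p`. -/
noncomputable def monomialSpan1 (p : ZMod 2) : Submodule k (Pol T 1) :=
  Submodule.span k {f | ∃ r : ℕ, ∃ a ∈ 𝒜 (p + r * T.par), tok T 0 a * dot T 0 ^ r = f}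

theorem parity_le_monomialSpan1 (p : ZMod 2) : parity T p ≤ monomialSpan1 T p := by
  refine parity_le_of_mul_mem T _ ?_ ?_ ?_ p
  · refine Submodule.subset_span ⟨0, 1, ?_, by simp [tok_one]⟩
    simpa using SetLike.one_mem_graded 𝒜
  · intro i p q a ha f hf
    induction hf using Submodule.span_induction with
    | zero => simp
    | add f g _ _ hf hg => rw [mul_add]; exact add_mem hf hg
    | smul c f _ hf => rw [mul_smul_comm]; exact Submodule.smul_mem _ _ hf
    | mem w hw =>
    obtain ⟨r, b, hb, rfl⟩ := hw
    obtain rfl := Subsingleton.elim i 0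
    rw [← mul_assoc, ← tok_mul]
    exact Submodule.subset_span ⟨r, _, by rw [add_assoc]; exact SetLike.mul_mem_graded ha hb, rfl⟩
  · intro i q f hf
    induction hf using Submodule.span_induction with
    | zero => simp
    | add f g _ _ hf hg => rw [mul_add]; exact add_mem hf hg
    | smul c f _ hf => rw [mul_smul_comm]; exact Submodule.smul_mem _ _ hf
    | mem w hw =>
    obtain ⟨r, b, hb, rfl⟩ := hw
    obtain rfl := Subsingleton.elim i 0
    obtain ⟨c, hc, e⟩ := exists_dot_mul_tok T (0 : Fin 1) hb
    rw [← mul_assoc, e, mul_assoc, ← pow_succ']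
    refine Submodule.subset_span ⟨r + 1, c, ?_, rfl⟩
    convert hc using 2
    push_cast
    generalize T.par = x, (r : ZMod 2) = y
    clear * -
    revert q x y; decide

theorem exists_poly1 {f : Pol T 1} (hf : f ∈ parity T 0) :
    ∃ (N : ℕ) (a : ∀ r : ℕ, 𝒜 (r * T.par)), LAW.poly1 T N a = f := by
  -- Vanishing of the coefficients from `N` on is added so that two expansions can be extended to a
  -- common bound before they are summed.
  suffices h : ∃ (N : ℕ) (a : ∀ r : ℕ, 𝒜 (r * T.par)), (∀ r, N ≤ r → a r = 0) ∧
      LAW.poly1 T N a = f from ⟨h.choose, h.choose_spec.choose, h.choose_spec.choose_spec.2⟩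
  have ext (N M : ℕ) (hNM : N ≤ M) (a : ∀ r : ℕ, 𝒜 (r * T.par)) (ha : ∀ r, N ≤ r → a r = 0) :
      LAW.poly1 T N a = LAW.poly1 T M a := by
    refine Finset.sum_subset (Finset.range_mono hNM) fun r _ hr => ?_
    rw [ha r (by simpa using hr), ZeroMemClass.coe_zero, tok_zero, zero_mul]
  replace hf := parity_le_monomialSpan1 T 0 hf
  induction hf using Submodule.span_induction with
  | zero => exact ⟨0, 0, fun _ _ => rfl, rfl⟩
  | add f g _ _ hf hg =>
    obtain ⟨N, a, ha, rfl⟩ := hf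
    obtain ⟨M, b, hb, rfl⟩ := hg
    refine ⟨max N M, a + b, fun r hr => ?_, ?_⟩
    · rw [Pi.add_apply, ha r ((le_max_left _ _).trans hr), hb r ((le_max_right _ _).trans hr),
        add_zero]
    · rw [ext N _ (le_max_left N M) a ha, ext M _ (le_max_right N M) b hb]
      simp [LAW.poly1, tok_add, add_mul, Finset.sum_add_distrib]
  | smul c f _ hf =>
    obtain ⟨N, a, ha, rfl⟩ := hf
    refine ⟨N, c • a, fun r hr => ?_, ?_⟩
    · rw [Pi.smul_apply, ha r hr, smul_zero]
    · simp [LAW.poly1, tok_smul, Finset.smul_sum]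
  | mem w hw =>
    obtain ⟨r, a, ha, rfl⟩ := hw
    rw [zero_add] at ha
    refine ⟨r + 1, Pi.single r ⟨a, ha⟩, fun s hs => ?_, ?_⟩
    · rw [Pi.single_eq_of_ne (by omega)]
    · rw [LAW.poly1, Finset.sum_eq_single r]
      · simp
      · intro s _ hs
        rw [Pi.single_eq_of_ne hs, ZeroMemClass.coe_zero, tok_zero, zero_mul]
      · simp

variable (B : HomogBasis 𝒜 ι)

/-- The monomial `(b ⊗ c) x_1^r x_2^s`. -/
noncomputable def basisMonomial (t : ι × ι × ℕ × ℕ) : Pol T 2 :=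
  tok T 0 (B.basis t.1) * tok T 1 (B.basis t.2.1) * dot T 0 ^ t.2.2.1 * dot T 1 ^ t.2.2.2

theorem basisMonomial_mem_parity {p : ZMod 2} (t : ι × ι × ℕ × ℕ)
    (ht : B.deg t.1 + B.deg t.2.1 + (t.2.2.1 + t.2.2.2) * T.par = p) :
    basisMonomial T B t ∈ parity T p := by
  have hp : ∀ (i : Fin 2) (r : ℕ) (q : ZMod 2), ∀ f ∈ parity T q,
      dot T i ^ r * f ∈ parity T (r * T.par + q) := by
    intro i r q f hf
    induction r with
    | zero => simpa using hf
    | succ r ih =>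
      rw [pow_succ', mul_assoc]
      convert dot_mul_mem_parity T i ih using 2
      push_cast
      ring
  have h := tok_mul_mem_parity T 0 (B.mem t.1) (tok_mul_mem_parity T 1 (B.mem t.2.1)
    (hp 0 t.2.2.1 _ _ (hp 1 t.2.2.2 _ _ one_mem_parity)))
  rw [mul_one, ← mul_assoc, ← mul_assoc] at h
  rw [← ht]
  convert h using 2
  · ring
  · rfl

variable [Fintype ι]

/-- The span of the monomials `(b ⊗ c) x_1^r x_2^s` of parity `p`. -/
noncomputable def monomialSpan2 (p : ZMod 2) : Submodule k (Pol T 2) :=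
  Submodule.span k (basisMonomial T B ''
    {t | B.deg t.1 + B.deg t.2.1 + (t.2.2.1 + t.2.2.2) * T.par = p})

theorem mem_span_basis_deg {p : ZMod 2} {a : A} (ha : a ∈ 𝒜 p) :
    a ∈ Submodule.span k (B.basis '' {i | B.deg i = p}) := by
  rw [← B.basis.sum_repr a]
  refine sum_mem fun i _ => ?_
  by_cases hi : B.deg i = p
  · exact Submodule.smul_mem _ _ (Submodule.subset_span ⟨i, hi, rfl⟩)
  · rw [repr_eq_zero B ha hi, zero_smul]
    exact zero_mem _

/-- Bilinearity in the two tokens reduces to basis elements of the same parities. This allows the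
normal ordering argument to use arbitrary homogeneous tokens. -/
theorem monomial_mem_monomialSpan2 {p q e : ZMod 2} {a b : A} (ha : a ∈ 𝒜 p) (hb : b ∈ 𝒜 q)
    (r s : ℕ) (he : p + q + (r + s) * T.par = e) :
    tok T 0 a * tok T 1 b * dot T 0 ^ r * dot T 1 ^ s ∈ monomialSpan2 T B e := by
  let m : A →ₗ[k] A →ₗ[k] Pol T 2 :=
    ((LinearMap.mul k (Pol T 2)).compl₁₂ (tokLin T 0) (tokLin T 1)).compr₂
      (LinearMap.mulRight k (dot T 0 ^ r * dot T 1 ^ s))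
  have hm : ∀ a b, m a b = tok T 0 a * tok T 1 b * dot T 0 ^ r * dot T 1 ^ s := fun a b =>
    (mul_assoc _ _ _).symm
  rw [← hm]
  refine bilin_mem m ?_ (mem_span_basis_deg B ha) (mem_span_basis_deg B hb)
  rintro _ ⟨i, rfl, rfl⟩ _ ⟨j, rfl, rfl⟩
  rw [hm]
  exact Submodule.subset_span ⟨(i, j, r, s), he, rfl⟩

theorem parity_le_monomialSpan2 (p : ZMod 2) : parity T p ≤ monomialSpan2 T B p := by
  refine parity_le_of_mul_mem T _ ?_ ?_ ?_ p
  · have := monomial_mem_monomialSpan2 T B (SetLike.one_mem_graded 𝒜) (SetLike.one_mem_graded 𝒜) 0 0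
      (e := 0) (by simp)
    simpa [tok_one] using this
  · intro i p q a ha f hf
    induction hf using Submodule.span_induction with
    | zero => simp
    | add f g _ _ hf hg => rw [mul_add]; exact add_mem hf hg
    | smul c f _ hf => rw [mul_smul_comm]; exact Submodule.smul_mem _ _ hf
    | mem w hw =>
    obtain ⟨⟨b, c, r, s⟩, hq, rfl⟩ := hw
    simp only [Set.mem_ofPred_eq] at hq
    simp only [basisMonomial, ← mul_assoc]
    fin_cases i
    · simp only [Fin.zero_eta, ← tok_mul]
      refine monomial_mem_monomialSpan2 T B (SetLike.mul_mem_graded ha (B.mem b)) (B.mem c) r s ?_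
      rw [← hq]; ring
    · simp only [Fin.mk_one]
      rw [tok_comm T (by decide) ha (B.mem b)]
      simp only [smul_mul_assoc]
      rw [mul_assoc (tok T 0 _), ← tok_mul]
      refine Submodule.smul_mem _ _ (monomial_mem_monomialSpan2 T B (B.mem b)
        (SetLike.mul_mem_graded ha (B.mem c)) r s ?_)
      rw [← hq]; ring
  · intro i q f hf
    induction hf using Submodule.span_induction with
    | zero => simp
    | add f g _ _ hf hg => rw [mul_add]; exact add_mem hf hg
    | smul c f _ hf => rw [mul_smul_comm]; exact Submodule.smul_mem _ _ hf
    | mem w hw =>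
    obtain ⟨⟨b, c, r, s⟩, hq, rfl⟩ := hw
    simp only [Set.mem_ofPred_eq] at hq
    simp only [basisMonomial, ← mul_assoc]
    fin_cases i
    · obtain ⟨b', hb', e⟩ := exists_dot_mul_tok T (0 : Fin 2) (B.mem b)
      simp only [Fin.zero_eta]
      rw [e, mul_assoc (tok T 0 _), dot_mul_tok_ne T (by decide) (B.mem c), ← mul_assoc,
        mul_assoc _ (dot T 0), ← pow_succ']
      refine monomial_mem_monomialSpan2 T B hb' (Submodule.smul_mem _ _ (B.mem c)) (r + 1) s ?_
      rw [← hq]; push_cast; ring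
    · obtain ⟨c', hc', e⟩ := exists_dot_mul_tok T (1 : Fin 2) (B.mem c)
      simp only [Fin.mk_one]
      -- The second dot has to cross the token on strand one, the token on its own strand and the
      -- power of the first dot. The tokens are replaced by others of the same parity, and the last
      -- crossing costs a sign.
      rw [dot_mul_tok_ne T (by decide) (B.mem b), mul_assoc (tok T 0 _), e, ← mul_assoc,
        mul_assoc _ (dot T 1), dot_mul_dot_pow T (by decide), mul_smul_comm, smul_mul_assoc,
        ← mul_assoc, mul_assoc _ (dot T 1), ← pow_succ']
      refine Submodule.smul_mem _ _ (monomial_mem_monomialSpan2 T B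
        (Submodule.smul_mem _ _ (B.mem b)) hc' r (s + 1) ?_)
      rw [← hq]; push_cast; ring

theorem exists_poly2 {f : Pol T 2} (hf : f ∈ parity T 0) :
    ∃ (N : ℕ) (l : ι → ι → ℕ → ℕ → k),
      (∀ b c r s, l b c r s ≠ 0 → B.deg b + B.deg c + (r + s) * T.par = 0) ∧
        LAW.poly2 B T N l = f := by
  replace hf := parity_le_monomialSpan2 T B 0 hf
  rw [monomialSpan2, Finsupp.mem_span_image_iff_linearCombination] at hf
  obtain ⟨L, hL, rfl⟩ := hf
  -- One more than the largest total degree in the support bounds both exponents strictly, as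
  -- `Finset.range` requires.
  refine ⟨L.support.sup (fun t => t.2.2.1 + t.2.2.2) + 1, fun b c r s => L (b, c, r, s), ?_, ?_⟩
  · intro b c r s h
    exact (Finsupp.mem_supported _ _).1 hL (Finsupp.mem_support_iff.2 h)
  · set N := L.support.sup (fun t => t.2.2.1 + t.2.2.2) + 1
    rw [Finsupp.linearCombination_apply, Finsupp.sum_of_support_subset
      (s := Finset.univ ×ˢ Finset.univ ×ˢ Finset.range N ×ˢ Finset.range N) L ?_ _ (by simp)]
    · simp only [Finset.sum_product]
      rfl
    · intro t ht
      have := Finset.le_sup (f := fun t : ι × ι × ℕ × ℕ => t.2.2.1 + t.2.2.2) ht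
      simp only [Finset.mem_product, Finset.mem_univ, Finset.mem_range, true_and, N]
      constructor <;> omega

/-- This supplies the evenness of `∂(Q_1)` in the last relation from the expansion given there,
without a separate study of how `∂` acts on parities. -/
theorem poly2_mem_parity (N : ℕ) (l : ι → ι → ℕ → ℕ → k)
    (hl : ∀ b c r s, l b c r s ≠ 0 → B.deg b + B.deg c + (r + s) * T.par = 0) :
    LAW.poly2 B T N l ∈ parity T 0 := by
  refine sum_mem fun b _ => sum_mem fun c _ => sum_mem fun r _ => sum_mem fun s _ => ?_
  by_cases h : l b c r s = 0
  · rw [h, zero_smul]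
    exact zero_mem _
  · exact Submodule.smul_mem _ _ (basisMonomial_mem_parity T B (b, c, r, s) (hl b c r s h))

end Pol

end NormalForm

universe u' v' w'

/-! ### Endomorphism algebras of objects, and whiskering -/

namespace MonoidalSupercat

variable {k : Type u} [CommRing k] (C : MonoidalSupercat.{u, v, w} k)

/-- The endomorphism superalgebra of an object. -/
def End (X : C.Obj) : Type _ := C.Hom X X

namespace End

variable {C} {X Y : C.Obj}

instance : AddCommGroup (C.End X) := inferInstanceAs (AddCommGroup (C.Hom X X))

instance : Module k (C.End X) := inferInstanceAs (Module k (C.Hom X X))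

instance : Mul (C.End X) := ⟨fun f g => C.comp f g⟩

instance : One (C.End X) := ⟨C.id X⟩

noncomputable instance : Ring (C.End X) :=
  { (inferInstance : AddCommGroup (C.End X)) with
    left_distrib := fun f g h => map_add (C.comp f) g h
    right_distrib := fun f g h => LinearMap.congr_fun (map_add C.comp f g) h
    zero_mul := fun f => LinearMap.congr_fun (map_zero C.comp) f
    mul_zero := fun f => map_zero (C.comp f)
    mul_assoc := C.assoc
    one_mul := C.id_comp
    mul_one := C.comp_id }

noncomputable instance : Algebra k (C.End X) :=
  Algebra.ofModule (fun c f g => LinearMap.congr_fun (map_smul C.comp c f) g)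
    (fun c f g => map_smul (C.comp f) c g)

end End

variable {C}

theorem exists_add_parity {X Y : C.Obj} (f : C.Hom X Y) :
    ∃ g ∈ C.parity X Y 0, ∃ h ∈ C.parity X Y 1, g + h = f :=
  Submodule.mem_sup.1 ((codisjoint_iff.1 (C.isCompl_parity X Y).codisjoint).symm ▸ Submodule.mem_top)

/-- The interchange sign involves only the two middle morphisms and is trivial once one of them is
even. The other one can then be split into homogeneous parts and need not be homogeneous itself. -/
theorem interchange_of_even_right {X Y Z X' Y' Z' : C.Obj} {g : C.Hom Y' Z'} (f' : C.Hom Y Z)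
    (f : C.Hom X Y) (g' : C.Hom X' Y') (hg : g ∈ C.parity Y' Z' 0) :
    C.comp (C.tensor f' g) (C.tensor f g') = C.tensor (C.comp f' f) (C.comp g g') := by
  obtain ⟨a, ha, b, hb, rfl⟩ := C.exists_add_parity f
  simp only [map_add, LinearMap.add_apply, C.interchange f' g' ha hg, C.interchange f' g' hb hg]
  simp [ksgn]

theorem interchange_of_even_left {X Y Z X' Y' Z' : C.Obj} {f : C.Hom X Y} (f' : C.Hom Y Z)
    (g : C.Hom Y' Z') (g' : C.Hom X' Y') (hf : f ∈ C.parity X Y 0) :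
    C.comp (C.tensor f' g) (C.tensor f g') = C.tensor (C.comp f' f) (C.comp g g') := by
  obtain ⟨a, ha, b, hb, rfl⟩ := C.exists_add_parity g
  simp only [map_add, LinearMap.add_apply, C.interchange f' g' hf ha, C.interchange f' g' hf hb]
  simp [ksgn]

variable (X Y : C.Obj)

/-- `f ↦ f ⊗ 1_Y`, as a homomorphism of endomorphism algebras. -/
noncomputable def whiskerR : C.End X →ₐ[k] C.End (X * Y) :=
  AlgHom.ofLinearMap ((C.tensor (X := X) (Y := X)).flip (C.id Y)) (C.tensor_id X Y) fun f g => by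
    refine .trans ?_ (interchange_of_even_right f g (C.id Y) (C.id_mem Y)).symm
    rw [C.id_comp]
    rfl

/-- `f ↦ 1_X ⊗ f`, as a homomorphism of endomorphism algebras. -/
noncomputable def whiskerL : C.End Y →ₐ[k] C.End (X * Y) :=
  AlgHom.ofLinearMap (C.tensor (C.id X)) (C.tensor_id X Y) fun f g => by
    refine .trans ?_ (interchange_of_even_left (C.id X) f g (C.id_mem X)).symm
    rw [C.id_comp]
    rfl

variable {X Y}

theorem whiskerR_mul_whiskerL (f : C.End X) (g : C.End Y) :
    whiskerR X Y f * whiskerL X Y g = C.tensor f g :=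
  (interchange_of_even_left f (C.id Y) g (C.id_mem X)).trans
    (congrArg₂ (fun a b => C.tensor a b) (C.comp_id f) (C.id_comp g))

/-- Super interchange makes endomorphisms of the two tensor factors supercommute; this is the source
of all relations in `Pol_2` between different strands. -/
theorem whiskerL_mul_whiskerR {f : C.End X} {g : C.End Y} {p q : ZMod 2} (hf : f ∈ C.parity X X p)
    (hg : g ∈ C.parity Y Y q) :
    whiskerL X Y g * whiskerR X Y f = ksgn k (p * q) • (whiskerR X Y f * whiskerL X Y g) := by
  rw [whiskerR_mul_whiskerL]
  exact (C.interchange (C.id X) (C.id Y) hf hg).trans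
    (congrArg₂ (fun a b => ksgn k (p * q) • C.tensor a b) (C.id_comp f) (C.comp_id g))

theorem whiskerR_mul_whiskerL_comm {f : C.End X} {g : C.End Y} {p q : ZMod 2}
    (hf : f ∈ C.parity X X p) (hg : g ∈ C.parity Y Y q) :
    whiskerR X Y f * whiskerL X Y g =
      ksgn k (p * q) • (whiskerL X Y g * whiskerR X Y f) := by
  rw [whiskerL_mul_whiskerR hf hg, smul_smul, ksgn_mul_self, one_smul]

theorem whiskerR_mem {f : C.End X} {p : ZMod 2} (hf : f ∈ C.parity X X p) :
    (whiskerR X Y f : C.Hom (X * Y) (X * Y)) ∈ C.parity (X * Y) (X * Y) p := by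
  have h := C.tensor_mem hf (C.id_mem Y)
  rwa [add_zero] at h

/-! ### Transport of morphisms along equalities of objects -/

section HEq

theorem comp_heq {X X' Y Y' Z Z' : C.Obj} (hX : X = X') (hY : Y = Y') (hZ : Z = Z')
    {f : C.Hom Y Z} {f' : C.Hom Y' Z'} {g : C.Hom X Y} {g' : C.Hom X' Y'} (hf : HEq f f')
    (hg : HEq g g') : HEq (C.comp f g) (C.comp f' g') := by
  subst hX hY hZ hf hg; rfl

theorem tensor_heq {X X' Y Y' Z Z' W W' : C.Obj} (hX : X = X') (hY : Y = Y') (hZ : Z = Z')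
    (hW : W = W') {f : C.Hom X Y} {f' : C.Hom X' Y'} {g : C.Hom Z W} {g' : C.Hom Z' W'}
    (hf : HEq f f') (hg : HEq g g') : HEq (C.tensor f g) (C.tensor f' g') := by
  subst hX hY hZ hW hf hg; rfl

theorem id_heq {X X' : C.Obj} (hX : X = X') : HEq (C.id X) (C.id X') := by
  subst hX; rfl

theorem zero_heq {X X' Y Y' : C.Obj} (hX : X = X') (hY : Y = Y') :
    HEq (0 : C.Hom X Y) (0 : C.Hom X' Y') := by
  subst hX hY; rfl

theorem add_heq {X X' Y Y' : C.Obj} (hX : X = X') (hY : Y = Y') {f g : C.Hom X Y}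
    {f' g' : C.Hom X' Y'} (hf : HEq f f') (hg : HEq g g') : HEq (f + g) (f' + g') := by
  subst hX hY hf hg; rfl

theorem smul_heq {X X' Y Y' : C.Obj} (hX : X = X') (hY : Y = Y') (c : k) {f : C.Hom X Y}
    {f' : C.Hom X' Y'} (hf : HEq f f') : HEq (c • f) (c • f') := by
  subst hX hY hf; rfl

theorem mem_parity_of_heq {X X' Y Y' : C.Obj} (hX : X = X') (hY : Y = Y') {p : ZMod 2}
    {f : C.Hom X Y} {f' : C.Hom X' Y'} (h : HEq f f') (hf : f ∈ C.parity X Y p) :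
    f' ∈ C.parity X' Y' p := by
  subst hX hY h; exact hf

theorem cast_heq_hom {X X' Y Y' : C.Obj} (hX : X = X') (hY : Y = Y') (f : C.Hom X Y) :
    ∃ f' : C.Hom X' Y', HEq f' f := by
  subst hX hY; exact ⟨f, HEq.rfl⟩

end HEq

end MonoidalSupercat

namespace MonoidalSuperfunctor

variable {k : Type u} [CommRing k] {C : MonoidalSupercat.{u, v, w} k}
  {D : MonoidalSupercat.{u, v', w'} k} {φ : C.Obj →* D.Obj}

theorem map_heq (F : MonoidalSuperfunctor C D φ) {X X' Y Y' : C.Obj} (hX : X = X') (hY : Y = Y')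
    {f : C.Hom X Y} {f' : C.Hom X' Y'} (h : HEq f f') : HEq (F.map f) (F.map f') := by
  subst hX hY h; rfl

section

variable {γ : D.Obj →* C.Obj} (F : MonoidalSuperfunctor C D φ) (G : MonoidalSuperfunctor D C γ)
  {X Y : C.Obj}

theorem map_map_zero_heq (hX : γ (φ X) = X) (hY : γ (φ Y) = Y) :
    HEq (G.map (F.map (0 : C.Hom X Y))) (0 : C.Hom X Y) := by
  rw [map_zero, map_zero]
  exact MonoidalSupercat.zero_heq hX hY

theorem map_map_add_heq (hX : γ (φ X) = X) (hY : γ (φ Y) = Y) {f g : C.Hom X Y}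
    (hf : HEq (G.map (F.map f)) f) (hg : HEq (G.map (F.map g)) g) :
    HEq (G.map (F.map (f + g))) (f + g) := by
  rw [map_add, map_add]
  exact MonoidalSupercat.add_heq hX hY hf hg

theorem map_map_smul_heq (hX : γ (φ X) = X) (hY : γ (φ Y) = Y) (c : k) {f : C.Hom X Y}
    (hf : HEq (G.map (F.map f)) f) : HEq (G.map (F.map (c • f))) (c • f) := by
  rw [map_smul, map_smul]
  exact MonoidalSupercat.smul_heq hX hY c hf

end

end MonoidalSuperfunctor

/-! ### Functors out of presented categories -/

section Presented

variable {k : Type u} [CommRing k] {S : Signature.{v, w}} {S' : Signature.{v', w'}}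
variable {R : ∀ X Y : FreeMonoid S.Letter, Set (LDiag k S X Y)}
variable {R' : ∀ X Y : FreeMonoid S'.Letter, Set (LDiag k S' X Y)}

theorem compQ_id_left {X Y : FreeMonoid S.Letter} (hR : IsHomogRel R) (f : PHom R X Y) :
    compQ R (cls R (mono k (.id Y))) f = f := (presented R hR).id_comp f

theorem compQ_id_right {X Y : FreeMonoid S.Letter} (hR : IsHomogRel R) (f : PHom R X Y) :
    compQ R f (cls R (mono k (.id X))) = f := (presented R hR).comp_id f

theorem compQ_assoc {X Y Z W : FreeMonoid S.Letter} (hR : IsHomogRel R) (f : PHom R Z W)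
    (g : PHom R Y Z) (h : PHom R X Y) :
    compQ R (compQ R f g) h = compQ R f (compQ R g h) := (presented R hR).assoc f g h

theorem tensorQ_id {X Y V : FreeMonoid S.Letter} (h h' : V = X * Y) :
    tensorQ R h h' (cls R (mono k (.id X))) (cls R (mono k (.id Y))) = cls R (mono k (.id V)) := by
  rw [tensorQ_cls, tensorL_mono, cls_eq (.tensor_id h h')]

theorem tensorQ_interchange {X Y Z X' Y' Z' U V W : FreeMonoid S.Letter} (hR : IsHomogRel R)
    {p q : ZMod 2} (f' : PHom R Y Z) {f : PHom R X Y} {g : PHom R Y' Z'} (g' : PHom R X' Y')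
    (hU : U = X * X') (hV hV' : V = Y * Y') (hW : W = Z * Z') (hf : f ∈ parityQ R X Y p)
    (hg : g ∈ parityQ R Y' Z' q) :
    compQ R (tensorQ R hV hW f' g) (tensorQ R hU hV' f g') =
      ksgn k (p * q) • tensorQ R hU hW (compQ R f' f) (compQ R g g') := by
  subst hU hV hW
  exact (presented R hR).interchange f' g' hf hg

theorem tensorQ_assoc {X Y X' Y' X'' Y'' V W V' W' V'' W'' : FreeMonoid S.Letter}
    (hR : IsHomogRel R) (f : PHom R X Y) (g : PHom R X' Y') (h : PHom R X'' Y'')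
    (h1 : V' = X * X') (h2 : W' = Y * Y') (h3 : V = V' * X'')
    (h4 : W = W' * Y'') (h5 : V'' = X' * X'') (h6 : W'' = Y' * Y'') (h7 : V = X * V'')
    (h8 : W = Y * W'') :
    tensorQ R h3 h4 (tensorQ R h1 h2 f g) h = tensorQ R h7 h8 f (tensorQ R h5 h6 g h) := by
  subst h1 h2 h3 h4 h5 h6
  exact eq_of_heq (((presented R hR).tensor_assoc f g h).trans (tensorQ_heq h7 h8 _ _))

/-- The unit object is a variable `E` because the image of the empty word under a monoid
homomorphism equals the empty word only propositionally. -/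
theorem tensorQ_one_left {E X Y : FreeMonoid S.Letter} (hR : IsHomogRel R) (hE : E = 1)
    (f : PHom R X Y) (h : X = E * X) (h' : Y = E * Y) :
    tensorQ R h h' (cls R (mono k (.id E))) f = f := by
  subst hE
  exact eq_of_heq ((tensorQ_heq h h' _ _).symm.trans ((presented R hR).one_tensor f))

theorem tensorQ_one_right {E X Y : FreeMonoid S.Letter} (hR : IsHomogRel R) (hE : E = 1)
    (f : PHom R X Y) (h : X = X * E) (h' : Y = Y * E) :
    tensorQ R h h' f (cls R (mono k (.id E))) = f := by
  subst hE
  exact eq_of_heq ((tensorQ_heq h h' _ _).symm.trans ((presented R hR).tensor_one f))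

variable (R') (φ : FreeMonoid S.Letter →* FreeMonoid S'.Letter)
variable (m : ∀ {X Y}, S.Gen X Y → PHom R' (φ X) (φ Y))

theorem map_eq_mul {V X Y : FreeMonoid S.Letter} (h : V = X * Y) : φ V = φ X * φ Y :=
  (congrArg φ h).trans (map_mul φ X Y)

/-- Evaluation of diagrams, given the images of the generators. -/
noncomputable def evalDiag : ∀ {X Y}, Diag S X Y → PHom R' (φ X) (φ Y)
  | _, _, .id X => cls R' (mono k (.id (φ X)))
  | _, _, .gen g => m g
  | _, _, .comp f g => compQ R' (evalDiag f) (evalDiag g)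
  | _, _, .tensor f g hV hW => tensorQ R' (map_eq_mul φ hV) (map_eq_mul φ hW) (evalDiag f) (evalDiag g)

/-- Evaluation of linear combinations of diagrams, given the images of the generators. -/
noncomputable def evalL {X Y} : LDiag k S X Y →ₗ[k] PHom R' (φ X) (φ Y) :=
  Finsupp.linearCombination k (evalDiag R' φ m)

theorem evalL_mono {X Y} (D : Diag S X Y) : evalL R' φ m (mono k D) = evalDiag R' φ m D := by
  simp [evalL, mono]

theorem evalL_compL {X Y Z : FreeMonoid S.Letter} (f : LDiag k S Y Z) (g : LDiag k S X Y) :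
    evalL R' φ m (compL k f g) = compQ R' (evalL R' φ m f) (evalL R' φ m g) := by
  induction f using mono_induction with
  | zero => simp
  | add f f' hf hf' => simp only [map_add, LinearMap.add_apply, hf, hf']
  | smul a D =>
  induction g using mono_induction with
  | zero => simp
  | add f f' hf hf' => simp only [map_add, hf, hf']
  | smul b E =>
  simp only [map_smul, LinearMap.smul_apply, compL_mono, evalL_mono, evalDiag]

theorem evalL_tensorL {X Y X' Y' V W : FreeMonoid S.Letter} (hV : V = X * X') (hW : W = Y * Y')
    (f : LDiag k S X Y) (g : LDiag k S X' Y') :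
    evalL R' φ m (tensorL k hV hW f g) =
      tensorQ R' (map_eq_mul φ hV) (map_eq_mul φ hW) (evalL R' φ m f) (evalL R' φ m g) := by
  induction f using mono_induction with
  | zero => simp
  | add f f' hf hf' => simp only [map_add, LinearMap.add_apply, hf, hf']
  | smul a D =>
  induction g using mono_induction with
  | zero => simp
  | add f f' hf hf' => simp only [map_add, hf, hf']
  | smul b E =>
  simp only [map_smul, LinearMap.smul_apply, tensorL_mono, evalL_mono, evalDiag]

variable {R' φ m}

theorem evalDiag_mem (hm : ∀ {X Y} (g : S.Gen X Y), m g ∈ parityQ R' (φ X) (φ Y) (S.parity g))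
    {X Y} (D : Diag S X Y) : evalDiag R' φ m D ∈ parityQ R' (φ X) (φ Y) D.parity := by
  induction D with
  | id X => exact id_memQ _
  | gen g => exact hm g
  | comp f g hf hg => exact compQ_mem hf hg
  | tensor f g hV hW hf hg => exact tensorQ_mem _ _ hf hg

theorem evalL_mem (hm : ∀ {X Y} (g : S.Gen X Y), m g ∈ parityQ R' (φ X) (φ Y) (S.parity g))
    {X Y} {p : ZMod 2} {f : LDiag k S X Y} (hf : f ∈ parityL k X Y p) :
    evalL R' φ m f ∈ parityQ R' (φ X) (φ Y) p := by
  induction hf using Submodule.span_induction with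
  | zero => simp
  | add f g _ _ hf hg => rw [map_add]; exact add_mem hf hg
  | smul c f _ hf => rw [map_smul]; exact Submodule.smul_mem _ _ hf
  | mem w hw =>
    obtain ⟨D, rfl, rfl⟩ := hw
    rw [evalL_mono]
    exact evalDiag_mem hm D

/-- The axioms of a strict monoidal supercategory already hold in the target, and evaluation
respects both compositions, so only the given relations have to be checked. That generators keep
their parity is used to match the sign in the interchange law. -/
theorem evalL_relator (hR' : IsHomogRel R')
    (hm : ∀ {X Y} (g : S.Gen X Y), m g ∈ parityQ R' (φ X) (φ Y) (S.parity g))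
    (hr : ∀ X Y, ∀ r ∈ R X Y, evalL R' φ m r = 0) {X Y : FreeMonoid S.Letter} {r : LDiag k S X Y}
    (h : Relator R r) : evalL R' φ m r = 0 := by
  induction h with
  | rel r h => exact hr _ _ r h
  | id_comp f => simp only [map_sub, evalL_mono, evalDiag, compQ_id_left hR', sub_self]
  | comp_id f => simp only [map_sub, evalL_mono, evalDiag, compQ_id_right hR', sub_self]
  | assoc f g h => simp only [map_sub, evalL_mono, evalDiag, compQ_assoc hR', sub_self]
  | tensor_id h h' => simp only [map_sub, evalL_mono, evalDiag, tensorQ_id, sub_self]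
  | interchange f' f g g' _ _ _ _ =>
    simp only [map_sub, map_smul, evalL_mono, evalDiag]
    rw [tensorQ_interchange hR' _ _ _ _ _ _ (evalDiag_mem hm f) (evalDiag_mem hm g), sub_self]
  | tensor_assoc f g h _ _ _ _ h5 h6 h7 h8 =>
    simp only [map_sub, evalL_mono, evalDiag]
    exact sub_eq_zero.2 (tensorQ_assoc hR' _ _ _ _ _ _ _ (map_eq_mul φ h5) (map_eq_mul φ h6)
      (map_eq_mul φ h7) (map_eq_mul φ h8))
  | one_tensor f h h' =>
    simp only [map_sub, evalL_mono, evalDiag]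
    exact sub_eq_zero.2 (tensorQ_one_left hR' (map_one φ) (evalDiag R' φ m f) _ _)
  | tensor_one f h h' =>
    simp only [map_sub, evalL_mono, evalDiag]
    exact sub_eq_zero.2 (tensorQ_one_right hR' (map_one φ) (evalDiag R' φ m f) _ _)
  | comp_left D r _ ih => rw [evalL_compL, ih, map_zero]
  | comp_right r D _ ih => rw [evalL_compL, ih, map_zero, LinearMap.zero_apply]
  | tensor_left D r hV hW _ ih => rw [evalL_tensorL, ih, map_zero]
  | tensor_right r D hV hW _ ih => rw [evalL_tensorL, ih, map_zero, LinearMap.zero_apply]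

/-- The superfunctor between presented monoidal supercategories given by the images of the
generators. -/
noncomputable def presentedFunctor (hR : IsHomogRel R) (hR' : IsHomogRel R')
    (φ : FreeMonoid S.Letter →* FreeMonoid S'.Letter)
    (m : ∀ {X Y}, S.Gen X Y → PHom R' (φ X) (φ Y))
    (hm : ∀ {X Y} (g : S.Gen X Y), m g ∈ parityQ R' (φ X) (φ Y) (S.parity g))
    (hr : ∀ X Y, ∀ r ∈ R X Y, evalL R' φ m r = 0) :
    MonoidalSuperfunctor (presented R hR) (presented R' hR') φ where
  map {X Y} := (idealOf R X Y).liftQ (evalL R' φ m)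
    (Submodule.span_le.2 fun _ h => evalL_relator hR' hm hr h)
  map_mem := by
    rintro X Y p _ ⟨f, hf, rfl⟩
    exact evalL_mem hm hf
  map_id X := evalL_mono R' φ m (.id X)
  map_comp f g := by
    obtain ⟨f, rfl⟩ := Submodule.mkQ_surjective _ f
    obtain ⟨g, rfl⟩ := Submodule.mkQ_surjective _ g
    exact evalL_compL R' φ m f g
  map_tensor f g := by
    obtain ⟨f, rfl⟩ := Submodule.mkQ_surjective _ f
    obtain ⟨g, rfl⟩ := Submodule.mkQ_surjective _ g
    refine (heq_of_eq (evalL_tensorL R' φ m rfl rfl f g)).trans ?_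
    exact (tensorQ_heq (map_eq_mul φ rfl) (map_eq_mul φ rfl) _ _).symm

theorem presentedFunctor_cls (hR : IsHomogRel R) (hR' : IsHomogRel R')
    (hm : ∀ {X Y} (g : S.Gen X Y), m g ∈ parityQ R' (φ X) (φ Y) (S.parity g))
    (hr : ∀ X Y, ∀ r ∈ R X Y, evalL R' φ m r = 0) {X Y} (D : Diag S X Y) :
    (presentedFunctor hR hR' φ m hm hr).map (cls R (mono k D)) = evalDiag R' φ m D :=
  evalL_mono R' φ m D

/-- A composite of superfunctors fixing objects and generators fixes all morphisms. -/
theorem map_map_heq_of_gen (hR : IsHomogRel R) {D : MonoidalSupercat.{u, v', w'} k}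
    {φ : (presented R hR).Obj →* D.Obj} {γ : D.Obj →* (presented R hR).Obj}
    (F : MonoidalSuperfunctor (presented R hR) D φ) (G : MonoidalSuperfunctor D (presented R hR) γ)
    (hφ : ∀ X, γ (φ X) = X)
    (hgen : ∀ {X Y} (g : S.Gen X Y), HEq (G.map (F.map (cls R (mono k (.gen g))))) (cls R (mono k (.gen g))))
    {X Y : (presented R hR).Obj} (f : (presented R hR).Hom X Y) : HEq (G.map (F.map f)) f := by
  have hD : ∀ {X Y : FreeMonoid S.Letter} (E : Diag S X Y),
      HEq (G.map (F.map (cls R (mono k E) : (presented R hR).Hom X Y))) (cls R (mono k E)) := by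
    intro X Y E
    induction E with
    | id X =>
      have h := congrArg G.map (F.map_id X)
      rw [G.map_id] at h
      exact (heq_of_eq h).trans (MonoidalSupercat.id_heq (C := presented R hR) (hφ X))
    | gen g => exact hgen g
    | @comp X Y Z f g hf hg =>
      have h := congrArg G.map (F.map_comp (cls R (mono k f) : (presented R hR).Hom Y Z) (cls R (mono k g)))
      rw [G.map_comp] at h
      have e : cls R (mono k (.comp f g)) = (presented R hR).comp (cls R (mono k f)) (cls R (mono k g)) := by
        rw [← compL_mono]; rfl
      rw [e]
      exact (heq_of_eq h).trans
        (MonoidalSupercat.comp_heq (C := presented R hR) (hφ X) (hφ Y) (hφ Z) hf hg)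
    | @tensor X Y X' Y' V W f g hV hW hf hg =>
      subst hV hW
      have e : cls R (mono k (.tensor f g rfl rfl)) =
          (presented R hR).tensor (cls R (mono k f)) (cls R (mono k g)) := by
        rw [← tensorL_mono]; rfl
      rw [e]
      -- The first functor respects tensor products only up to equality of objects, so the second is
      -- applied across a heterogeneous equality.
      refine (G.map_heq (map_mul φ X X') (map_mul φ Y Y') (F.map_tensor _ _)).trans ?_
      refine (G.map_tensor _ _).trans ?_
      exact MonoidalSupercat.tensor_heq (C := presented R hR) (hφ X) (hφ Y) (hφ X') (hφ Y') hf hg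
  induction f using cls_induction (R := R) with
  | zero => exact F.map_map_zero_heq G (hφ X) (hφ Y)
  | add f g hf hg => exact F.map_map_add_heq G (hφ X) (hφ Y) hf hg
  | smul c E => exact F.map_map_smul_heq G (hφ X) (hφ Y) c (hD E)

end Presented

/-! ### Actions of polynomial algebras on objects -/

namespace MonoidalSupercat

variable {k : Type u} [CommRing k] {C : MonoidalSupercat.{u, v, w} k} {X Y : C.Obj}

/-- A crossing that slides past dots and past tokens also slides past their products. This handles
the image of the dot, which is a scalar times a dot composed with a token. -/
theorem comp_mul_of_comm {b : C.Hom X Y} {f g : C.End X} {f' g' : C.End Y}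
    (hf : C.comp b f = C.comp f' b) (hg : C.comp b g = C.comp g' b) :
    C.comp b (f * g : C.End X) = C.comp (f' * g' : C.End Y) b :=
  calc C.comp b (f * g : C.End X) = C.comp (C.comp b f) g := (C.assoc b f g).symm
    _ = C.comp (C.comp f' b) g := by rw [hf]
    _ = C.comp f' (C.comp b g) := C.assoc f' b g
    _ = C.comp f' (C.comp g' b) := by rw [hg]
    _ = C.comp (f' * g' : C.End Y) b := (C.assoc f' g' b).symm

theorem comp_smul_of_comm {b : C.Hom X Y} {f : C.End X} {f' : C.End Y} (c : k)
    (hf : C.comp b f = C.comp f' b) :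
    C.comp b (c • f : C.End X) = C.comp (c • f' : C.End Y) b :=
  calc C.comp b (c • f : C.End X) = c • C.comp b f := map_smul (C.comp b) c f
    _ = c • C.comp f' b := by rw [hf]
    _ = C.comp (c • f' : C.End Y) b := (LinearMap.congr_fun (map_smul C.comp c f') b).symm

variable {A : Type v'} [Ring A] [Algebra k A] {𝒜 : ZMod 2 → Submodule k A} [GradedAlgebra 𝒜]
  {T : FrobeniusTrace 𝒜}

/-- An action of `Pol_1(A)` on an object by even maps. -/
structure IsSuperAction (e : Pol T 1 →ₐ[k] C.End X) : Prop where
  tok_mem : ∀ p, ∀ a ∈ 𝒜 p, (e (Pol.tok T 0 a) : C.Hom X X) ∈ C.parity X X p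
  dot_mem : (e (Pol.dot T 0) : C.Hom X X) ∈ C.parity X X T.par

theorem IsSuperAction.whiskerR {e : Pol T 1 →ₐ[k] C.End X} (he : IsSuperAction e) (Y : C.Obj) :
    IsSuperAction ((MonoidalSupercat.whiskerR X Y).comp e) :=
  ⟨fun p a ha => whiskerR_mem (he.tok_mem p a ha), whiskerR_mem he.dot_mem⟩

/-- The action of `Pol_2(A)` on `X ⊗ Y` given by actions of `Pol_1(A)` on `X` and `Y`. -/
noncomputable def pairAction {e : Pol T 1 →ₐ[k] C.End X} {e' : Pol T 1 →ₐ[k] C.End Y}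
    (he : IsSuperAction e) (he' : IsSuperAction e') : Pol T 2 →ₐ[k] C.End (X * Y) :=
  Pol.lift T (fun g => match g with
    | .tok i a => ![whiskerR X Y (e (Pol.tok T 0 a)), whiskerL X Y (e' (Pol.tok T 0 a))] i
    | .dot i => ![whiskerR X Y (e (Pol.dot T 0)), whiskerL X Y (e' (Pol.dot T 0))] i) (by
    rintro x y (i | ⟨i, a, b⟩ | ⟨i, c, a⟩ | ⟨i, a, b⟩ | ⟨i, j, hij, p, q, a, b, ha, hb⟩ | ⟨i, j, hij⟩ |
      ⟨i, p, a, ha⟩ | ⟨i, j, hij, p, a, ha⟩)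
    · fin_cases i <;> simp [Pol.tok_one]
    · fin_cases i <;> simp [Pol.tok_add]
    · fin_cases i <;> simp [Pol.tok_smul]
    · fin_cases i <;> simp [Pol.tok_mul]
    · simp only [map_mul, map_smul, FreeAlgebra.lift_ι_apply]
      fin_cases i <;> fin_cases j
      · exact absurd rfl hij
      · exact whiskerR_mul_whiskerL_comm (he.tok_mem p a ha) (he'.tok_mem q b hb)
      · exact mul_comm p q ▸ whiskerL_mul_whiskerR (he.tok_mem q b hb) (he'.tok_mem p a ha)
      · exact absurd rfl hij
    · simp only [map_mul, map_smul, FreeAlgebra.lift_ι_apply]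
      -- Parities are idempotent under multiplication, so the sign `(-1)^ε` between two dots is the
      -- supercommutation sign of two elements of parity `ε`.
      rw [show T.par = T.par * T.par by generalize T.par = x; clear * -; revert x; decide]
      fin_cases i <;> fin_cases j
      · exact absurd rfl hij
      · exact whiskerR_mul_whiskerL_comm he.dot_mem he'.dot_mem
      · exact whiskerL_mul_whiskerR he.dot_mem he'.dot_mem
      · exact absurd rfl hij
    · have h := Pol.tok_dot T (0 : Fin 1) ha
      have h1 := congrArg (fun f => whiskerR X Y (e f)) h
      have h2 := congrArg (fun f => whiskerL X Y (e' f)) h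
      simp only [map_mul, map_smul] at h1 h2
      fin_cases i
      · simpa using h1
      · simpa using h2
    · simp only [map_mul, map_smul, FreeAlgebra.lift_ι_apply]
      fin_cases i <;> fin_cases j
      · exact absurd rfl hij
      · exact whiskerL_mul_whiskerR he.dot_mem (he'.tok_mem p a ha)
      · exact mul_comm p T.par ▸ whiskerR_mul_whiskerL_comm (he.tok_mem p a ha) he'.dot_mem
      · exact absurd rfl hij)

section

variable {e : Pol T 1 →ₐ[k] C.End X} {e' : Pol T 1 →ₐ[k] C.End Y} (he : IsSuperAction e)
  (he' : IsSuperAction e')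

theorem pairAction_tok_zero (a : A) :
    pairAction he he' (Pol.tok T 0 a) = whiskerR X Y (e (Pol.tok T 0 a)) := Pol.lift_tok T _ _ 0 a

theorem pairAction_tok_one (a : A) :
    pairAction he he' (Pol.tok T 1 a) = whiskerL X Y (e' (Pol.tok T 0 a)) := Pol.lift_tok T _ _ 1 a

theorem pairAction_dot_zero :
    pairAction he he' (Pol.dot T 0) = whiskerR X Y (e (Pol.dot T 0)) := Pol.lift_dot T _ _ 0

theorem pairAction_dot_one :
    pairAction he he' (Pol.dot T 1) = whiskerL X Y (e' (Pol.dot T 0)) := Pol.lift_dot T _ _ 1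

theorem pairAction_incl_zero (f : Pol T 1) :
    pairAction he he' (Pol.incl T 0 f) = whiskerR X Y (e f) := by
  suffices h : (pairAction he he').comp (Pol.incl T 0) = (whiskerR X Y).comp e from
    DFunLike.congr_fun h f
  apply Pol.hom_ext
  · intro i a
    obtain rfl := Subsingleton.elim i 0
    simp [Pol.incl, Pol.lift_tok, pairAction_tok_zero]
  · intro i
    obtain rfl := Subsingleton.elim i 0
    simp [Pol.incl, Pol.lift_dot, pairAction_dot_zero]

theorem pairAction_incl_one (f : Pol T 1) :
    pairAction he he' (Pol.incl T 1 f) = whiskerL X Y (e' f) := by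
  suffices h : (pairAction he he').comp (Pol.incl T 1) = (whiskerL X Y).comp e' from
    DFunLike.congr_fun h f
  apply Pol.hom_ext
  · intro i a
    obtain rfl := Subsingleton.elim i 0
    simp [Pol.incl, Pol.lift_tok, pairAction_tok_one]
  · intro i
    obtain rfl := Subsingleton.elim i 0
    simp [Pol.incl, Pol.lift_dot, pairAction_dot_one]

end

end MonoidalSupercat

/-! ### Polynomial actions on black strands -/

section LAW

variable {k : Type u} {A : Type v} {ι : Type w} [CommRing k] [Ring A] [Algebra k A]
variable {𝒜 : ZMod 2 → Submodule k A} [GradedAlgebra 𝒜] [Fintype ι]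
variable (B : HomogBasis 𝒜 ι) (T : FrobeniusTrace 𝒜)

namespace LAWCat

open MonoidalSupercat

theorem cls_rel {X Y : FreeMonoid (Strand T)} {f g : LDiag k (lawSig T) X Y}
    (h : LAW.Rel B T X Y (f - g)) :
    cls (fun X Y => {r | LAW.Rel B T X Y r}) f = cls (fun X Y => {r | LAW.Rel B T X Y r}) g :=
  cls_eq (.rel _ h)

variable {T} in
theorem ofDiag_comp {X Y Z : FreeMonoid (Strand T)} (f : LAW.D T Y Z) (g : LAW.D T X Y) :
    ofDiag B T (.comp f g) = (LAWCat B T).comp (ofDiag B T f) (ofDiag B T g) :=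
  congrArg (cls fun X Y => {r | LAW.Rel B T X Y r}) (compL_mono k f g).symm

variable {T} in
theorem ofDiag_hor {X Y X' Y' : FreeMonoid (Strand T)} (f : LAW.D T X Y) (g : LAW.D T X' Y') :
    ofDiag B T (LAW.hor f g) = (LAWCat B T).tensor (ofDiag B T f) (ofDiag B T g) :=
  congrArg (cls fun X Y => {r | LAW.Rel B T X Y r}) (tensorL_mono k rfl rfl f g).symm

theorem ofDiag_mem {X Y : FreeMonoid (Strand T)} (f : LAW.D T X Y) :
    ofDiag B T f ∈ (LAWCat B T).parity (obj B X) (obj B Y) f.parity :=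
  ⟨mono k f, mono_mem_parityL rfl, rfl⟩

theorem ofDiag_tok_linear {p : ZMod 2} (c d : k) (a b : 𝒜 p) :
    ofDiag B T (LAW.tok T (c • a + d • b)) =
      c • ofDiag B T (LAW.tok T a) + d • ofDiag B T (LAW.tok T b) := by
  have h := cls_rel B T (.tok_lin p c d a b)
  rw [map_add, map_smul, map_smul] at h
  exact h.symm

/-- Homogeneous tokens, as a linear map. -/
noncomputable def homogTok (p : ZMod 2) : 𝒜 p →ₗ[k] (LAWCat B T).End (obj B (bl T)) where
  toFun a := ofDiag B T (LAW.tok T a)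
  map_add' a b := by
    have h := ofDiag_tok_linear B T 1 1 a b
    rw [one_smul, one_smul, one_smul, one_smul] at h
    exact h
  map_smul' c a := by
    have h := ofDiag_tok_linear B T c 0 a 0
    rw [zero_smul, zero_smul, add_zero, add_zero] at h
    exact h

/-- All but one homogeneous component vanish, and linearity of homogeneous tokens makes the token of
zero vanish. This links general tokens with the generators, whose labels are homogeneous. -/
theorem tok_of_mem {p : ZMod 2} {a : A} (ha : a ∈ 𝒜 p) :
    tok B T a = ofDiag B T (LAW.tok T (⟨a, ha⟩ : 𝒜 p)) := by
  refine (Finset.sum_eq_single p (fun q _ hq => ?_) (by simp)).trans ?_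
  · have h : DirectSum.decompose 𝒜 a q = 0 :=
      Subtype.ext (DirectSum.decompose_of_mem_ne 𝒜 ha hq.symm)
    rw [h]
    exact map_zero (homogTok B T q)
  · have h : DirectSum.decompose 𝒜 a p = ⟨a, ha⟩ :=
      Subtype.ext (DirectSum.decompose_of_mem_same 𝒜 ha)
    rw [h]

/-- Tokens, as a linear map. -/
noncomputable def tokLinear : A →ₗ[k] (LAWCat B T).End (obj B (bl T)) :=
  ∑ p : ZMod 2, homogTok B T p ∘ₗ (GradedAlgebra.proj 𝒜 p).codRestrict (𝒜 p) fun _ => SetLike.coe_mem _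

theorem tokLinear_apply (a : A) : tokLinear B T a = tok B T a :=
  LinearMap.sum_apply _ _ _

theorem tok_homog_mul {p q : ZMod 2} {a b : A} (ha : a ∈ 𝒜 p) (hb : b ∈ 𝒜 q) :
    tokLinear B T (a * b) = tokLinear B T a * tokLinear B T b := by
  rw [tokLinear_apply, tokLinear_apply, tokLinear_apply, tok_of_mem B T ha, tok_of_mem B T hb,
    tok_of_mem B T (SetLike.mul_mem_graded ha hb)]
  exact (cls_rel B T (.tok_mul p q ⟨a, ha⟩ ⟨b, hb⟩)).symm.trans (ofDiag_comp B _ _)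

/-- Tokens, as a homomorphism of algebras. -/
noncomputable def tokHom : A →ₐ[k] (LAWCat B T).End (obj B (bl T)) :=
  AlgHom.ofLinearMap (tokLinear B T)
    (by
      rw [tokLinear_apply, tok_of_mem B T (SetLike.one_mem_graded 𝒜)]
      exact cls_rel B T .tok_one)
    (fun a b => by
      rw [← sum_proj (𝒜 := 𝒜) a, ← sum_proj (𝒜 := 𝒜) b]
      simp only [Finset.sum_mul, Finset.mul_sum, map_sum]
      exact Finset.sum_congr rfl fun p _ => Finset.sum_congr rfl fun q _ =>
        tok_homog_mul B T (SetLike.coe_mem _) (SetLike.coe_mem _))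

theorem tokHom_apply (a : A) : tokHom B T a = tok B T a := tokLinear_apply B T a

theorem tokHom_of_mem {p : ZMod 2} {a : A} (ha : a ∈ 𝒜 p) :
    tokHom B T a = ofDiag B T (LAW.tok T (⟨a, ha⟩ : 𝒜 p)) :=
  (tokHom_apply B T a).trans (tok_of_mem B T ha)

/-- The dot, as an element of the endomorphism algebra. -/
noncomputable def dotEnd : (LAWCat B T).End (obj B (bl T)) := dot B T

/-- The action of `Pol_1(A)` on the black strand. -/
noncomputable def polAction : Pol T 1 →ₐ[k] (LAWCat B T).End (obj B (bl T)) :=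
  Pol.lift T (fun g => match g with
    | .tok _ a => tokHom B T a
    | .dot _ => dotEnd B T) (by
    rintro x y (j | ⟨j, a, b⟩ | ⟨j, c, a⟩ | ⟨j, a, b⟩ | ⟨j, l, h, _, _, _, _, _, _⟩ | ⟨j, l, h⟩ |
      ⟨j, p, a, ha⟩ | ⟨j, l, h, _, _, _⟩)
    · simp
    · simp
    · simp
    · simp
    · exact absurd (Subsingleton.elim j l) h
    · exact absurd (Subsingleton.elim j l) h
    · simp only [map_mul, map_smul, FreeAlgebra.lift_ι_apply]
      have h := cls_rel B T (.tok_dot p ⟨a, ha⟩)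
      rw [map_smul, ← compL_mono, ← compL_mono] at h
      rw [tokHom_of_mem B T ha, tokHom_of_mem B T (nakayama_mem T ha)]
      exact h
    · exact absurd (Subsingleton.elim j l) h)

theorem polAction_tok (a : A) : polAction B T (Pol.tok T 0 a) = tokHom B T a :=
  Pol.lift_tok T _ _ 0 a

theorem polAction_dot : polAction B T (Pol.dot T 0) = dotEnd B T := Pol.lift_dot T _ _ 0

theorem isSuperAction_polAction : IsSuperAction (polAction B T) where
  tok_mem p a ha := by
    rw [polAction_tok, tokHom_of_mem B T ha]
    exact ofDiag_mem B T (LAW.tok T (⟨a, ha⟩ : 𝒜 p))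
  dot_mem := by
    rw [polAction_dot]
    exact ofDiag_mem B T (LAW.dot T)

/-- The action of `Pol_2(A)` on two black strands. -/
noncomputable def polAction₂ : Pol T 2 →ₐ[k] (LAWCat B T).End (obj B (bl T) * obj B (bl T)) :=
  pairAction (isSuperAction_polAction B T) (isSuperAction_polAction B T)

variable {T} in
/-- The action of `Pol_2(A)` on two black strands around a red one. -/
noncomputable def polActionAround (Q : Pol.evenCentralRegular T) :
    Pol T 2 →ₐ[k] (LAWCat B T).End (obj B (bl T) * obj B (rd Q) * obj B (bl T)) :=
  pairAction ((isSuperAction_polAction B T).whiskerR (obj B (rd Q))) (isSuperAction_polAction B T)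

theorem ofDiag_dotPow (r : ℕ) :
    ofDiag B T (LAW.dotPow T r) = polAction B T (Pol.dot T 0 ^ r) := by
  rw [map_pow, polAction_dot]
  induction r with
  | zero => rfl
  | succ r ih =>
    rw [pow_succ', ← ih]
    exact ofDiag_comp B _ _

theorem ofDiag_tok {p : ZMod 2} (a : 𝒜 p) :
    ofDiag B T (LAW.tok T a) = polAction B T (Pol.tok T 0 a) := by
  rw [polAction_tok, tokHom_of_mem B T a.2]

/-- A pin becomes the value of an algebra homomorphism at the polynomial it names. Hence it does not
depend on the chosen expansion, and identities in `Pol_1` apply to it. -/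
theorem cls_pin1 (N : ℕ) (a : ∀ r : ℕ, 𝒜 (r * T.par)) :
    cls (fun X Y => {r | LAW.Rel B T X Y r}) (LAW.pin1 T N a) = polAction B T (LAW.poly1 T N a) := by
  rw [LAW.pin1, LAW.poly1, map_sum, map_sum]
  refine Finset.sum_congr rfl fun r _ => ?_
  rw [map_mul, ← ofDiag_dotPow, ← ofDiag_tok]
  exact ofDiag_comp B _ _

variable {T}

theorem polActionAround_incl_mul_incl (Q : Pol.evenCentralRegular T) (f g : Pol T 1) :
    polActionAround B Q (Pol.incl T 0 f * Pol.incl T 1 g) =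
      (LAWCat B T).tensor ((LAWCat B T).tensor (polAction B T f) ((LAWCat B T).id (obj B (rd Q))))
        (polAction B T g) := by
  rw [map_mul, polActionAround, pairAction_incl_zero, pairAction_incl_one, whiskerR_mul_whiskerL]
  rfl

theorem ofDiag_around (Q : Pol.evenCentralRegular T) (f g : LAW.D T (bl T) (bl T)) {f' g' : Pol T 1}
    (hf : ofDiag B T f = polAction B T f') (hg : ofDiag B T g = polAction B T g') :
    ofDiag B T (LAW.around Q f g) =
      polActionAround B Q (Pol.incl T 0 f' * Pol.incl T 1 g') := by
  rw [polActionAround_incl_mul_incl, LAW.around, ofDiag_hor, ofDiag_hor, hf, hg]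
  rfl

theorem cls_pin2 (Q : Pol.evenCentralRegular T) (N : ℕ) (l : ι → ι → ℕ → ℕ → k) :
    cls (fun X Y => {r | LAW.Rel B T X Y r}) (LAW.pin2 B Q N l) =
      polActionAround B Q (LAW.poly2 B T N l) := by
  rw [LAW.pin2, LAW.poly2]
  simp only [map_sum, map_smul]
  refine Finset.sum_congr rfl fun b _ => Finset.sum_congr rfl fun c _ =>
    Finset.sum_congr rfl fun r _ => Finset.sum_congr rfl fun s _ => congrArg _ ?_
  refine (ofDiag_comp B _ _).trans ?_
  -- Each monomial is a product of a token part and a dot part, with strand one before strand two in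
  -- both. This is exactly the layering of the diagram, so no sign appears.
  rw [ofDiag_around B Q _ _ (ofDiag_tok B T _) (ofDiag_tok B T _),
    ofDiag_around B Q _ _ (ofDiag_dotPow B T r) (ofDiag_dotPow B T s), mul_assoc (_ * _), map_mul]
  simp [Pol.incl, Pol.lift_tok, Pol.lift_dot, LAW.basisElt]
  rfl

end LAWCat

end LAW

/-! ### The relations in terms of polynomial actions, and evaluation under the change of trace -/

section LAW

variable {k : Type u} {A : Type v} {ι : Type w} [CommRing k] [Ring A] [Algebra k A]
variable {𝒜 : ZMod 2 → Submodule k A} [GradedAlgebra 𝒜] [Fintype ι]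
variable (B : HomogBasis 𝒜 ι) (T : FrobeniusTrace 𝒜)

namespace LAWCat

open MonoidalSupercat

/-- The black crossing, as an element of the endomorphism algebra. -/
noncomputable def crossEnd : (LAWCat B T).End (obj B (bl T) * obj B (bl T)) := cross B T

theorem crossEnd_mul_tok {p : ZMod 2} {a : A} (ha : a ∈ 𝒜 p) :
    crossEnd B T * whiskerR _ _ (tokHom B T a) = whiskerL _ _ (tokHom B T a) * crossEnd B T := by
  have h := cls_rel B T (.cross_tok p ⟨a, ha⟩)
  rw [← compL_mono, ← compL_mono, LAW.hor, LAW.hor, ← tensorL_mono, ← tensorL_mono] at h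
  rw [tokHom_of_mem B T ha]
  exact h

theorem polAction₂_tele : polAction₂ B T (Pol.tele T B 0 1) =
    ∑ b, ksgn k (T.par * B.deg b) • (whiskerR _ _ (tokHom B T (B.basis b)) *
      whiskerL _ _ (tokHom B T (leftDual B T b))) := by
  simp only [Pol.tele, map_sum, map_smul, map_mul, polAction₂, pairAction_tok_zero,
    pairAction_tok_one, polAction_tok]

/-- The correction term is recognised as the action of `t_{1,2}`, so that the comparison of these
elements for two traces can be applied to it. -/
theorem crossEnd_mul_dot :
    crossEnd B T * whiskerR _ _ (dotEnd B T) =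
      whiskerL _ _ (dotEnd B T) * crossEnd B T - polAction₂ B T (Pol.tele T B 0 1) := by
  have h := cls_rel B T .cross_dot
  simp only [map_sub, map_sum, map_smul, ← compL_mono, LAW.hor, ← tensorL_mono] at h
  rw [polAction₂_tele]
  simp only [tokHom_of_mem B T (B.mem _), tokHom_of_mem B T (leftDual_mem B T _)]
  exact h

variable {T}

theorem blackRed_tok (Q : Pol.evenCentralRegular T) {p : ZMod 2} {a : A} (ha : a ∈ 𝒜 p) :
    (LAWCat B T).comp (blackRed B Q) (whiskerR _ _ (tokHom B T a)) =
      (LAWCat B T).comp (whiskerL _ _ (tokHom B T a)) (blackRed B Q) := by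
  have h := cls_rel B T (.blackRed_tok Q p ⟨a, ha⟩)
  rw [← compL_mono, ← compL_mono, LAW.hor, LAW.hor, ← tensorL_mono, ← tensorL_mono] at h
  rw [tokHom_of_mem B T ha]
  exact h

theorem redBlack_tok (Q : Pol.evenCentralRegular T) {p : ZMod 2} {a : A} (ha : a ∈ 𝒜 p) :
    (LAWCat B T).comp (redBlack B Q) (whiskerL _ _ (tokHom B T a)) =
      (LAWCat B T).comp (whiskerR _ _ (tokHom B T a)) (redBlack B Q) := by
  have h := cls_rel B T (.redBlack_tok Q p ⟨a, ha⟩)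
  rw [← compL_mono, ← compL_mono, LAW.hor, LAW.hor, ← tensorL_mono, ← tensorL_mono] at h
  rw [tokHom_of_mem B T ha]
  exact h

theorem blackRed_dot (Q : Pol.evenCentralRegular T) :
    (LAWCat B T).comp (blackRed B Q) (whiskerR _ _ (dotEnd B T)) =
      (LAWCat B T).comp (whiskerL _ _ (dotEnd B T)) (blackRed B Q) := by
  have h := cls_rel B T (.blackRed_dot Q)
  rw [← compL_mono, ← compL_mono, LAW.hor, LAW.hor, ← tensorL_mono, ← tensorL_mono] at h
  exact h

theorem redBlack_dot (Q : Pol.evenCentralRegular T) :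
    (LAWCat B T).comp (redBlack B Q) (whiskerL _ _ (dotEnd B T)) =
      (LAWCat B T).comp (whiskerR _ _ (dotEnd B T)) (redBlack B Q) := by
  have h := cls_rel B T (.redBlack_dot Q)
  rw [← compL_mono, ← compL_mono, LAW.hor, LAW.hor, ← tensorL_mono, ← tensorL_mono] at h
  exact h

/-- The relation is available for each expansion of `Q`; evenness of `Q` guarantees that one exists,
and the resulting statement no longer mentions it. -/
theorem redBlack_blackRed (Q : Pol.evenCentralRegular T) :
    (LAWCat B T).comp (redBlack B Q) (blackRed B Q) =
      whiskerR (obj B (bl T)) (obj B (rd Q)) (polAction B T Q) := by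
  obtain ⟨N, a, h⟩ := Pol.exists_poly1 T Q.2.1
  have e := cls_rel B T (.redBlack_blackRed Q N a h)
  rw [← compL_mono] at e
  rw [← h, ← cls_pin1]
  exact e

theorem blackRed_redBlack (Q : Pol.evenCentralRegular T) :
    (LAWCat B T).comp (blackRed B Q) (redBlack B Q) =
      whiskerL (obj B (rd Q)) (obj B (bl T)) (polAction B T Q) := by
  obtain ⟨N, a, h⟩ := Pol.exists_poly1 T Q.2.1
  have e := cls_rel B T (.blackRed_redBlack Q N a h)
  rw [← compL_mono] at e
  rw [← h, ← cls_pin1]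
  exact e

end LAWCat

namespace PolEquiv

open MonoidalSupercat LAWCat

variable {B T} {T' : FrobeniusTrace 𝒜}

/-- `e` fixes tokens and maps `x` to `(-1)^ū x u`. -/
structure IsTraceChange (e : PolEquiv T T') (u : Aˣ) : Prop where
  relates : RelatesTraces T T' u
  tok : ∀ a, e.equiv (Pol.tok T 0 a) = Pol.tok T' 0 a
  dot : e.equiv (Pol.dot T 0) = ksgn k (T.par + T'.par) • (Pol.dot T' 0 * Pol.tok T' 0 (u : A))

theorem IsTraceChange.symm {e : PolEquiv T T'} {u : Aˣ} (h : e.IsTraceChange u) :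
    e.symm.IsTraceChange u⁻¹ where
  relates := h.relates.symm
  tok a := by
    rw [← h.tok]
    exact e.equiv.symm_apply_apply _
  dot := by
    apply e.equiv.injective
    refine (e.equiv.apply_symm_apply _).trans ?_
    rw [map_smul, map_mul, h.dot, h.tok, smul_mul_assoc, mul_assoc, ← Pol.tok_mul, Units.mul_inv,
      Pol.tok_one, mul_one, smul_smul, add_comm T'.par, ksgn_mul_self, one_smul]

theorem IsTraceChange.equiv_eq {e : PolEquiv T T'} {u : Aˣ} (h : e.IsTraceChange u) (f : Pol T 1) :
    e.equiv f = Pol.traceMap h.relates 1 f := by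
  suffices e : e.equiv.toAlgHom = Pol.traceMap h.relates 1 from DFunLike.congr_fun e f
  apply Pol.hom_ext
  · intro i a
    obtain rfl := Subsingleton.elim i 0
    rw [Pol.traceMap_tok]
    exact h.tok a
  · intro i
    obtain rfl := Subsingleton.elim i 0
    rw [Pol.traceMap_dot]
    exact h.dot

variable (B)

/-- The induced map on words. -/
noncomputable def wordMap (e : PolEquiv T T') : FreeMonoid (Strand T) →* FreeMonoid (Strand T') :=
  FreeMonoid.map e.onStrands

/-- The images of the generating morphisms under the change of trace. -/
noncomputable def genMap (e : PolEquiv T T') (u : Aˣ) : ∀ {X Y : FreeMonoid (Strand T)},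
    LGen T X Y → PHom (fun X Y => {r | LAW.Rel B T' X Y r}) (e.wordMap X) (e.wordMap Y)
  | _, _, .cross => LAWCat.cross B T'
  | _, _, .tok _ a => ofDiag B T' (LAW.tok T' a)
  | _, _, .dot => ksgn k (T.par + T'.par) •
      (LAWCat B T').comp (LAWCat.dot B T') (LAWCat.tok B T' (u : A))
  | _, _, .redBlack Q => LAWCat.redBlack B (e.onLabels Q)
  | _, _, .blackRed Q => LAWCat.blackRed B (e.onLabels Q)

variable {e : PolEquiv T T'} {u : Aˣ}

theorem genMap_mem (he : e.IsTraceChange u) {X Y : FreeMonoid (Strand T)} (g : LGen T X Y) :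
    genMap B e u g ∈ parityQ (fun X Y => {r | LAW.Rel B T' X Y r}) (e.wordMap X) (e.wordMap Y)
      g.parity := by
  cases g with
  | cross => exact ofDiag_mem B T' (LAW.cross T')
  | tok p a => exact ofDiag_mem B T' (LAW.tok T' a)
  | dot =>
    refine Submodule.smul_mem _ _ ?_
    have h := (LAWCat B T').comp_mem (ofDiag_mem B T' (LAW.dot T'))
      (ofDiag_mem B T' (LAW.tok T' (⟨u, he.relates.1⟩ : 𝒜 _)))
    rw [← tok_of_mem] at h
    -- The twist by `u` restores the parity `ε` of the original dot.
    have hp : T'.par + (T.par + T'.par) = T.par := by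
      generalize T.par = x, T'.par = y
      clear * -
      revert x y; decide
    exact (congrArg (fun p => (LAWCat B T').comp (LAWCat.dot B T') (LAWCat.tok B T' (u : A)) ∈
      (LAWCat B T').parity (obj B (bl T')) (obj B (bl T')) p) hp).mp h
  | redBlack Q => exact ofDiag_mem B T' (LAW.redBlack (e.onLabels Q))
  | blackRed Q => exact ofDiag_mem B T' (LAW.blackRed (e.onLabels Q))

/-- Evaluation of diagrams under the change of trace. -/
noncomputable abbrev evalD (e : PolEquiv T T') (u : Aˣ) {X Y : FreeMonoid (Strand T)} (D : LAW.D T X Y) :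
    PHom (fun X Y => {r | LAW.Rel B T' X Y r}) (e.wordMap X) (e.wordMap Y) :=
  evalDiag (S := lawSig T) (fun X Y => {r | LAW.Rel B T' X Y r}) e.wordMap (genMap B e u) D

theorem genMap_dot : genMap B e u .dot =
    polAction B T' (ksgn k (T.par + T'.par) • (Pol.dot T' 0 * Pol.tok T' 0 (u : A))) := by
  rw [map_smul, map_mul, polAction_dot, polAction_tok, tokHom_apply]
  rfl

theorem evalD_dot (he : e.IsTraceChange u) :
    evalD B e u (LAW.dot T) = polAction B T' (e.equiv (Pol.dot T 0)) := by
  rw [he.dot]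
  exact genMap_dot B (e := e) (u := u)

theorem evalD_tok (he : e.IsTraceChange u) {p : ZMod 2} (a : 𝒜 p) :
    evalD B e u (LAW.tok T a) = polAction B T' (e.equiv (Pol.tok T 0 a)) := by
  rw [he.tok]
  exact ofDiag_tok B T' a

theorem evalD_dotPow (he : e.IsTraceChange u) (r : ℕ) :
    evalD B e u (LAW.dotPow T r) = polAction B T' (e.equiv (Pol.dot T 0 ^ r)) := by
  rw [map_pow, map_pow]
  induction r with
  | zero => rfl
  | succ r ih =>
    rw [pow_succ', ← ih, ← evalD_dot B he]
    rfl

/-- Evaluation on tokens and dots is the action composed with the isomorphism of polynomial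
algebras. Multiplicativity extends this to powers and sums, so the pin of `Q` goes to the pin of its
new label. -/
theorem evalL_pin1 (he : e.IsTraceChange u) (N : ℕ) (a : ∀ r : ℕ, 𝒜 (r * T.par)) :
    evalL (S := lawSig T) (fun X Y => {r | LAW.Rel B T' X Y r}) e.wordMap (genMap B e u)
      (LAW.pin1 T N a) = polAction B T' (e.equiv (LAW.poly1 T N a)) := by
  rw [LAW.pin1, LAW.poly1, map_sum, map_sum, map_sum]
  refine Finset.sum_congr rfl fun r _ => ?_
  rw [map_mul, map_mul, ← evalD_dotPow B he, ← evalD_tok B he, evalL_mono]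
  rfl

theorem evalD_around (Q : Pol.evenCentralRegular T) (f g : LAW.D T (bl T) (bl T)) {f' g' : Pol T' 1}
    (hf : evalD B e u f = polAction B T' f') (hg : evalD B e u g = polAction B T' g') :
    evalD B e u (LAW.around Q f g) =
      polActionAround B (e.onLabels Q) (Pol.incl T' 0 f' * Pol.incl T' 1 g') := by
  exact (congrArg₂ (fun a b => (LAWCat B T').tensor ((LAWCat B T').tensor a
    ((LAWCat B T').id (obj B (rd (e.onLabels Q))))) b) hf hg).trans
      (polActionAround_incl_mul_incl B (e.onLabels Q) f' g').symm

theorem evalL_pin2 (he : e.IsTraceChange u) (Q : Pol.evenCentralRegular T) (N : ℕ)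
    (l : ι → ι → ℕ → ℕ → k) :
    evalL (S := lawSig T) (fun X Y => {r | LAW.Rel B T' X Y r}) e.wordMap (genMap B e u)
      (LAW.pin2 B Q N l) =
    polActionAround B (e.onLabels Q) (Pol.traceMap he.relates 2 (LAW.poly2 B T N l)) := by
  rw [LAW.pin2, LAW.poly2]
  simp only [map_sum, map_smul]
  refine Finset.sum_congr rfl fun b _ => Finset.sum_congr rfl fun c _ =>
    Finset.sum_congr rfl fun r _ => Finset.sum_congr rfl fun s _ => congrArg _ ?_
  rw [evalL_mono]
  have h1 := evalD_around B Q _ _ (evalD_tok B he (LAW.basisElt B b)) (evalD_tok B he (LAW.basisElt B c))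
  have h2 := evalD_around B Q _ _ (evalD_dotPow B he r) (evalD_dotPow B he s)
  refine (congrArg₂ (fun a b => (LAWCat B T').comp a b) h1 h2).trans ?_
  -- The image of the monomial is regrouped into a token layer and a dot layer, each a product of a
  -- factor from the first strand and one from the second, to match the two layers of the diagram.
  have h3 : Pol.traceMap he.relates 2 (Pol.tok T 0 (B.basis b) * Pol.tok T 1 (B.basis c) *
      Pol.dot T 0 ^ r * Pol.dot T 1 ^ s) =
      (Pol.incl T' 0 (e.equiv (Pol.tok T 0 (B.basis b))) *
        Pol.incl T' 1 (e.equiv (Pol.tok T 0 (B.basis c)))) *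
      (Pol.incl T' 0 (e.equiv (Pol.dot T 0 ^ r)) * Pol.incl T' 1 (e.equiv (Pol.dot T 0 ^ s))) := by
    rw [he.equiv_eq, he.equiv_eq, he.equiv_eq, he.equiv_eq, mul_assoc (_ * _)]
    simp only [← Pol.traceMap_incl, ← map_mul]
    simp [Pol.incl, Pol.lift_tok, Pol.lift_dot]
  rw [h3]
  exact (map_mul (polActionAround B (e.onLabels Q)) _ _).symm

end PolEquiv

end LAW

/-! ### The superfunctor attached to a change of trace, and its inverse -/

section LAW

variable {k : Type u} {A : Type v} {ι : Type w} [CommRing k] [Ring A] [Algebra k A]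
variable {𝒜 : ZMod 2 → Submodule k A} [GradedAlgebra 𝒜] [Fintype ι]
variable (B : HomogBasis 𝒜 ι) {T T' : FrobeniusTrace 𝒜}

namespace PolEquiv

open MonoidalSupercat LAWCat

variable {e : PolEquiv T T'} {u : Aˣ}

/-- The image of the dot, as an element of the endomorphism algebra. -/
noncomputable def dotImage (T : FrobeniusTrace 𝒜) (T' : FrobeniusTrace 𝒜) (u : Aˣ) :
    (LAWCat B T').End (obj B (bl T')) :=
  ksgn k (T.par + T'.par) • (dotEnd B T' * tokHom B T' (u : A))

theorem genMap_dot_eq_dotImage : genMap B e u .dot = dotImage B T T' u := by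
  rw [dotImage, tokHom_apply]
  rfl

theorem whiskerR_dotImage (Y : (LAWCat B T').Obj) :
    whiskerR (obj B (bl T')) Y (dotImage B T T' u) = ksgn k (T.par + T'.par) •
      (whiskerR _ Y (dotEnd B T') * whiskerR _ Y (tokHom B T' (u : A))) := by
  rw [dotImage, map_smul, map_mul]

theorem whiskerL_dotImage (Y : (LAWCat B T').Obj) :
    whiskerL Y (obj B (bl T')) (dotImage B T T' u) = ksgn k (T.par + T'.par) •
      (whiskerL Y _ (dotEnd B T') * whiskerL Y _ (tokHom B T' (u : A))) := by
  rw [dotImage, map_smul, map_mul]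

theorem dotImage_symm_mul_tok :
    ksgn k (T.par + T'.par) • (dotImage B T' T u⁻¹ * tokHom B T (u : A)) = dotEnd B T := by
  rw [dotImage, smul_mul_assoc, smul_smul, add_comm T'.par, ksgn_mul_self, one_smul, mul_assoc,
    ← map_mul, Units.inv_mul, map_one, mul_one]

theorem blackRed_dotImage (he : e.IsTraceChange u) (Q : Pol.evenCentralRegular T') :
    (LAWCat B T').comp (LAWCat.blackRed B Q) (whiskerR _ _ (dotImage B T T' u)) =
      (LAWCat B T').comp (whiskerL _ _ (dotImage B T T' u)) (LAWCat.blackRed B Q) := by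
  exact (congrArg ((LAWCat B T').comp (LAWCat.blackRed B Q)) (whiskerR_dotImage B (obj B (rd Q)))).trans
    ((comp_smul_of_comm _ (comp_mul_of_comm (blackRed_dot B Q) (blackRed_tok B Q he.relates.1))).trans
      (congrArg (fun z => (LAWCat B T').comp z (LAWCat.blackRed B Q))
        (whiskerL_dotImage B (obj B (rd Q))).symm))

theorem redBlack_dotImage (he : e.IsTraceChange u) (Q : Pol.evenCentralRegular T') :
    (LAWCat B T').comp (LAWCat.redBlack B Q) (whiskerL _ _ (dotImage B T T' u)) =
      (LAWCat B T').comp (whiskerR _ _ (dotImage B T T' u)) (LAWCat.redBlack B Q) := by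
  exact (congrArg ((LAWCat B T').comp (LAWCat.redBlack B Q)) (whiskerL_dotImage B (obj B (rd Q)))).trans
    ((comp_smul_of_comm _ (comp_mul_of_comm (redBlack_dot B Q) (redBlack_tok B Q he.relates.1))).trans
      (congrArg (fun z => (LAWCat B T').comp z (LAWCat.redBlack B Q))
        (whiskerR_dotImage B (obj B (rd Q))).symm))

/-- Multiplying the dot-crossing relation of the second trace by `u_1` on the right slides `u`
through the crossing in the main term and leaves `t'_{1,2} u_1` in the correction term. With the
sign `(-1)^ū` this is `t_{1,2}` of the first trace by `traceMap_tele`. -/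
theorem crossEnd_mul_dotImage (he : e.IsTraceChange u) :
    crossEnd B T' * whiskerR _ _ (dotImage B T T' u) =
      whiskerL _ _ (dotImage B T T' u) * crossEnd B T' -
        ∑ b, ksgn k (T.par * B.deg b) • (whiskerR _ _ (tokHom B T' (B.basis b)) *
          whiskerL _ _ (tokHom B T' (leftDual B T b))) := by
  have h : ∑ b, ksgn k (T.par * B.deg b) • (whiskerR _ _ (tokHom B T' (B.basis b)) *
      whiskerL _ _ (tokHom B T' (leftDual B T b))) =
      polAction₂ B T' (Pol.traceMap he.relates 2 (Pol.tele T B 0 1)) := by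
    simp only [Pol.tele, map_sum, map_smul, map_mul, polAction₂, Pol.traceMap_tok,
      pairAction_tok_zero, pairAction_tok_one, polAction_tok]
  rw [h, Pol.traceMap_tele B he.relates (by decide)]
  simp only [dotImage, map_smul, map_mul, mul_smul_comm, smul_mul_assoc]
  rw [← smul_sub, ← mul_assoc, crossEnd_mul_dot, sub_mul, mul_assoc, mul_assoc,
    crossEnd_mul_tok B T' he.relates.1, polAction₂, pairAction_tok_zero, polAction_tok]

theorem evalD_tok_tok {p q : ZMod 2} (a : 𝒜 p) (b : 𝒜 q) :
    evalD B e u (.comp (LAW.hor (LAW.tok T a) (LAW.idd T (bl T)))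
      (LAW.hor (LAW.idd T (bl T)) (LAW.tok T b))) =
    (whiskerR (obj B (bl T')) (obj B (bl T')) (tokHom B T' (a : A)) *
      whiskerL _ _ (tokHom B T' (b : A)) : (LAWCat B T').End (obj B (bl T') * obj B (bl T'))) := by
  rw [tokHom_of_mem B T' a.2, tokHom_of_mem B T' b.2]
  rfl

theorem evalL_tele : evalL (S := lawSig T) (fun X Y => {r | LAW.Rel B T' X Y r}) e.wordMap
      (genMap B e u) (∑ b, ksgn k (T.par * B.deg b) •
        mono k (.comp (LAW.hor (LAW.tok T (LAW.basisElt B b)) (LAW.idd T (bl T)))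
          (LAW.hor (LAW.idd T (bl T)) (LAW.tok T (LAW.dualElt B T b))))) =
    (∑ b, ksgn k (T.par * B.deg b) • (whiskerR _ _ (tokHom B T' (B.basis b)) *
      whiskerL _ _ (tokHom B T' (leftDual B T b))) :
        (LAWCat B T').End (obj B (bl T') * obj B (bl T'))) := by
  rw [map_sum]
  refine Finset.sum_congr rfl fun b _ => ?_
  rw [map_smul, evalL_mono]
  exact congrArg (fun z => ksgn k (T.par * B.deg b) • z)
    (evalD_tok_tok B (LAW.basisElt B b) (LAW.dualElt B T b))

theorem evalD_cross_dot :
    evalD B e u (.comp (LAW.cross T) (LAW.hor (LAW.dot T) (LAW.idd T (bl T)))) =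
      (crossEnd B T' * whiskerR _ _ (dotImage B T T' u) :
        (LAWCat B T').End (obj B (bl T') * obj B (bl T'))) := by
  rw [← genMap_dot_eq_dotImage (e := e)]
  rfl

theorem evalD_dot_cross :
    evalD B e u (.comp (LAW.hor (LAW.idd T (bl T)) (LAW.dot T)) (LAW.cross T)) =
      (whiskerL _ _ (dotImage B T T' u) * crossEnd B T' :
        (LAWCat B T').End (obj B (bl T') * obj B (bl T'))) := by
  rw [← genMap_dot_eq_dotImage (e := e)]
  rfl

/-- Relations without dots or pins go to the corresponding relations of the target, with red labels
renamed. Those with dots use that the image of the dot is a dot times a token, and those with pins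
use that pins are values of polynomial actions. -/
theorem evalL_rel (he : e.IsTraceChange u) {X Y : FreeMonoid (Strand T)}
    {r : LDiag k (lawSig T) X Y} (hr : LAW.Rel B T X Y r) :
    evalL (S := lawSig T) (fun X Y => {r | LAW.Rel B T' X Y r}) e.wordMap (genMap B e u) r = 0 := by
  rcases hr with _ | ⟨p, c, d, a, b⟩ | ⟨p, q, a, b⟩ | _ | _ | ⟨p, a⟩ | _ | ⟨p, a⟩ | ⟨Q, p, a⟩ |
    ⟨Q, p, a⟩ | Q | Q | ⟨Q, N, a, h⟩ | ⟨Q, N, a, h⟩ | Q | Q | ⟨Q, N, l, hl, h⟩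
  · rw [map_sub, evalL_mono, evalL_mono]
    exact sub_eq_zero.2 (cls_rel B T' .tok_one)
  · rw [map_sub, map_add, map_smul, map_smul, evalL_mono, evalL_mono, evalL_mono]
    exact sub_eq_zero.2 (ofDiag_tok_linear B T' c d a b).symm
  · rw [map_sub, evalL_mono, evalL_mono]
    have h := cls_rel B T' (.tok_mul p q a b)
    rw [← compL_mono] at h
    exact sub_eq_zero.2 h
  · rw [map_sub, evalL_mono, evalL_mono]
    have h := cls_rel B T' .cross_cross
    rw [← compL_mono] at h
    exact sub_eq_zero.2 h
  · rw [map_sub, evalL_mono, evalL_mono]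
    have h := cls_rel B T' .braid
    simp only [← compL_mono, LAW.left3, LAW.right3, ← tensorL_mono] at h
    exact sub_eq_zero.2 h
  · rw [map_sub, evalL_mono, evalL_mono]
    have h := crossEnd_mul_tok B T' a.2
    rw [tokHom_of_mem B T' a.2] at h
    exact sub_eq_zero.2 h
  · rw [map_sub, map_sub, evalL_mono, evalL_mono]
    exact sub_eq_zero.2 ((evalD_cross_dot B).trans ((crossEnd_mul_dotImage B he).trans
      (congrArg₂ (fun y z => y - z) (evalD_dot_cross B).symm (evalL_tele B).symm)))
  · rw [map_sub, map_smul, evalL_mono, evalL_mono]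
    -- The token-dot relation is the image of a relation of `Pol_1` under a homomorphism, so nothing
    -- about signs has to be checked again.
    have h := congrArg (fun f => polAction B T' (e.equiv f)) (Pol.tok_dot T (0 : Fin 1) a.2)
    simp only [map_mul, map_smul] at h
    rw [← evalD_dot B he, ← evalD_tok B he, ← evalD_tok B he ⟨_, nakayama_mem T a.2⟩] at h
    exact sub_eq_zero.2 h
  · rw [map_sub, evalL_mono, evalL_mono]
    have h := LAWCat.blackRed_tok B (e.onLabels Q) a.2
    rw [tokHom_of_mem B T' a.2] at h
    exact sub_eq_zero.2 h
  · rw [map_sub, evalL_mono, evalL_mono]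
    have h := LAWCat.redBlack_tok B (e.onLabels Q) a.2
    rw [tokHom_of_mem B T' a.2] at h
    exact sub_eq_zero.2 h
  · rw [map_sub, evalL_mono, evalL_mono]
    exact sub_eq_zero.2 (blackRed_dotImage B he (e.onLabels Q))
  · rw [map_sub, evalL_mono, evalL_mono]
    exact sub_eq_zero.2 (redBlack_dotImage B he (e.onLabels Q))
  · rw [map_sub, evalL_tensorL, evalL_mono, evalL_mono, evalL_pin1 B he, h]
    exact sub_eq_zero.2 (LAWCat.redBlack_blackRed B (e.onLabels Q))
  · rw [map_sub, evalL_tensorL, evalL_mono, evalL_mono, evalL_pin1 B he, h]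
    exact sub_eq_zero.2 (LAWCat.blackRed_redBlack B (e.onLabels Q))
  · rw [map_sub, evalL_mono, evalL_mono]
    have h := cls_rel B T' (.braid_red_left (e.onLabels Q))
    simp only [← compL_mono, LAW.left3, LAW.right3, ← tensorL_mono] at h
    exact sub_eq_zero.2 h
  · rw [map_sub, evalL_mono, evalL_mono]
    have h := cls_rel B T' (.braid_red_right (e.onLabels Q))
    simp only [← compL_mono, LAW.left3, LAW.right3, ← tensorL_mono] at h
    exact sub_eq_zero.2 h
  -- The polynomial in the pin is carried to the Demazure image of the new label, because the change
  -- of trace commutes with both `∂` and the inclusion of the first strand.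
  · have hd : Pol.traceMap he.relates 2 (LAW.poly2 B T N l) =
        Pol.demazure T' B (Pol.incl T' 0 (e.onLabels Q)) := by
      rw [h, Pol.traceMap_demazure, Pol.traceMap_incl, ← he.equiv_eq]
      rfl
    -- The given expansion is not normally ordered after each `x_i` is replaced by `(-1)^ū x_i u_i`.
    -- A fresh expansion of the image is chosen to invoke the relation in the target; both
    -- expansions name the same value of the action.
    obtain ⟨M, l', hl', h'⟩ := Pol.exists_poly2 T' B
      (Pol.traceMap_mem_parity he.relates (Pol.poly2_mem_parity T B N l hl))
    have hr := cls_rel B T' (.braid_red_middle (e.onLabels Q) M l' hl' (h'.trans hd))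
    rw [map_sub, cls_pin2, h'] at hr
    simp only [← compL_mono, LAW.left3, LAW.right3, ← tensorL_mono] at hr
    rw [map_sub, map_sub, evalL_mono, evalL_mono, evalL_pin2 B he]
    exact sub_eq_zero.2 hr

/-- The superfunctor between the higher-level affine wreath product categories given by a change
of trace. -/
noncomputable def traceFunctor (he : e.IsTraceChange u) :
    MonoidalSuperfunctor (LAWCat B T) (LAWCat B T') (e.onObj B) :=
  presentedFunctor (LAW.isHomogRel B) (LAW.isHomogRel B) e.wordMap (genMap B e u) (genMap_mem B he)
    fun _ _ _ hr => evalL_rel B he hr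

theorem traceFunctor_gen (he : e.IsTraceChange u) {X Y : FreeMonoid (Strand T)} (g : LGen T X Y) :
    (traceFunctor B he).map (ofDiag B T (.gen (S := lawSig T) g)) = genMap B e u g :=
  presentedFunctor_cls (LAW.isHomogRel B) (LAW.isHomogRel B) (genMap_mem B he)
    (fun _ _ _ hr => evalL_rel B he hr) (.gen g)

theorem traceFunctor_tok (he : e.IsTraceChange u) (a : A) :
    (traceFunctor B he).map (LAWCat.tok B T a) = LAWCat.tok B T' a := by
  rw [LAWCat.tok, map_sum]
  exact Finset.sum_congr rfl fun p _ => traceFunctor_gen B he (.tok p _)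

theorem traceFunctor_dot (he : e.IsTraceChange u) :
    (traceFunctor B he).map (LAWCat.dot B T) = ksgn k (T.par + T'.par) •
      (LAWCat B T').comp (LAWCat.dot B T') (LAWCat.tok B T' (u : A)) :=
  traceFunctor_gen B he .dot

theorem symm_onStrands_onStrands (e : PolEquiv T T') (s : Strand T) :
    e.symm.onStrands (e.onStrands s) = s := by
  cases s with
  | black => rfl
  | red Q => exact congrArg Strand.red (Subtype.ext (e.equiv.symm_apply_apply _))

theorem symm_onObj_onObj (e : PolEquiv T T') (X : (LAWCat B T).Obj) :
    e.symm.onObj B (e.onObj B X) = X := by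
  have h : (FreeMonoid.map e.symm.onStrands).comp (FreeMonoid.map e.onStrands) = MonoidHom.id _ :=
    FreeMonoid.hom_eq fun s => congrArg FreeMonoid.of (e.symm_onStrands_onStrands s)
  exact DFunLike.congr_fun h X

theorem traceFunctor_symm_traceFunctor (he : e.IsTraceChange u) {X Y : (LAWCat B T).Obj}
    (f : (LAWCat B T).Hom X Y) :
    HEq ((traceFunctor B he.symm).map ((traceFunctor B he).map f)) f := by
  have hl : ∀ Q, e.symm.onLabels (e.onLabels Q) = Q := fun Q =>
    Subtype.ext (e.equiv.symm_apply_apply _)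
  refine map_map_heq_of_gen (LAW.isHomogRel B) _ _ (symm_onObj_onObj B e) ?_ f
  intro X Y g
  refine (heq_of_eq (congrArg (traceFunctor B he.symm).map (traceFunctor_gen B he g))).trans ?_
  cases g with
  | cross => exact heq_of_eq (traceFunctor_gen B he.symm .cross)
  | tok p a => exact heq_of_eq (traceFunctor_gen B he.symm (.tok p a))
  | dot =>
    refine heq_of_eq ?_
    -- The round trip turns the dot into `x u⁻¹ u` with the sign `(-1)^ū` occurring twice, which is
    -- the dot again.
    refine (map_smul (traceFunctor B he.symm).map (ksgn k (T.par + T'.par)) _).trans ?_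
    refine Eq.trans ?_ (dotImage_symm_mul_tok B (T := T) (T' := T') (u := u))
    refine congrArg (fun z => ksgn k (T.par + T'.par) • z)
      (((traceFunctor B he.symm).map_comp _ _).trans ?_)
    rw [tokHom_apply]
    refine congrArg₂ (fun a b => (LAWCat B T).comp a b) ?_ (traceFunctor_tok B he.symm _)
    rw [← genMap_dot_eq_dotImage (e := e.symm)]
    exact traceFunctor_dot B he.symm
  | redBlack Q =>
    refine (heq_of_eq (traceFunctor_gen B he.symm (.redBlack (e.onLabels Q)))).trans ?_
    change HEq (LAWCat.redBlack B (e.symm.onLabels (e.onLabels Q))) (LAWCat.redBlack B Q)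
    rw [hl]
  | blackRed Q =>
    refine (heq_of_eq (traceFunctor_gen B he.symm (.blackRed (e.onLabels Q)))).trans ?_
    change HEq (LAWCat.blackRed B (e.symm.onLabels (e.onLabels Q))) (LAWCat.blackRed B Q)
    rw [hl]

theorem mutuallyInverse_traceFunctor (he : e.IsTraceChange u) :
    MutuallyInverse (traceFunctor B he) (traceFunctor B he.symm) := by
  exact ⟨⟨symm_onObj_onObj B e, traceFunctor_symm_traceFunctor B he⟩,
    ⟨symm_onObj_onObj B e.symm, traceFunctor_symm_traceFunctor B he.symm⟩⟩

end PolEquiv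

end LAW

/-! ### Functoriality of endomorphism algebras in the additive envelope -/

namespace MonoidalSupercat.AddEnd

variable {k : Type u} [CommRing k] {C : MonoidalSupercat.{u, v, w} k}
  {D : MonoidalSupercat.{u, v', w'} k} {φ : C.Obj →* D.Obj} {I J : Type*} [Fintype I] [Fintype J]

/-- Entrywise application of a superfunctor. -/
noncomputable def map (F : MonoidalSuperfunctor C D φ) (X : I → C.Obj) :
    C.AddEnd X →ₐ[k] D.AddEnd fun i => φ (X i) :=
  AlgHom.ofLinearMap
    { toFun := fun M j i => F.map (M j i)
      map_add' := fun M N => by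
        funext j i
        exact map_add F.map (M j i) (N j i)
      map_smul' := fun c M => by
        funext j i
        exact map_smul F.map c (M j i) }
    (by
      funext j i
      by_cases h : i = j
      · subst h
        refine (congrArg F.map (one_apply_self i)).trans ?_
        rw [F.map_id, one_apply_self]
      · refine (congrArg F.map (one_apply_ne h)).trans ?_
        rw [map_zero, one_apply_ne h])
    (fun M N => by
      funext j i
      refine (map_sum F.map _ _).trans (Finset.sum_congr rfl fun l _ => F.map_comp _ _))

/-- Reindexing matrices along a bijection. -/
noncomputable def reindex (ρ : I ≃ J) (Y : J → D.Obj) :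
    D.AddEnd Y →ₐ[k] D.AddEnd fun i => Y (ρ i) :=
  AlgHom.ofLinearMap
    { toFun := fun M j i => M (ρ j) (ρ i)
      map_add' := fun _ _ => rfl
      map_smul' := fun _ _ => rfl }
    (by
      funext j i
      by_cases h : i = j
      · subst h
        exact (one_apply_self (ρ i)).trans (one_apply_self (X := fun i => Y (ρ i)) i).symm
      · exact (one_apply_ne (ρ.injective.ne h)).trans (one_apply_ne (X := fun i => Y (ρ i)) h).symm)
    (fun M N => by
      funext j i
      exact (ρ.sum_comp fun l => D.comp (M (ρ j) l) (N l (ρ i))).symm)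

theorem reindex_bijective (ρ : I ≃ J) (Y : J → D.Obj) : Function.Bijective (reindex ρ Y) := by
  constructor
  · intro M N h
    funext j i
    obtain ⟨j, rfl⟩ := ρ.surjective j
    obtain ⟨i, rfl⟩ := ρ.surjective i
    exact congrFun (congrFun h j) i
  · intro M
    -- The type of an entry depends on its two indices, so the preimage is obtained by transporting
    -- a dependent function on pairs of indices.
    let N := Equiv.piCongrLeft (fun p : J × J => D.Hom (Y p.2) (Y p.1)) (ρ.prodCongr ρ)
      fun p => M p.1 p.2
    exact ⟨fun j i => N (j, i), funext fun j => funext fun i =>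
      Equiv.piCongrLeft_apply_apply (fun p : J × J => D.Hom (Y p.2) (Y p.1)) (ρ.prodCongr ρ)
        (fun p => M p.1 p.2) (j, i)⟩

theorem reindex_mem_parity_iff (ρ : I ≃ J) (Y : J → D.Obj) (M : D.AddEnd Y) (p : ZMod 2) :
    reindex ρ Y M ∈ parity p ↔ M ∈ parity p := by
  refine ⟨fun h j i => ?_, fun h j i => h (ρ j) (ρ i)⟩
  obtain ⟨j, rfl⟩ := ρ.surjective j
  obtain ⟨i, rfl⟩ := ρ.surjective i
  exact h j i

end MonoidalSupercat.AddEnd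

namespace MutuallyInverse

open MonoidalSupercat

variable {k : Type u} [CommRing k] {C : MonoidalSupercat.{u, v, w} k}
  {D : MonoidalSupercat.{u, v', w'} k} {φ : C.Obj →* D.Obj} {γ : D.Obj →* C.Obj}
  {F : MonoidalSuperfunctor C D φ} {G : MonoidalSuperfunctor D C γ}

/-- The inverse on a morphism space is not literally `G.map`, which lands between `γ (φ X)` and `γ
(φ Y)`. The image under `G` is first transported to a morphism from `X` to `Y`. -/
theorem map_bijective (h : MutuallyInverse F G) (X Y : C.Obj) :
    Function.Bijective (F.map : C.Hom X Y →ₗ[k] D.Hom (φ X) (φ Y)) := by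
  constructor
  · intro f g hfg
    exact eq_of_heq ((h.1.2 f).symm.trans ((heq_of_eq (congrArg G.map hfg)).trans (h.1.2 g)))
  · intro g
    obtain ⟨f, hf⟩ := cast_heq_hom (h.1.1 X) (h.1.1 Y) (G.map g)
    exact ⟨f, eq_of_heq ((F.map_heq (h.1.1 X).symm (h.1.1 Y).symm hf).trans (h.2.2 g))⟩

theorem map_mem_parity_iff (h : MutuallyInverse F G) {X Y : C.Obj} (f : C.Hom X Y) (p : ZMod 2) :
    F.map f ∈ D.parity (φ X) (φ Y) p ↔ f ∈ C.parity X Y p :=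
  ⟨fun hf => mem_parity_of_heq (h.1.1 X) (h.1.1 Y) (h.1.2 f) (G.map_mem hf), F.map_mem⟩

variable {I : Type*} [Fintype I]

theorem addEnd_map_bijective (h : MutuallyInverse F G) (X : I → C.Obj) :
    Function.Bijective (AddEnd.map F X) := by
  constructor
  · intro M N hMN
    funext j i
    exact (h.map_bijective _ _).1 (congrFun (congrFun hMN j) i)
  · intro M
    choose N hN using fun j i => (h.map_bijective (X i) (X j)).2 (M j i)
    exact ⟨N, funext fun j => funext fun i => hN j i⟩

end MutuallyInverse

/-! ### Shuffles and the isomorphism of wreath product algebras -/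

section LAW

variable {k : Type u} {A : Type v} {ι : Type w} [CommRing k] [Ring A] [Algebra k A]
variable {𝒜 : ZMod 2 → Submodule k A} [GradedAlgebra 𝒜] [Fintype ι]
variable (B : HomogBasis 𝒜 ι) {T T' : FrobeniusTrace 𝒜}

namespace PolEquiv

open MonoidalSupercat

/-- Relabelling acts letter by letter, so it preserves lengths and subwords; it fixes black letters
and relabels the red word. -/
theorem wordMap_mem_Gam (e : PolEquiv T T') {d : ℕ} {Q : FreeMonoid (Pol.evenCentralRegular T)}
    {X : FreeMonoid (Strand T)} (hX : X ∈ Gam T d Q) :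
    e.wordMap X ∈ Gam T' d (FreeMonoid.map e.onLabels Q) := by
  have h1 : e.wordMap (bl T ^ d) = bl T' ^ d := map_pow _ _ _
  have h2 : e.wordMap (redWord Q) = redWord (FreeMonoid.map e.onLabels Q) := by
    have h : e.wordMap.comp (FreeMonoid.map Strand.red) =
        (FreeMonoid.map Strand.red).comp (FreeMonoid.map e.onLabels) :=
      FreeMonoid.hom_eq fun _ => rfl
    exact DFunLike.congr_fun h Q
  obtain ⟨hl, hb, hr⟩ := hX
  rw [Gam, ← h1, ← h2]
  simp only [wordMap, shuffles, FreeMonoid.toList_map, List.length_map, Set.mem_ofPred_eq]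
  exact ⟨hl, hb.map _, hr.map _⟩

theorem symm_onLabels_onLabels (e : PolEquiv T T') (Q : FreeMonoid (Pol.evenCentralRegular T)) :
    FreeMonoid.map e.symm.onLabels (FreeMonoid.map e.onLabels Q) = Q := by
  have h : (FreeMonoid.map e.symm.onLabels).comp (FreeMonoid.map e.onLabels) = MonoidHom.id _ :=
    FreeMonoid.hom_eq fun Q => congrArg FreeMonoid.of (Subtype.ext (e.equiv.symm_apply_apply Q))
  exact DFunLike.congr_fun h Q

/-- The bijection between the sets of shuffles. -/
noncomputable def gamEquiv (e : PolEquiv T T') (d : ℕ) (Q : FreeMonoid (Pol.evenCentralRegular T)) :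
    Gam T d Q ≃ Gam T' d (FreeMonoid.map e.onLabels Q) :=
  Equiv.ofBijective (fun X => ⟨e.wordMap X, e.wordMap_mem_Gam X.2⟩) (by
    constructor
    · intro X Y h
      have h' := congrArg (e.symm.onObj B) (congrArg Subtype.val h)
      exact Subtype.ext ((symm_onObj_onObj B e X.1).symm.trans (h'.trans (symm_onObj_onObj B e Y.1)))
    · intro Y
      have h := e.symm.wordMap_mem_Gam Y.2
      rw [symm_onLabels_onLabels] at h
      exact ⟨⟨_, h⟩, Subtype.ext (symm_onObj_onObj B e.symm Y.1)⟩)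

/-- Applying the functor to entries yields matrices over the relabelled objects, still indexed by
the shuffles of the first word. Reindexing identifies these with the second algebra. Both steps
detect parity entrywise, so the composite is an isomorphism of superalgebras. -/
theorem exists_wAff_equiv (e : PolEquiv T T')
    {F : MonoidalSuperfunctor (LAWCat B T) (LAWCat B T') (e.onObj B)}
    {G : MonoidalSuperfunctor (LAWCat B T') (LAWCat B T) (e.symm.onObj B)}
    (h : MutuallyInverse F G) (d : ℕ) (Q : FreeMonoid (Pol.evenCentralRegular T)) :
    ∃ f : WAff B T d Q ≃ₐ[k] WAff B T' d (FreeMonoid.map e.onLabels Q),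
      ∀ p w, f w ∈ AddEnd.parity p ↔ w ∈ AddEnd.parity p := by
  let X : Gam T d Q → (LAWCat B T).Obj := fun i => LAWCat.obj B (i : FreeMonoid (Strand T))
  let Y : Gam T' d (FreeMonoid.map e.onLabels Q) → (LAWCat B T').Obj :=
    fun i => LAWCat.obj B (i : FreeMonoid (Strand T'))
  let f₁ := AlgEquiv.ofBijective (AddEnd.map F X) (h.addEnd_map_bijective X)
  let f₂ : WAff B T' d (FreeMonoid.map e.onLabels Q) ≃ₐ[k]
      (LAWCat B T').AddEnd fun i => e.onObj B (X i) :=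
    AlgEquiv.ofBijective (AddEnd.reindex (e.gamEquiv B d Q) Y)
      (AddEnd.reindex_bijective (e.gamEquiv B d Q) Y)
  -- Reindexing pulls matrices back from the second set of shuffles to the first, so it is used in
  -- the inverse direction.
  refine ⟨f₁.trans f₂.symm, fun p w => ?_⟩
  have h₂ := AddEnd.reindex_mem_parity_iff (e.gamEquiv B d Q) Y (f₂.symm (f₁ w)) p
  have h₃ : AddEnd.reindex (e.gamEquiv B d Q) Y (f₂.symm (f₁ w)) = f₁ w := f₂.apply_symm_apply (f₁ w)
  rw [h₃] at h₂
  exact h₂.symm.trans (forall₂_congr fun j i => h.map_mem_parity_iff (w j i) p)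

end PolEquiv

end LAW

theorem proposition5p23 {k A ι : Type*} [CommRing k] [Ring A] [Algebra k A]
    (𝒜 : ZMod 2 → Submodule k A) [GradedAlgebra 𝒜] [Fintype ι] (B : HomogBasis 𝒜 ι)
    (T T' : FrobeniusTrace 𝒜) :
    (∃ u : Aˣ, RelatesTraces T T' u) ∧
    ∀ u : Aˣ, RelatesTraces T T' u →
      ∃ Ψ : PolEquiv T T',
        ((∀ a, Ψ.equiv (Pol.tok T 0 a) = Pol.tok T' 0 a) ∧
          Ψ.equiv (Pol.dot T 0) =
            ksgn k (T.par + T'.par) • (Pol.dot T' 0 * Pol.tok T' 0 (u : A))) ∧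
        (∃ (F : MonoidalSuperfunctor (LAWCat B T) (LAWCat B T') (Ψ.onObj B))
            (G : MonoidalSuperfunctor (LAWCat B T') (LAWCat B T) (Ψ.symm.onObj B)),
          MutuallyInverse F G ∧
          ((∀ a, F.map (LAWCat.tok B T a) = LAWCat.tok B T' a) ∧
            F.map (LAWCat.dot B T) = ksgn k (T.par + T'.par) •
              (LAWCat B T').comp (LAWCat.dot B T') (LAWCat.tok B T' (u : A)) ∧
            F.map (LAWCat.cross B T) = LAWCat.cross B T' ∧
            (∀ Q, F.map (LAWCat.redBlack B Q) = LAWCat.redBlack B (Ψ.onLabels Q)) ∧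
            ∀ Q, F.map (LAWCat.blackRed B Q) = LAWCat.blackRed B (Ψ.onLabels Q)) ∧
          ((∀ a, G.map (LAWCat.tok B T' a) = LAWCat.tok B T a) ∧
            G.map (LAWCat.dot B T') = ksgn k (T.par + T'.par) •
              (LAWCat B T).comp (LAWCat.dot B T) (LAWCat.tok B T ((u⁻¹ : Aˣ) : A)) ∧
            G.map (LAWCat.cross B T') = LAWCat.cross B T ∧
            (∀ Q, G.map (LAWCat.redBlack B Q) = LAWCat.redBlack B (Ψ.symm.onLabels Q)) ∧
            ∀ Q, G.map (LAWCat.blackRed B Q) = LAWCat.blackRed B (Ψ.symm.onLabels Q))) ∧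
        ∀ (d : ℕ), 0 < d → ∀ Q : FreeMonoid (Pol.evenCentralRegular T),
          ∃ e : WAff B T d Q ≃ₐ[k] WAff B T' d (FreeMonoid.map Ψ.onLabels Q),
            ∀ p w, e w ∈ MonoidalSupercat.AddEnd.parity p ↔
              w ∈ MonoidalSupercat.AddEnd.parity p := by
  refine ⟨exists_relatesTraces T T', fun u hu => ?_⟩
  have he : (Pol.traceEquiv hu).IsTraceChange u :=
    ⟨hu, Pol.traceMap_tok hu 0, Pol.traceMap_dot hu 0⟩
  have hFG := PolEquiv.mutuallyInverse_traceFunctor B he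
  refine ⟨Pol.traceEquiv hu, ⟨he.tok, he.dot⟩,
    ⟨PolEquiv.traceFunctor B he, PolEquiv.traceFunctor B he.symm, hFG, ⟨?_, ?_, ?_, ?_, ?_⟩,
      ⟨?_, ?_, ?_, ?_, ?_⟩⟩, fun d _ Q => PolEquiv.exists_wAff_equiv B _ hFG d Q⟩
  · exact PolEquiv.traceFunctor_tok B he
  · exact PolEquiv.traceFunctor_dot B he
  · exact PolEquiv.traceFunctor_gen B he .cross
  · exact fun Q => PolEquiv.traceFunctor_gen B he (.redBlack Q)
  · exact fun Q => PolEquiv.traceFunctor_gen B he (.blackRed Q)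
  · exact PolEquiv.traceFunctor_tok B he.symm
  -- The construction for `u⁻¹` interchanges the two traces, so its sign is `(-1)^(ε' + ε)`.
  · rw [add_comm T.par]
    exact PolEquiv.traceFunctor_dot B he.symm
  · exact PolEquiv.traceFunctor_gen B he.symm .cross
  · exact fun Q => PolEquiv.traceFunctor_gen B he.symm (.redBlack Q)
  · exact fun Q => PolEquiv.traceFunctor_gen B he.symm (.blackRed Q)
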